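/- An instance of the $k$-Median problem consists of a finite set $U$ of centers, a finite set $W$ of $n$ customers, an integer $k$, and costs $c_{ij}\in[0,\infty]$ for $i\in U$, $j\in W$. Let $E=\{(i,j)\in U\times W : c_{ij}<\infty\}$ and $m=|E|$. The cost of a set $C\subseteq U$ is $c(C)=\sum_{j\in W}\min_{i\in C}c_{ij}$ (a minimum over the empty set being $\infty$). Let $\lambda^*\in[0,\infty]$ be the optimum of the standard linear-programming relaxation: minimize $\sum_{i,j}c_{ij}y_{ij}$ (with $\infty\cdot 0=0$) subject to $x_i\ge y_{ij}\ge 0$ for all $i\in U$, $j\in W$; $\sum_i y_{ij}=1$ for all $j\in W$; $\sum_i x_i=k$ (so $\lambda^*=\infty$ if this is infeasible). Put $$T=\Big\lceil k\ln\frac{n^2}{2k(2k+1)}\Big\rceil,\qquad \alpha_{kn}=\frac{T}{k}+2 .$$ **Theorem.** There are a deterministic real-RAM algorithm and a constant $K$ such that the following holds for all $k\ge 1$ and $n>2k$ and every instance with $n$ customers. Given $k$, $|U|$, $n$, $m$ and a list, in any order, of the $m$ edges $(i,j)\in E$ with their costs, the algorithm halts after at most $K\cdot\max\{1,\;k\,m\,\ln(n/k)\,\ln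 m\}$ steps (with $\ln 0$ read as $0$), that is, in time $O(k\,m\log(n/k)\log m)$, and outputs a set $C\subseteq U$ with $|C|\le\alpha_{kn}\,k=T+2k$ and $c(C)\le\lambda^*$; moreover $c(C)\le c(C')$ for every $C'\subseteq U$ with $|C'|\le k$. Furthermore $\alpha_{kn}<1+2\ln(n/k)$ whenever $k\ge 2$ and $n>2k$. Here a real RAM is a machine with integer and real memory cells, addressed by integers, that in one step performs a memory access, an exact addition, subtraction, multiplication or division of reals, a conversion of an integer to a real, an addition, truncated subtraction or halving (rounded down) of nonnegative integers, or a comparison. -/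

import Mathlib

open scoped ENNReal NNReal

/-! ## A real random-access machine

Programs of a structured imperative language over two kinds of memory cells, holding natural
numbers and real numbers.  A cell is addressed by the name of an array (fixed in the program text)
and an index (computed at run time); a program mentions only finitely many arrays.  Every
elementary operation (constant, memory access, addition, subtraction, halving, real arithmetic,
comparison) takes one step.  There is no rounding of reals to integers, and no real constant
other than natural numbers. -/

namespace RealRAM

/-- Memory contents: `nat a i` and `real a i` are the `i`-th cells of the `a`-th integer array and
of the `a`-th real array. -/
structure Memory where
  nat : ℕ → ℕ → ℕ
  real : ℕ → ℕ → ℝ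

/-- Expressions for natural numbers; subtraction is truncated, `half` is `⌊· / 2⌋`. -/
inductive NatExpr where
  | const (v : ℕ)
  | read (a : ℕ) (i : NatExpr)
  | add (e f : NatExpr)
  | sub (e f : NatExpr)
  | half (e : NatExpr)

/-- The value of an expression. -/
def NatExpr.eval (s : Memory) : NatExpr → ℕ
  | const v => v
  | read a i => s.nat a (i.eval s)
  | add e f => e.eval s + f.eval s
  | sub e f => e.eval s - f.eval s
  | half e => e.eval s / 2

/-- The number of elementary operations in an expression. -/
def NatExpr.cost : NatExpr → ℕ
  | const _ => 1
  | read _ i => i.cost + 1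
  | add e f => e.cost + f.cost + 1
  | sub e f => e.cost + f.cost + 1
  | half e => e.cost + 1

/-- Expressions for real numbers; `ofNat` converts an integer to a real, and the machine
returns `0` when asked to divide by `0`. -/
inductive RealExpr where
  | ofNat (e : NatExpr)
  | read (a : ℕ) (i : NatExpr)
  | add (e f : RealExpr)
  | sub (e f : RealExpr)
  | mul (e f : RealExpr)
  | div (e f : RealExpr)

/-- The value of an expression. -/
noncomputable def RealExpr.eval (s : Memory) : RealExpr → ℝ
  | ofNat e => (e.eval s : ℝ)
  | read a i => s.real a (i.eval s)
  | add e f => e.eval s + f.eval s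
  | sub e f => e.eval s - f.eval s
  | mul e f => e.eval s * f.eval s
  | div e f => e.eval s / f.eval s

/-- The number of elementary operations in an expression. -/
def RealExpr.cost : RealExpr → ℕ
  | ofNat e => e.cost + 1
  | read _ i => i.cost + 1
  | add e f => e.cost + f.cost + 1
  | sub e f => e.cost + f.cost + 1
  | mul e f => e.cost + f.cost + 1
  | div e f => e.cost + f.cost + 1

/-- Conditions: comparisons of integers, comparisons of reals, and Boolean combinations. -/
inductive Test where
  | natLe (e f : NatExpr)
  | realLe (e f : RealExpr)
  | not (b : Test)
  | and (b d : Test)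

/-- The truth of a condition. -/
def Test.Holds (s : Memory) : Test → Prop
  | natLe e f => e.eval s ≤ f.eval s
  | realLe e f => e.eval s ≤ f.eval s
  | not b => ¬ b.Holds s
  | and b d => b.Holds s ∧ d.Holds s

/-- The number of elementary operations in a condition. -/
def Test.cost : Test → ℕ
  | natLe e f => e.cost + f.cost + 1
  | realLe e f => e.cost + f.cost + 1
  | not b => b.cost + 1
  | and b d => b.cost + d.cost + 1

/-- Programs. `setNat a i e` writes the value of `e` to cell `i` of the integer array `a`. -/
inductive Program where
  | skip
  | setNat (a : ℕ) (i e : NatExpr)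
  | setReal (a : ℕ) (i : NatExpr) (e : RealExpr)
  | seq (P Q : Program)
  | ite (b : Test) (P Q : Program)
  | while (b : Test) (P : Program)

/-- Overwrite one integer cell. -/
def Memory.writeNat (s : Memory) (a i v : ℕ) : Memory where
  nat := Function.update s.nat a (Function.update (s.nat a) i v)
  real := s.real

/-- Overwrite one real cell. -/
def Memory.writeReal (s : Memory) (a i : ℕ) (v : ℝ) : Memory where
  nat := s.nat
  real := Function.update s.real a (Function.update (s.real a) i v)

/-- `Runs P s t s'`: started with memory `s`, the program `P` halts after exactly `t` steps,
leaving memory `s'`. -/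
inductive Runs : Program → Memory → ℕ → Memory → Prop where
  | skip (s : Memory) : Runs Program.skip s 1 s
  | setNat (s : Memory) (a : ℕ) (i e : NatExpr) :
      Runs (Program.setNat a i e) s (i.cost + e.cost + 1)
        (s.writeNat a (i.eval s) (e.eval s))
  | setReal (s : Memory) (a : ℕ) (i : NatExpr) (e : RealExpr) :
      Runs (Program.setReal a i e) s (i.cost + e.cost + 1)
        (s.writeReal a (i.eval s) (e.eval s))
  | seq {P Q : Program} {s s' s'' : Memory} {t t' : ℕ} :
      Runs P s t s' → Runs Q s' t' s'' → Runs (Program.seq P Q) s (t + t') s''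
  | iteTrue {b : Test} {P Q : Program} {s s' : Memory} {t : ℕ} :
      b.Holds s → Runs P s t s' → Runs (Program.ite b P Q) s (b.cost + 1 + t) s'
  | iteFalse {b : Test} {P Q : Program} {s s' : Memory} {t : ℕ} :
      ¬ b.Holds s → Runs Q s t s' → Runs (Program.ite b P Q) s (b.cost + 1 + t) s'
  | whileTrue {b : Test} {P : Program} {s s' s'' : Memory} {t t' : ℕ} :
      b.Holds s → Runs P s t s' → Runs (Program.while b P) s' t' s'' →
        Runs (Program.while b P) s (b.cost + 1 + t + t') s''
  | whileFalse {b : Test} {P : Program} {s : Memory} :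
      ¬ b.Holds s → Runs (Program.while b P) s (b.cost + 1) s

end RealRAM

/-! ## The `k`-Median problem

An instance with centers `Fin p` and customers `Fin n` is given by its costs
`c i j ∈ [0, ∞]`; the edges of the bipartite graph are the pairs of finite cost. -/

namespace KMedian

variable {p n : ℕ}

/-- The edge set: the center/customer pairs of finite cost. -/
noncomputable def edges (c : Fin p → Fin n → ℝ≥0∞) : Finset (Fin p × Fin n) :=
  open Classical in Finset.univ.filter (fun q => c q.1 q.2 ≠ ∞)

/-- The cost of a set `C` of centers: each customer is assigned to its closest center in `C`
(at cost `∞` if `C` is empty). -/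
noncomputable def cost (c : Fin p → Fin n → ℝ≥0∞) (C : Finset (Fin p)) : ℝ≥0∞ :=
  ∑ j, ⨅ i ∈ C, c i j

/-- Feasibility for the standard linear-programming relaxation. -/
structure LPFeasible (k : ℕ) (x : Fin p → ℝ≥0) (y : Fin p → Fin n → ℝ≥0) : Prop where
  le : ∀ i j, y i j ≤ x i
  assigned : ∀ j, ∑ i, y i j = 1
  size : ∑ i, x i = (k : ℝ≥0)

/-- The optimum cost of the linear-programming relaxation (`∞` if it is infeasible);
here `∞ * 0 = 0`. -/
noncomputable def lpOpt (c : Fin p → Fin n → ℝ≥0∞) (k : ℕ) : ℝ≥0∞ :=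
  ⨅ (x : Fin p → ℝ≥0) (y : Fin p → Fin n → ℝ≥0) (_ : LPFeasible k x y),
    ∑ i, ∑ j, c i j * (y i j : ℝ≥0∞)

/-- The integer `T = ⌈k ln (n² / (2k(2k+1)))⌉`. -/
noncomputable def greedySize (k n : ℕ) : ℤ :=
  ⌈(k : ℝ) * Real.log ((n : ℝ) ^ 2 / (2 * k * (2 * k + 1)))⌉

/-- The size-approximation ratio `T / k + 2`. -/
noncomputable def sizeRatio (k n : ℕ) : ℝ := (greedySize k n : ℝ) / k + 2

/-- The memory holding the input. Integer array `0` holds `k`, the numbers of centers, customers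
and edges; integer arrays `1`, `2` and real array `0` hold the center, the customer and the cost of
each edge, in the order given by `e`. All other cells are zero. -/
noncomputable def input (c : Fin p → Fin n → ℝ≥0∞) (k : ℕ)
    (e : Fin (edges c).card ≃ edges c) : RealRAM.Memory where
  nat a t :=
    if a = 0 then
      if t = 0 then k else if t = 1 then p else if t = 2 then n
      else if t = 3 then (edges c).card else 0
    else if h : t < (edges c).card then
      if a = 1 then ((e ⟨t, h⟩).1.1 : ℕ) else if a = 2 then ((e ⟨t, h⟩).1.2 : ℕ) else 0
    else 0
  real a t :=
    if h : t < (edges c).card then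
      if a = 0 then (c (e ⟨t, h⟩).1.1 (e ⟨t, h⟩).1.2).toReal else 0
    else 0

/-- The memory `s` holds the output `C`: cell `0` of integer array `3` holds `|C|`, and the first
`|C|` cells of integer array `4` list the elements of `C`. -/
def IsOutput (s : RealRAM.Memory) (C : Finset (Fin p)) : Prop :=
  s.nat 3 0 = C.card ∧ (Finset.range C.card).image (s.nat 4) = C.image Fin.val

end KMedian

/-! Reduced costs. Subtracting from the costs at each customer its distance to the nearest center
changes the cost of every fractional assignment by the same amount (`EdgeList.LPValue.shift`). So
one may work with nonnegative costs such that every customer with an edge has a free one.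

Capped greedy. Let L > 0 be the reduced LP value, ρ = n / ((2k+1)(n-2k)) (`capRatio`), and let a
customer without a close enough center pay the cap ρL. Averaging over the centers with weights x_i /
k shows that some center lowers the capped cost H by at least (H - L) / k
(`EdgeList.LPValue.exists_gain_le`). Starting from nρL, the capped cost therefore falls below L
n/(n-2k) = (2k+1)ρL within T steps (`potential_lt_stopRatio`). Then at most 2k customers are
unassigned. Serving the 2k most expensive customers by their free edges scales the capped cost by at
most (n-2k)/n (`Trimmed.step`): everybody is assigned, at cost at most L, by at most T + 2k centers.

Unknown L. The value L is not computed. A run knows only a threshold b, one of the reduced costs,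
below which an edge counts as cheaper than the cap. Each step picks the center that needs the
smallest budget to keep the capped cost below budget times `potential`, and L is the maximum of the
budgets needed. By the averaging argument no positive budget that the LP realizes and that is
compatible with b is smaller (the field `complete` of `Greedy`). The recurrence for `potential` adds
slightly more than 1/k, which makes the relevant inequality strict and the budget a quotient with
positive denominator.

Threshold. A binary search runs over the sorted reduced costs. A run at rank q is accepted if ρ
times its budget is at most the next value; a rejected run proves that ρ times the LP value exceeds
the next value (`Greedy.lt_of_unsuccessful`). Where the two outcomes meet, the saved run has a
budget of at most the LP value (`Searching.savedOptimal`).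

Time. A greedy step makes a bounded number of passes over the edges, a run has at most T steps, and
there are O(log m) runs. Programs are verified by Hoare triples with step bounds (`Ends`), weakest
preconditions for loop-free pieces (`Ends.of_wp`), a counting-loop rule (`Ends.forTo`) and frames
(`Runs.same`). -/

namespace RealRAM

/-! ### Total correctness with a time bound -/

/-- Started in `s`, the program `P` halts after at most `N` steps in a memory satisfying `Q`. -/
def Ends (P : Program) (s : Memory) (N : ℕ) (Q : Memory → Prop) : Prop :=
  ∃ t s', Runs P s t s' ∧ t ≤ N ∧ Q s'

theorem Ends.mono {P : Program} {s : Memory} {N N' : ℕ} {Q Q' : Memory → Prop}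
    (h : Ends P s N Q) (hN : N ≤ N') (hQ : ∀ s', Q s' → Q' s') : Ends P s N' Q' := by
  obtain ⟨t, s', hr, ht, hq⟩ := h
  exact ⟨t, s', hr, ht.trans hN, hQ _ hq⟩

theorem Ends.seq {P P' : Program} {s : Memory} {N N' : ℕ} {R Q : Memory → Prop}
    (h : Ends P s N R) (h' : ∀ s', R s' → Ends P' s' N' Q) :
    Ends (.seq P P') s (N + N') Q := by
  obtain ⟨t, s', hr, ht, hq⟩ := h
  obtain ⟨t', s'', hr', ht', hq'⟩ := h' s' hq
  exact ⟨t + t', s'', .seq hr hr', by omega, hq'⟩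

theorem Ends.ite {b : Test} {P P' : Program} {s : Memory} {N : ℕ} {Q : Memory → Prop}
    (h : b.Holds s → Ends P s N Q) (h' : ¬ b.Holds s → Ends P' s N Q) :
    Ends (.ite b P P') s (b.cost + 1 + N) Q := by
  by_cases hb : b.Holds s
  · obtain ⟨t, s', hr, ht, hq⟩ := h hb
    exact ⟨_, s', .iteTrue hb hr, by omega, hq⟩
  · obtain ⟨t, s', hr, ht, hq⟩ := h' hb
    exact ⟨_, s', .iteFalse hb hr, by omega, hq⟩

/-- The loop rule: `v` bounds the number of remaining iterations. -/
theorem Ends.while {b : Test} {P : Program} {B : ℕ} (I : ℕ → Memory → Prop)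
    (h : ∀ v s, I v s → b.Holds s → Ends P s B (fun s' => ∃ v' < v, I v' s')) :
    ∀ v s, I v s → Ends (.while b P) s (v * (B + b.cost + 1) + b.cost + 1)
      (fun s' => (∃ v', I v' s') ∧ ¬ b.Holds s') := by
  intro v
  induction v using Nat.strong_induction_on with
  | _ v ih =>
    intro s hs
    by_cases hb : b.Holds s
    · obtain ⟨t, s', hr, ht, v', hv', hI⟩ := h v s hs hb
      obtain ⟨t', s'', hr', ht', hq⟩ := ih v' hv' s' hI
      refine ⟨_, s'', .whileTrue hb hr hr', ?_, hq⟩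
      have : (v' + 1) * (B + b.cost + 1) ≤ v * (B + b.cost + 1) := Nat.mul_le_mul_right _ hv'
      rw [Nat.add_mul, Nat.one_mul] at this
      omega
    · exact ⟨_, s, .whileFalse hb, by omega, ⟨v, hs⟩, hb⟩

/-- The weakest precondition of a loop-free program. -/
def wp : Program → (Memory → Prop) → Memory → Prop
  | .skip, Q, s => Q s
  | .setNat a i e, Q, s => Q (s.writeNat a (i.eval s) (e.eval s))
  | .setReal a i e, Q, s => Q (s.writeReal a (i.eval s) (e.eval s))
  | .seq P P', Q, s => wp P (wp P' Q) s
  | .ite b P P', Q, s => (b.Holds s → wp P Q s) ∧ (¬ b.Holds s → wp P' Q s)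
  | .while _ _, _, _ => False

/-- A bound on the number of steps of a loop-free program. -/
def Program.bodyCost : Program → ℕ
  | .skip => 1
  | .setNat _ i e => i.cost + e.cost + 1
  | .setReal _ i e => i.cost + e.cost + 1
  | .seq P P' => P.bodyCost + P'.bodyCost
  | .ite b P P' => b.cost + 1 + (P.bodyCost + P'.bodyCost)
  | .while _ _ => 0

/-- Loop-free code is verified by evaluating `wp`. Since `bodyCost` adds up both branches of a
conditional, it is a closed numeral, and time bounds for concrete code hold by computation. -/
theorem Ends.of_wp {P : Program} : ∀ {s : Memory} {Q : Memory → Prop},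
    wp P Q s → Ends P s P.bodyCost Q := by
  induction P with
  | skip => exact fun h => ⟨_, _, .skip _, le_rfl, h⟩
  | setNat a i e => exact fun h => ⟨_, _, .setNat _ _ _ _, le_rfl, h⟩
  | setReal a i e => exact fun h => ⟨_, _, .setReal _ _ _ _, le_rfl, h⟩
  | seq P P' ih ih' => exact fun h => (ih h).seq fun _ h' => ih' h'
  | ite b P P' ih ih' =>
    exact fun h => Ends.ite (fun hb => (ih (h.1 hb)).mono (Nat.le_add_right _ _) fun _ => id)
      (fun hb => (ih' (h.2 hb)).mono (Nat.le_add_left _ _) fun _ => id)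
  | _ => exact fun h => h.elim

/-! ### Frames -/

/-- Whether the program writes to the integer array `a`. -/
def Program.writesNat (a : ℕ) : Program → Bool
  | .skip => false
  | .setNat a' _ _ => a.beq a'
  | .setReal _ _ _ => false
  | .seq P P' => P.writesNat a || P'.writesNat a
  | .ite _ P P' => P.writesNat a || P'.writesNat a
  | .while _ P => P.writesNat a

/-- Whether the program writes to the real array `a`. -/
def Program.writesReal (a : ℕ) : Program → Bool
  | .skip => false
  | .setNat _ _ _ => false
  | .setReal a' _ _ => a.beq a'
  | .seq P P' => P.writesReal a || P'.writesReal a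
  | .ite _ P P' => P.writesReal a || P'.writesReal a
  | .while _ P => P.writesReal a

/-- The memories agree on all arrays to which `P` does not write. -/
structure Same (P : Program) (s s' : Memory) : Prop where
  nat : ∀ a, P.writesNat a = false → s'.nat a = s.nat a
  real : ∀ a, P.writesReal a = false → s'.real a = s.real a

theorem Same.refl (P : Program) (s : Memory) : Same P s s := ⟨fun _ _ => rfl, fun _ _ => rfl⟩

theorem Same.trans {P : Program} {s s' s'' : Memory} (h : Same P s s') (h' : Same P s' s'') :
    Same P s s'' :=
  ⟨fun a ha => (h'.nat a ha).trans (h.nat a ha), fun a ha => (h'.real a ha).trans (h.real a ha)⟩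

theorem Same.of_imp {P P' : Program} {s s' : Memory} (h : Same P s s')
    (hn : ∀ a, P'.writesNat a = false → P.writesNat a = false)
    (hr : ∀ a, P'.writesReal a = false → P.writesReal a = false) : Same P' s s' :=
  ⟨fun a ha => h.nat a (hn a ha), fun a ha => h.real a (hr a ha)⟩

theorem Same.seq_left {P P' : Program} {s s' : Memory} (h : Same P s s') :
    Same (.seq P P') s s' :=
  h.of_imp (fun a ha => by simp only [Program.writesNat, Bool.or_eq_false_iff] at ha; exact ha.1)
    (fun a ha => by simp only [Program.writesReal, Bool.or_eq_false_iff] at ha; exact ha.1)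

theorem Same.seq_right {P P' : Program} {s s' : Memory} (h : Same P' s s') :
    Same (.seq P P') s s' :=
  h.of_imp (fun a ha => by simp only [Program.writesNat, Bool.or_eq_false_iff] at ha; exact ha.2)
    (fun a ha => by simp only [Program.writesReal, Bool.or_eq_false_iff] at ha; exact ha.2)

/-- The frame rule. Whether an array is written is a Boolean function of the program text, so that
the side conditions for concrete programs are proved by `rfl`. -/
theorem Runs.same {P : Program} {s s' : Memory} {t : ℕ} (h : Runs P s t s') : Same P s s' := by
  induction h with
  | skip s => exact .refl _ _
  | setNat s a i e =>
    refine ⟨fun a' ha => ?_, fun _ _ => rfl⟩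
    have : a' ≠ a := fun h => by simp [Program.writesNat, h] at ha
    simp [Memory.writeNat, this]
  | setReal s a i e =>
    refine ⟨fun _ _ => rfl, fun a' ha => ?_⟩
    have : a' ≠ a := fun h => by simp [Program.writesReal, h] at ha
    simp [Memory.writeReal, this]
  | seq _ _ ih ih' => exact ih.seq_left.trans ih'.seq_right
  | iteTrue _ _ ih =>
    exact ih.of_imp
      (fun a ha => by simp only [Program.writesNat, Bool.or_eq_false_iff] at ha; exact ha.1)
      (fun a ha => by simp only [Program.writesReal, Bool.or_eq_false_iff] at ha; exact ha.1)
  | iteFalse _ _ ih =>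
    exact ih.of_imp
      (fun a ha => by simp only [Program.writesNat, Bool.or_eq_false_iff] at ha; exact ha.2)
      (fun a ha => by simp only [Program.writesReal, Bool.or_eq_false_iff] at ha; exact ha.2)
  | whileTrue _ _ _ ih ih' => exact Same.trans ⟨ih.nat, ih.real⟩ ih'
  | whileFalse _ => exact .refl _ _

theorem Ends.same {P : Program} {s : Memory} {N : ℕ} {Q : Memory → Prop} (h : Ends P s N Q) :
    Ends P s N (fun s' => Q s' ∧ Same P s s') := by
  obtain ⟨t, s', hr, ht, hq⟩ := h
  exact ⟨t, s', hr, ht, hq, hr.same⟩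

theorem Ends.seq_same {P P' : Program} {s : Memory} {N N' : ℕ} {R Q : Memory → Prop}
    (h : Ends P s N R) (h' : ∀ s', R s' → Same P s s' → Ends P' s' N' Q) :
    Ends (.seq P P') s (N + N') Q :=
  h.same.seq fun s' hs => h' s' hs.1 hs.2

/-! ### Abbreviations -/

/-- Cell `0` of an integer array. -/
abbrev nvar (a : ℕ) : NatExpr := .read a (.const 0)

/-- Cell `0` of a real array. -/
abbrev rvar (a : ℕ) : RealExpr := .read a (.const 0)

/-- Assignment to cell `0` of an integer array. -/
abbrev letNat (a : ℕ) (e : NatExpr) : Program := .setNat a (.const 0) e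

/-- Assignment to cell `0` of a real array. -/
abbrev letReal (a : ℕ) (e : RealExpr) : Program := .setReal a (.const 0) e

/-- Increase a counter by one. -/
abbrev incr (a : ℕ) : Program := letNat a (.add (nvar a) (.const 1))

/-- Run the program for the values `0, 1, …, e - 1` of the counter `v`. -/
def forTo (v : ℕ) (e : NatExpr) (P : Program) : Program :=
  .seq (letNat v (.const 0))
    (.while (.natLe (.add (nvar v) (.const 1)) e) (.seq P (incr v)))

infixr:60 " ;; " => Program.seq

/-- The frame is carried along with the invariant, so `I` need only describe arrays that the loop
modifies. For the same reason `he` only asks for the value of the bound in memories that agree with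
`s₀` outside the written arrays. -/
theorem Ends.forTo {v : ℕ} {e : NatExpr} {P : Program} {N B : ℕ} {s₀ : Memory}
    (I : ℕ → Memory → Prop) (h0 : I 0 (s₀.writeNat v 0 0))
    (he : ∀ s, Same (RealRAM.forTo v e P) s₀ s → e.eval s = N)
    (h : ∀ u < N, ∀ s, Same (RealRAM.forTo v e P) s₀ s → s.nat v 0 = u → I u s →
      Ends (P ;; incr v) s B (fun s' => s'.nat v 0 = u + 1 ∧ I (u + 1) s')) :
    Ends (RealRAM.forTo v e P) s₀ ((N + 1) * (B + e.cost + 10)) (I N) := by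
  have hw : Same (letNat v (.const 0)) s₀ (s₀.writeNat v 0 0) := (Runs.setNat s₀ v _ _).same
  have key := Ends.while (b := .natLe (.add (nvar v) (.const 1)) e) (P := P ;; incr v) (B := B)
    (fun r s => ∃ u, u + r = N ∧ s.nat v 0 = u ∧ I u s ∧ Same (RealRAM.forTo v e P) s₀ s) ?_
    N (s₀.writeNat v 0 0) ⟨0, by omega, by simp [Memory.writeNat], h0, hw.seq_left⟩
  · have first : Ends (letNat v (.const 0)) s₀ 3 (fun s => s = s₀.writeNat v 0 0) :=
      Ends.of_wp (P := letNat v (.const 0)) (by simp [wp, NatExpr.eval])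
    refine (first.seq fun s' hs' => hs' ▸ key).mono ?_ fun s hs => ?_
    · simp only [Test.cost, NatExpr.cost]; ring_nf; omega
    · obtain ⟨⟨r, u, hu, hv, hI, hs⟩, hn⟩ := hs
      simp only [Test.Holds, NatExpr.eval] at hn
      rw [he s hs, hv] at hn
      have : u = N := by omega
      exact this ▸ hI
  · rintro r s ⟨u, hu, hv, hI, hs⟩ hb
    simp only [Test.Holds, NatExpr.eval, he s hs, hv] at hb
    refine (h u (by omega) s hs hv hI).same.mono le_rfl ?_
    rintro s' ⟨⟨hv', hI'⟩, hs'⟩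
    exact ⟨r - 1, by omega, u + 1, by omega, hv', hI', hs.trans (hs'.of_imp
      (fun a ha => by
        simp only [RealRAM.forTo, Program.writesNat, Bool.or_eq_false_iff] at ha ⊢; tauto)
      (fun a ha => by
        simp only [RealRAM.forTo, Program.writesReal, Bool.or_eq_false_iff] at ha ⊢; tauto))⟩

/-- Serves loop bodies that contain loops themselves, to which `wp` does not apply. -/
theorem Ends.then_incr {P : Program} {s : Memory} {B v u : ℕ} {R I : Memory → Prop}
    (h : Ends P s B R) (hv : P.writesNat v = false) (hs : s.nat v 0 = u)
    (hI : ∀ s', R s' → Same P s s' → I (s'.writeNat v 0 (u + 1))) :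
    Ends (P ;; incr v) s (B + 6) (fun s' => s'.nat v 0 = u + 1 ∧ I s') := by
  refine h.seq_same fun s' hR hP => (Ends.of_wp (P := incr v) ?_).mono le_rfl fun _ => id
  have : s'.nat v 0 = u := by rw [hP.nat v hv, hs]
  simp only [wp, NatExpr.eval, this]
  exact ⟨by simp [Memory.writeNat], hI s' hR hP⟩

end RealRAM

/-! ### Mathematics: edge lists, the averaging argument, the parameters, discarding customers -/

namespace KMedian

/-! ### Lists of edges -/

/-- A list of `m` distinct edges between `p` centers and `n` customers. -/
structure EdgeList where
  m : ℕ
  n : ℕ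
  p : ℕ
  center : ℕ → ℕ
  customer : ℕ → ℕ
  center_lt : ∀ t < m, center t < p
  customer_lt : ∀ t < m, customer t < n
  inj : ∀ t < m, ∀ t' < m, center t = center t' → customer t = customer t' → t = t'

/-- Whether a customer at distance `v` counts as unassigned with respect to the threshold `b`. -/
noncomputable def miss (b v : ℝ) : ℝ := if v ≤ b then 0 else 1

/-- The cost paid by a customer at distance `v`, if assigned. -/
noncomputable def paid (b v : ℝ) : ℝ := if v ≤ b then v else 0

/-- The cost of a customer at distance `v`, where unassigned customers pay `θ`. -/
noncomputable def capped (b θ v : ℝ) : ℝ := θ * miss b v + paid b v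

theorem miss_of_le {b v : ℝ} (h : v ≤ b) : miss b v = 0 := if_pos h
theorem miss_of_lt {b v : ℝ} (h : b < v) : miss b v = 1 := if_neg h.not_ge
theorem paid_of_le {b v : ℝ} (h : v ≤ b) : paid b v = v := if_pos h
theorem paid_of_lt {b v : ℝ} (h : b < v) : paid b v = 0 := if_neg h.not_ge

theorem capped_of_le {b θ v : ℝ} (h : v ≤ b) : capped b θ v = v := by
  simp [capped, miss_of_le h, paid_of_le h]

theorem capped_of_lt {b θ v : ℝ} (h : b < v) : capped b θ v = θ := by
  simp [capped, miss_of_lt h, paid_of_lt h]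

namespace EdgeList

variable (E : EdgeList) (d : ℕ → ℝ) (b : ℝ) (g : ℕ → ℝ)

/-- The edge `t` of cost at most `b` brings its customer closer. -/
def Improves (t : ℕ) : Prop := d t ≤ b ∧ d t < g (E.customer t)

open Classical in
/-- The distances after adding the center `i`, taking the first `u` edges into account. -/
noncomputable def relax (i : ℕ) : ℕ → ℕ → ℝ
  | 0 => g
  | u + 1 => if E.center u = i ∧ E.Improves d b (relax i u) u
      then Function.update (relax i u) (E.customer u) (d u) else relax i u

open Classical in
/-- The change of `∑ φ (g j)` on adding center `i`, taking the first `u` edges into account. -/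
noncomputable def gain (φ : ℝ → ℝ) (i u : ℕ) : ℝ :=
  ∑ t ∈ Finset.range u, if E.center t = i ∧ E.Improves d b g t
    then φ (d t) - φ (g (E.customer t)) else 0

variable {E d b g}

/-- Edges are distinct, so no two edges of the center `i` share a customer: until an edge of `i` is
processed, its customer keeps the old distance. -/
theorem relax_of_ge {i u : ℕ} (hu : u ≤ E.m) : ∀ t, u ≤ t → t < E.m → E.center t = i →
    E.relax d b g i u (E.customer t) = g (E.customer t) := by
  induction u with
  | zero => intros; rfl
  | succ u ih =>
    intro t ht htm hi
    rw [relax]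
    split_ifs with h
    · have : E.customer t ≠ E.customer u := fun h' => by
        have := E.inj t htm u (by omega) (hi.trans h.1.symm) h'
        omega
      rw [Function.update_of_ne this]
      exact ih (by omega) t (by omega) htm hi
    · exact ih (by omega) t (by omega) htm hi

/-- By `relax_of_ge`, testing an edge against the partly updated distances is the same as testing it
against the old ones. Hence gains computed beforehand, for all centers at once, predict the totals
after the update. -/
theorem sum_relax (φ : ℝ → ℝ) {i u : ℕ} (hu : u ≤ E.m) :
    ∑ j ∈ Finset.range E.n, φ (E.relax d b g i u j) =
      ∑ j ∈ Finset.range E.n, φ (g j) + E.gain d b g φ i u := by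
  induction u with
  | zero => simp [relax, gain]
  | succ u ih =>
    specialize ih (by omega)
    rw [gain, Finset.sum_range_succ, ← gain, ← add_assoc, ← ih, relax]
    by_cases hi : E.center u = i
    · have hg := relax_of_ge (d := d) (b := b) (g := g) (u := u) (by omega) u le_rfl (by omega) hi
      by_cases h : E.Improves d b g u
      · have h' : E.Improves d b (E.relax d b g i u) u := ⟨h.1, by rw [hg]; exact h.2⟩
        rw [if_pos ⟨hi, h'⟩, if_pos ⟨hi, h⟩]
        have hmem : E.customer u ∈ Finset.range E.n :=
          Finset.mem_range.2 (E.customer_lt u (by omega))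
        rw [← Finset.add_sum_erase _ _ hmem,
          ← Finset.add_sum_erase _ (fun j => φ (E.relax d b g i u j)) hmem, hg,
          Function.update_self]
        rw [Finset.sum_congr rfl fun j hj => by
          rw [Function.update_of_ne (Finset.ne_of_mem_erase hj)]]
        ring
      · have h' : ¬ E.Improves d b (E.relax d b g i u) u := fun h' =>
          h ⟨h'.1, by rw [← hg]; exact h'.2⟩
        rw [if_neg fun h => h' h.2, if_neg fun h'' => h h''.2, add_zero]
    · rw [if_neg fun h => hi h.1, if_neg fun h => hi h.1, add_zero]

/-- Every distance that changes is the cost of an actual edge at the new center; this keeps track of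
who serves whom. -/
theorem relax_cases {i u j : ℕ} : E.relax d b g i u j = g j ∨
    ∃ t < u, E.customer t = j ∧ E.center t = i ∧ E.relax d b g i u j = d t ∧ d t ≤ b := by
  induction u with
  | zero => exact .inl rfl
  | succ u ih =>
    rw [relax]
    split_ifs with h
    · by_cases hj : j = E.customer u
      · subst hj
        exact .inr ⟨u, by omega, rfl, h.1, Function.update_self .., h.2.1⟩
      · rw [Function.update_of_ne hj]
        exact ih.imp_right fun ⟨t, ht, h⟩ => ⟨t, by omega, h⟩
    · exact ih.imp_right fun ⟨t, ht, h⟩ => ⟨t, by omega, h⟩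

/-! ### The linear-programming relaxation and the averaging argument -/

variable (E d) in
/-- The linear-programming relaxation has a solution of cost at most `A`. -/
def LPValue (k : ℕ) (A : ℝ) : Prop :=
  ∃ x y : ℕ → ℝ, ∑ i ∈ Finset.range E.p, x i = k ∧ (∀ i, 0 ≤ x i) ∧
    (∀ t < E.m, 0 ≤ y t ∧ y t ≤ x (E.center t)) ∧
    (∀ j < E.n, ∑ t ∈ Finset.range E.m, (if E.customer t = j then y t else 0) = 1) ∧
    ∑ t ∈ Finset.range E.m, d t * y t ≤ A

theorem LPValue.mono {k : ℕ} {A A' : ℝ} (h : E.LPValue d k A) (hA : A ≤ A') :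
    E.LPValue d k A' := by
  obtain ⟨x, y, h1, h2, h3, h4, h5⟩ := h
  exact ⟨x, y, h1, h2, h3, h4, h5.trans hA⟩

theorem LPValue.nonneg {k : ℕ} {A : ℝ} (h : E.LPValue d k A) (hd : ∀ t < E.m, 0 ≤ d t) :
    0 ≤ A := by
  obtain ⟨x, y, h1, h2, h3, h4, h5⟩ := h
  refine le_trans (Finset.sum_nonneg fun t ht => ?_) h5
  exact mul_nonneg (hd t (Finset.mem_range.1 ht)) (h3 t (Finset.mem_range.1 ht)).1

theorem LPValue.exists_edge {k : ℕ} {A : ℝ} (h : E.LPValue d k A) {j : ℕ} (hj : j < E.n) :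
    ∃ t < E.m, E.customer t = j := by
  obtain ⟨x, y, -, -, -, h1, -⟩ := h
  by_contra! hno
  have := h1 j hj
  rw [Finset.sum_eq_zero fun t ht => if_neg (hno t (Finset.mem_range.1 ht))] at this
  exact zero_ne_one this

/-- Some center decreases the excess of the capped cost over the LP value by the factor
`1 - 1 / k`. -/
theorem LPValue.exists_gain_le {k : ℕ} (hk : 0 < k) {A θ : ℝ} (hA : E.LPValue d k A)
    (hm : 0 < E.m) (hb : b ≤ θ) (hsep : ∀ t < E.m, d t ≤ b ∨ θ ≤ d t) :
    ∃ t < E.m, E.gain d b g (capped b θ) (E.center t) E.m ≤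
      (A - ∑ j ∈ Finset.range E.n, capped b θ (g j)) / k := by
  classical
  obtain ⟨x, y, hx, hx0, hy, hy1, hcost⟩ := hA
  set H := ∑ j ∈ Finset.range E.n, capped b θ (g j) with hH
  have hk' : (0 : ℝ) < k := by exact_mod_cast hk
  set δ : ℕ → ℝ := fun t => if E.Improves d b g t
    then capped b θ (d t) - capped b θ (g (E.customer t)) else 0 with hδ
  have hδ0 : ∀ t, δ t ≤ 0 := by
    intro t
    simp only [hδ]
    split_ifs with h
    · rw [capped_of_le h.1]
      rcases le_or_gt (g (E.customer t)) b with h' | h'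
      · rw [capped_of_le h']; linarith [h.2]
      · rw [capped_of_lt h']; linarith [h.1]
    · exact le_rfl
  have hgain : ∀ i, E.gain d b g (capped b θ) i E.m =
      ∑ t ∈ Finset.range E.m, if E.center t = i then δ t else 0 := by
    intro i
    refine Finset.sum_congr rfl fun t _ => ?_
    by_cases h1 : E.center t = i <;> by_cases h2 : E.Improves d b g t <;> simp [hδ, h1, h2]
  have hgain0 : ∀ i, E.gain d b g (capped b θ) i E.m ≤ 0 := by
    intro i
    rw [hgain]
    refine Finset.sum_nonpos fun t _ => ?_
    split_ifs
    exacts [hδ0 t, le_rfl]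
  -- The constraint `y ≤ x` may be used because `δ ≤ 0`. The second factor compares `δ` with moving
  -- the customer to this edge unconditionally. For an edge that is no improvement that move gains
  -- nothing; if the customer is unassigned, the edge then costs more than `b`, hence at least the
  -- cap by `hsep`.
  have hδy : ∀ t < E.m, x (E.center t) * δ t ≤ y t * (d t - capped b θ (g (E.customer t))) := by
    intro t ht
    obtain ⟨h0, h1⟩ := hy t ht
    refine (mul_le_mul_of_nonpos_right h1 (hδ0 t)).trans (mul_le_mul_of_nonneg_left ?_ h0)
    simp only [hδ]
    split_ifs with h
    · rw [capped_of_le h.1]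
    · rw [sub_nonneg]
      rcases le_or_gt (g (E.customer t)) b with h' | h'
      · rw [capped_of_le h']
        by_contra! hlt
        exact h ⟨by linarith, hlt⟩
      · rw [capped_of_lt h']
        rcases hsep t ht with h2 | h2
        · exact absurd ⟨h2, h2.trans_lt h'⟩ h
        · exact h2
  -- Summed over the edges, the `d`-part is at most `A`, and the capped part is exactly `H` because
  -- each customer carries `y`-mass one.
  have hsum : ∑ i ∈ Finset.range E.p, x i * E.gain d b g (capped b θ) i E.m ≤ A - H := by
    have e1 : ∑ i ∈ Finset.range E.p, x i * E.gain d b g (capped b θ) i E.m =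
        ∑ t ∈ Finset.range E.m, x (E.center t) * δ t := by
      simp only [hgain, Finset.mul_sum]
      rw [Finset.sum_comm]
      refine Finset.sum_congr rfl fun t ht => ?_
      simp only [mul_ite, mul_zero]
      rw [Finset.sum_ite_eq, if_pos (Finset.mem_range.2 (E.center_lt t (Finset.mem_range.1 ht)))]
    have e2 : H = ∑ t ∈ Finset.range E.m, y t * capped b θ (g (E.customer t)) := by
      have : ∀ j ∈ Finset.range E.n, capped b θ (g j) = ∑ t ∈ Finset.range E.m,
          (if E.customer t = j then y t * capped b θ (g (E.customer t)) else 0) := by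
        intro j hj
        conv_lhs => rw [← one_mul (capped b θ (g j)), ← hy1 j (Finset.mem_range.1 hj),
          Finset.sum_mul]
        refine Finset.sum_congr rfl fun t _ => ?_
        split_ifs with h
        · rw [h]
        · simp
      rw [hH, Finset.sum_congr rfl this, Finset.sum_comm]
      refine Finset.sum_congr rfl fun t ht => ?_
      rw [Finset.sum_ite_eq,
        if_pos (Finset.mem_range.2 (E.customer_lt t (Finset.mem_range.1 ht)))]
    rw [e1, e2]
    refine (Finset.sum_le_sum fun t ht => hδy t (Finset.mem_range.1 ht)).trans ?_
    simp only [mul_sub, Finset.sum_sub_distrib]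
    simp only [mul_comm (d _)] at hcost
    linarith
  -- The center found must have an edge. If `H ≤ A`, any edge does. Otherwise the target is negative
  -- while centers without edges have gain zero, so such centers cannot be what averaging finds.
  rcases le_or_gt H A with h | h
  · exact ⟨0, hm, (hgain0 _).trans (div_nonneg (by linarith) hk'.le)⟩
  by_contra! hcon
  have hneg : (A - H) / k < 0 := div_neg_of_neg_of_pos (by linarith) hk'
  have hall : ∀ i, (A - H) / k < E.gain d b g (capped b θ) i E.m := by
    intro i
    by_cases hi : ∃ t < E.m, E.center t = i
    · obtain ⟨t, ht, rfl⟩ := hi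
      exact hcon t ht
    · rw [hgain, Finset.sum_eq_zero]
      · exact hneg
      · intro t ht
        rw [if_neg fun h => hi ⟨t, Finset.mem_range.1 ht, h⟩]
  have hpos : ∃ i ∈ Finset.range E.p, 0 < x i := by
    by_contra! h0
    have := Finset.sum_nonpos h0
    linarith
  obtain ⟨i, hi, hxi⟩ := hpos
  have : ∑ i ∈ Finset.range E.p, x i * ((A - H) / k) <
      ∑ i ∈ Finset.range E.p, x i * E.gain d b g (capped b θ) i E.m :=
    Finset.sum_lt_sum (fun i _ => mul_le_mul_of_nonneg_left (hall i).le (hx0 i))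
      ⟨i, hi, mul_lt_mul_of_pos_left (hall i) hxi⟩
  rw [← Finset.sum_mul, hx, mul_div_cancel₀ _ hk'.ne'] at this
  linarith

end EdgeList

/-! ### The numerical parameters -/

/-- The ratio of the cost cap to the budget. -/
noncomputable def capRatio (k n : ℕ) : ℝ := n / ((2 * k + 1) * (n - 2 * k))

/-- The bound on the capped cost at which the greedy phase stops, relative to the budget. -/
noncomputable def stopRatio (k n : ℕ) : ℝ := n / (n - 2 * k)

/-- The additive part of the recurrence for `potential`. -/
noncomputable def drift (k n : ℕ) : ℝ := (1 + 2 * k * (2 * k + 1) / (n * n)) / k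

/-- The bound on the capped cost after `t` greedy steps, relative to the budget. -/
noncomputable def potential (k n : ℕ) : ℕ → ℝ
  | 0 => n * capRatio k n
  | t + 1 => potential k n t * (1 - 1 / k) + drift k n

section

variable {k n : ℕ} (hk : 1 ≤ k) (hn : 2 * k < n)

include hn in
theorem two_mul_lt_cast : (2 * k : ℝ) < n := by exact_mod_cast hn

include hn in
theorem capRatio_pos : 0 < capRatio k n := by
  have := two_mul_lt_cast hn
  have h0 : (0 : ℝ) ≤ k := k.cast_nonneg
  exact div_pos (by linarith) (mul_pos (by linarith) (by linarith))

include hn in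
-- Capped cost below `stopRatio` times the budget means less than the price of `2k + 1` caps, hence
-- at most `2k` unassigned customers.
theorem stopRatio_eq : stopRatio k n = capRatio k n * (2 * k + 1) := by
  have := two_mul_lt_cast hn
  have h0 : (0 : ℝ) ≤ k := k.cast_nonneg
  have h1 : (n : ℝ) - 2 * k ≠ 0 := by linarith
  rw [stopRatio, capRatio]
  field_simp

include hk in
-- The recurrence is affine with contraction factor `1 - 1/k` and fixed point `k * drift`.
theorem potential_eq (t : ℕ) : potential k n t =
    (1 + 2 * k * (2 * k + 1) / (n * n)) +
      (1 - 1 / k) ^ t * (n * capRatio k n - (1 + 2 * k * (2 * k + 1) / (n * n))) := by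
  have h0 : (k : ℝ) ≠ 0 := by positivity
  induction t with
  | zero => simp [potential]
  | succ t ih => rw [potential, ih, drift, pow_succ]; field_simp; ring

include hk hn in
theorem greedySize_nonneg : 0 ≤ greedySize k n := by
  have h0 : (1 : ℝ) ≤ k := by exact_mod_cast hk
  have h1 : (2 * k + 1 : ℝ) ≤ n := by exact_mod_cast hn
  refine Int.ceil_nonneg (mul_nonneg (by linarith) (Real.log_nonneg ?_))
  rw [le_div_iff₀ (by positivity)]
  nlinarith

include hk hn in
theorem potential_lt_stopRatio : potential k n (greedySize k n).toNat < stopRatio k n := by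
  have h0 : (1 : ℝ) ≤ k := by exact_mod_cast hk
  have h1 : (2 * k + 1 : ℝ) ≤ n := by exact_mod_cast hn
  have h2 := two_mul_lt_cast hn
  have hnpos : (0 : ℝ) < n := by linarith
  set T := (greedySize k n).toNat with hT
  have hTr : (k : ℝ) * Real.log ((n : ℝ) ^ 2 / (2 * k * (2 * k + 1))) ≤ T := by
    have h := Int.le_ceil ((k : ℝ) * Real.log ((n : ℝ) ^ 2 / (2 * k * (2 * k + 1))))
    have h' : ((T : ℤ) : ℝ) = (greedySize k n : ℝ) := by
      rw [hT, Int.toNat_of_nonneg (greedySize_nonneg hk hn)]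
    rw [Int.cast_natCast] at h'
    rw [h']
    exact h
  set ε₀ : ℝ := 2 * k * (2 * k + 1) / (n * n) with hε₀
  have hε₀pos : 0 < ε₀ := by positivity
  have hε₀1 : ε₀ < 1 := by
    rw [hε₀, div_lt_one (by positivity)]
    nlinarith
  have hk1 : (0 : ℝ) ≤ 1 - 1 / k := by
    rw [sub_nonneg, div_le_one (by linarith)]; exact h0
  -- This is where `T` comes from: the power is at most `exp (-T/k)`, and `ε₀` is the inverse of the
  -- argument of the logarithm in `T`.
  have hε : (1 - 1 / (k : ℝ)) ^ T ≤ ε₀ := by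
    have e1 : (1 - 1 / (k : ℝ)) ^ T ≤ Real.exp (-(1 / k)) ^ T :=
      pow_le_pow_left₀ hk1 (by linarith [Real.add_one_le_exp (-(1 / (k : ℝ)))]) T
    refine e1.trans ?_
    rw [← Real.exp_nat_mul, ← Real.le_log_iff_exp_le hε₀pos]
    have e2 : Real.log ε₀ = - Real.log ((n : ℝ) ^ 2 / (2 * k * (2 * k + 1))) := by
      rw [← Real.log_inv, inv_div, hε₀, pow_two]
    rw [e2, mul_neg, neg_le_neg_iff, mul_one_div, le_div_iff₀ (by linarith)]
    linarith
  have hN : (n : ℝ) * capRatio k n * ε₀ = 2 * k / (n - 2 * k) := by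
    have : (n : ℝ) - 2 * k ≠ 0 := by linarith
    rw [hε₀, capRatio]; field_simp
  have hhalt : stopRatio k n = 1 + 2 * k / (n - 2 * k) := by
    have : (n : ℝ) - 2 * k ≠ 0 := by linarith
    rw [stopRatio]; field_simp; ring
  rw [potential_eq hk, ← hε₀]
  -- If the coefficient is nonnegative, replacing the power by `ε₀` gives `1 + nρε₀ - ε₀²`, and `1 +
  -- nρε₀` is `stopRatio`. Otherwise the potential is at most `1 + ε₀`, which is already small
  -- enough.
  rcases le_or_gt 0 (n * capRatio k n - (1 + ε₀)) with h | h
  · have := mul_le_mul_of_nonneg_right hε h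
    rw [hhalt, ← hN]
    nlinarith
  · have : (1 - 1 / (k : ℝ)) ^ T * (n * capRatio k n - (1 + ε₀)) ≤ 0 :=
      mul_nonpos_of_nonneg_of_nonpos (pow_nonneg hk1 T) h.le
    have hεe : ε₀ * (n * (n - 2 * k)) < 2 * k * n := by
      have hh : ε₀ * (n * n) = 2 * k * (2 * k + 1) := by
        rw [hε₀]; field_simp
      have : ε₀ * (n * (n - 2 * k)) = 2 * k * (2 * k + 1) - ε₀ * n * (2 * k) := by
        rw [← hh]; ring
      rw [this]
      have : 0 < ε₀ * n * (2 * k) := by positivity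
      nlinarith
    have hlt : ε₀ < 2 * k / (n - 2 * k) := by
      rw [lt_div_iff₀ (by linarith)]
      nlinarith
    linarith

include hk hn in
theorem exists_potential_lt : ∃ t, potential k n t < stopRatio k n :=
  ⟨_, potential_lt_stopRatio hk hn⟩

open Classical in
/-- The number of greedy steps. -/
noncomputable def numSteps (k n : ℕ) : ℕ :=
  if h : ∃ t, potential k n t < stopRatio k n then Nat.find h else 0

include hk hn in
theorem potential_numSteps : potential k n (numSteps k n) < stopRatio k n := by
  classical
  rw [numSteps, dif_pos (exists_potential_lt hk hn)]
  exact Nat.find_spec (exists_potential_lt hk hn)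

include hk hn in
-- The machine has no logarithm and cannot compute `T`. It iterates the recurrence for `potential`
-- and stops at the first value below `stopRatio`, which is reached no later than at `T`.
theorem numSteps_le : (numSteps k n : ℤ) ≤ greedySize k n := by
  classical
  rw [numSteps, dif_pos (exists_potential_lt hk hn),
    ← Int.toNat_of_nonneg (greedySize_nonneg hk hn)]
  exact_mod_cast Nat.find_min' (exists_potential_lt hk hn) (potential_lt_stopRatio hk hn)

theorem stopRatio_le_potential {t : ℕ} (ht : t < numSteps k n) :
    stopRatio k n ≤ potential k n t := by
  classical
  rw [numSteps] at ht
  split_ifs at ht with h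
  · exact not_lt.1 (Nat.find_min h ht)
  · omega

include hk hn in
theorem greedySize_lt : (greedySize k n : ℝ) < 2 * (k * Real.log (n / k)) + 1 := by
  have h0 : (1 : ℝ) ≤ k := by exact_mod_cast hk
  have h2 := two_mul_lt_cast hn
  have hnpos : (0 : ℝ) < n := by linarith
  refine (Int.ceil_lt_add_one _).trans_le (add_le_add_left ?_ 1)
  have : Real.log ((n : ℝ) ^ 2 / (2 * k * (2 * k + 1))) ≤ 2 * Real.log (n / k) := by
    rw [← Real.log_rpow (by positivity)]
    refine Real.log_le_log (by positivity) ?_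
    rw [Real.rpow_two, div_pow]
    exact div_le_div_of_nonneg_left (by positivity) (by positivity) (by nlinarith)
  nlinarith

include hn in
theorem sizeRatio_lt (hk : 2 ≤ k) : sizeRatio k n < 1 + 2 * Real.log ((n : ℝ) / k) := by
  have h0 : (2 : ℝ) ≤ k := by exact_mod_cast hk
  have hkpos : (0 : ℝ) < k := by linarith
  have h2 := two_mul_lt_cast hn
  have hnpos : (0 : ℝ) < n := by linarith
  have h3 : (greedySize k n : ℝ) < k * Real.log ((n : ℝ) ^ 2 / (2 * k * (2 * k + 1))) + 1 :=
    Int.ceil_lt_add_one _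
  have h4 : Real.log ((n : ℝ) ^ 2 / (2 * k * (2 * k + 1))) =
      2 * Real.log (n / k) - Real.log (4 + 2 * (1 / k)) := by
    rw [← Real.log_rpow (by positivity), ← Real.log_div (by positivity) (by positivity)]
    congr 1
    rw [Real.rpow_two]
    field_simp
    ring
  have hs : (1 / k : ℝ) ≤ 1 / 2 := by
    rw [div_le_div_iff₀ hkpos (by norm_num)]; linarith
  have hs0 : 0 < (1 / k : ℝ) := by positivity
  set s : ℝ := 1 / k with hsdef
  -- Equivalent to `exp (1 + s) ≤ 4 + 2 * s`. This holds for `s ≤ 1/2` but fails at `s = 1`, which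
  -- is why `k ≥ 2` is required.
  have h5 : 1 + s ≤ Real.log (4 + 2 * s) := by
    rw [Real.le_log_iff_exp_le (by positivity), Real.exp_add]
    have e1 := Real.exp_one_lt_d9
    have e2 : Real.exp s ≤ 1 + s + s ^ 2 := by
      have := Real.abs_exp_sub_one_sub_id_le (x := s) (by rw [abs_of_pos hs0]; linarith)
      have := (abs_le.1 this).2
      linarith
    have e3 : Real.exp 1 * Real.exp s ≤ 2.7182818286 * (1 + s + s ^ 2) :=
      mul_le_mul e1.le e2 (Real.exp_pos _).le (by norm_num)
    nlinarith
  have h6 : (greedySize k n : ℝ) / k < Real.log ((n : ℝ) ^ 2 / (2 * k * (2 * k + 1))) + s := by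
    rw [div_lt_iff₀ hkpos, add_mul, hsdef, one_div_mul_cancel hkpos.ne']
    linarith
  rw [sizeRatio]
  linarith

end

/-! ### Discarding the most expensive customers -/

/-- The state after removing `r` of the most expensive customers from a list of `n` customers:
at most `K - r` customers are unassigned and the capped cost has decreased proportionally. -/
structure Trimmed (n K : ℕ) (b θ H : ℝ) (r : ℕ) (g : ℕ → ℝ) : Prop where
  nonneg : ∀ j < n, 0 ≤ g j
  missing : ((Finset.range n).filter (fun j => b < g j)).card ≤ K - r
  support : ((Finset.range n).filter (fun j => g j ≠ 0)).card ≤ n - r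
  cost : n * ∑ j ∈ Finset.range n, capped b θ (g j) ≤ (n - r) * H

/-- At most `n - r` customers still have nonzero distance, so the largest capped distance is at
least the average over `n - r` of them. Removing it scales the sum by at most `(n - r - 1) / (n -
r)`, and these factors telescope. A largest distance also has the largest capped distance since `b ≤
θ`. -/
theorem Trimmed.step {n K : ℕ} {b θ H : ℝ} {r : ℕ} {g : ℕ → ℝ} (h : Trimmed n K b θ H r g)
    (hb : 0 ≤ b) (hθ : b ≤ θ) (hr : r < n) {i : ℕ} (hi : i < n)
    (hmax : ∀ j < n, g j ≤ g i) : Trimmed n K b θ H (r + 1) (Function.update g i 0) := by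
  have himem : i ∈ Finset.range n := Finset.mem_range.2 hi
  have hcap0 : capped b θ 0 = 0 := capped_of_le hb
  have hcapmax : ∀ j < n, capped b θ (g j) ≤ capped b θ (g i) := by
    intro j hj
    rcases le_or_gt (g i) b with h1 | h1
    · rw [capped_of_le h1, capped_of_le ((hmax j hj).trans h1)]; exact hmax j hj
    · rw [capped_of_lt h1]
      rcases le_or_gt (g j) b with h2 | h2
      · rw [capped_of_le h2]; linarith
      · rw [capped_of_lt h2]
  have hcapnn : 0 ≤ capped b θ (g i) := by
    rcases le_or_gt (g i) b with h1 | h1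
    · rw [capped_of_le h1]; exact h.nonneg i hi
    · rw [capped_of_lt h1]; linarith
  have hS : ∑ j ∈ Finset.range n, capped b θ (g j) ≤ ((n : ℝ) - r) * capped b θ (g i) := by
    have h1 : ∑ j ∈ Finset.range n, capped b θ (g j) =
        ∑ j ∈ (Finset.range n).filter (fun j => g j ≠ 0), capped b θ (g j) := by
      rw [Finset.sum_filter]
      refine Finset.sum_congr rfl fun j _ => ?_
      by_cases hj : g j = 0 <;> simp [hj, hcap0]
    rw [h1]
    refine (Finset.sum_le_card_nsmul _ _ (capped b θ (g i)) fun j hj =>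
      hcapmax j (Finset.mem_range.1 (Finset.mem_filter.1 hj).1)).trans ?_
    rw [nsmul_eq_mul, ← Nat.cast_sub hr.le]
    exact mul_le_mul_of_nonneg_right (by exact_mod_cast h.support) hcapnn
  have hsub : ∀ (q : ℝ → Prop) [DecidablePred q], ¬ q 0 →
      (Finset.range n).filter (fun j => q (Function.update g i 0 j)) =
        ((Finset.range n).filter (fun j => q (g j))).erase i := by
    intro q _ hq
    ext j
    by_cases hj : j = i
    · subst hj; simp [hq]
    · simp [hj]
  refine ⟨fun j hj => ?_, ?_, ?_, ?_⟩
  · by_cases hj' : j = i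
    · subst hj'; simp
    · simpa [hj'] using h.nonneg j hj
  · rw [hsub (fun v => b < v) hb.not_gt]
    by_cases hbi : b < g i
    · rw [Finset.card_erase_of_mem (Finset.mem_filter.2 ⟨himem, hbi⟩)]
      have := h.missing
      omega
    · have : (Finset.range n).filter (fun j => b < g j) = ∅ :=
        Finset.filter_eq_empty_iff.2 fun j hj hlt =>
          hbi (hlt.trans_le (hmax j (Finset.mem_range.1 hj)))
      rw [this]; simp
  · rw [hsub (fun v => v ≠ 0) (by simp)]
    by_cases hgi : g i = 0
    · have : (Finset.range n).filter (fun j => g j ≠ 0) = ∅ :=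
        Finset.filter_eq_empty_iff.2 fun j hj hne =>
          hne (le_antisymm (hgi ▸ hmax j (Finset.mem_range.1 hj))
            (h.nonneg j (Finset.mem_range.1 hj)))
      rw [this]; simp
    · rw [Finset.card_erase_of_mem (Finset.mem_filter.2 ⟨himem, hgi⟩)]
      have := h.support
      omega
  · have e1 : ∑ j ∈ Finset.range n, capped b θ (Function.update g i 0 j) =
        ∑ j ∈ Finset.range n, capped b θ (g j) - capped b θ (g i) := by
      rw [← Finset.add_sum_erase _ _ himem,
        ← Finset.add_sum_erase _ (fun j => capped b θ (g j)) himem, Function.update_self, hcap0]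
      rw [Finset.sum_congr rfl fun j hj => by
        rw [Function.update_of_ne (Finset.ne_of_mem_erase hj)]]
      ring
    rw [e1]
    have hc := h.cost
    set S := ∑ j ∈ Finset.range n, capped b θ (g j)
    have hnr : (0 : ℝ) < n - r := by
      rw [sub_pos]; exact_mod_cast hr
    have hn0 : (0 : ℝ) ≤ n := n.cast_nonneg
    have hr1 : (0 : ℝ) ≤ n - r - 1 := by
      have : ((r + 1 : ℕ) : ℝ) ≤ n := by exact_mod_cast hr
      push_cast at this; linarith
    push_cast
    -- The claim times `n - r`, which avoids division. The old bound is scaled by `n - r - 1`,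
    -- nonnegative because `r < n`.
    have h1 : (n - r : ℝ) * (n * (S - capped b θ (g i))) ≤ (n - r : ℝ) * ((n - (r + 1)) * H) := by
      nlinarith [mul_le_mul_of_nonneg_left hS hn0, mul_le_mul_of_nonneg_left hc hr1]
    exact le_of_mul_le_mul_left h1 hnr

end KMedian

/-! ### Preprocessing programs: nearest centers, reduced costs, sorting -/

namespace KMedian

open RealRAM

attribute [simp] wp Test.Holds NatExpr.eval RealExpr.eval Memory.writeNat Memory.writeReal

/-- The memory holds the instance given by `E` and `k`. -/
structure Loaded (E : EdgeList) (k : ℕ) (s : Memory) : Prop where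
  k_eq : s.nat 0 0 = k
  n_eq : s.nat 0 2 = E.n
  m_eq : s.nat 0 3 = E.m
  center : s.nat 1 = E.center
  customer : s.nat 2 = E.customer

theorem Loaded.of_same {E : EdgeList} {k : ℕ} {s s' : Memory} {P : Program}
    (h : Loaded E k s) (hs : Same P s s') (h0 : P.writesNat 0 = false)
    (h1 : P.writesNat 1 = false) (h2 : P.writesNat 2 = false) : Loaded E k s' :=
  ⟨by rw [hs.nat 0 h0, h.k_eq], by rw [hs.nat 0 h0, h.n_eq], by rw [hs.nat 0 h0, h.m_eq],
    by rw [hs.nat 1 h1, h.center], by rw [hs.nat 2 h2, h.customer]⟩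

/-! ### Reading the instance -/

/-- The number of customers. -/
abbrev nExpr : NatExpr := .read 0 (.const 2)

/-- The number of edges. -/
abbrev mExpr : NatExpr := .read 0 (.const 3)

/-- The center of the edge at the loop counter. -/
abbrev curCenter : NatExpr := .read 1 (nvar 7)

/-- The customer of the edge at the loop counter. -/
abbrev curCustomer : NatExpr := .read 2 (nvar 7)

/-! ### Nearest centers and reduced costs -/

/-- Compute the distance of each customer to its nearest center (real array `1`) and that center
(integer array `6`); integer array `5` marks the customers seen so far. -/
def findNearest : Program :=
  forTo 7 mExpr
    (.ite (.and (.natLe (.const 1) (.read 5 curCustomer))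
        (.realLe (.read 1 curCustomer) (.read 0 (nvar 7))))
      .skip
      (.setReal 1 curCustomer (.read 0 (nvar 7)) ;; .setNat 6 curCustomer curCenter ;;
        .setNat 5 curCustomer (.const 1)))

/-- The marks in integer array `5` distinguish a stored distance `0` from an untouched cell. The
last clause also covers customers without edges, whose center entry keeps the default `0`. -/
theorem ends_findNearest {E : EdgeList} {k : ℕ} {s₀ : Memory} (h : Loaded E k s₀)
    (h5 : ∀ j, s₀.nat 5 j = 0) (h6 : ∀ j, s₀.nat 6 j = 0) :
    Ends findNearest s₀ (100 * (E.m + 1)) (fun s =>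
      (∀ t < E.m, s.real 1 (E.customer t) ≤ s₀.real 0 t ∧ ∃ t' < E.m,
        E.customer t' = E.customer t ∧ E.center t' = s.nat 6 (E.customer t) ∧
        s₀.real 0 t' = s.real 1 (E.customer t)) ∧
      ∀ j, s.nat 6 j = 0 ∨ ∃ t < E.m, E.center t = s.nat 6 j) := by
  refine (Ends.forTo (N := E.m) (B := 50) (fun u s =>
    (∀ t < u, s.nat 5 (E.customer t) = 1 ∧ s.real 1 (E.customer t) ≤ s₀.real 0 t) ∧
    (∀ j, s.nat 5 j ≠ 0 → ∃ t < u, E.customer t = j ∧ E.center t = s.nat 6 j ∧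
      s₀.real 0 t = s.real 1 j) ∧
    ∀ j, s.nat 6 j = 0 ∨ ∃ t < E.m, E.center t = s.nat 6 j) ?_ ?_ ?_).mono ?_ ?_
  · simp [h5, h6]
  · intro s hs
    simp [(h.of_same hs rfl rfl rfl).m_eq]
  · rintro u hu s hs h7 ⟨hA, hB, hC⟩
    have hl := h.of_same hs rfl rfl rfl
    have hr0 : s.real 0 = s₀.real 0 := hs.real 0 rfl
    refine (Ends.of_wp ?_).mono (N := _) (Nat.le_of_ble_eq_true rfl) fun _ => id
    simp only [wp, Test.Holds, NatExpr.eval, RealExpr.eval, Memory.writeNat, Memory.writeReal, h7,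
      hl.center, hl.customer, hr0]
    refine ⟨fun ⟨h1, h2⟩ => ?_, fun h1 => ?_⟩
    · have h5' : s.nat 5 (E.customer u) = 1 := by
        obtain ⟨t, ht, ht', -⟩ := hB (E.customer u) (by omega)
        rw [← ht']; exact (hA t ht).1
      refine ⟨by simp, fun t ht => ?_, fun j hj => ?_, by simpa using hC⟩
      · rcases Nat.lt_succ_iff_lt_or_eq.1 ht with ht | rfl
        · simpa using hA t ht
        · simpa using ⟨h5', h2⟩
      · obtain ⟨t, ht, h'⟩ := hB j (by simpa using hj)
        exact ⟨t, by omega, by simpa using h'⟩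
    · refine ⟨by simp [h7], fun t ht => ?_, fun j hj => ?_, fun j => ?_⟩
      · rcases Nat.lt_succ_iff_lt_or_eq.1 ht with ht | rfl
        · by_cases hj : E.customer t = E.customer u
          · have h3 := hA t ht
            rw [hj] at h3
            rw [hj]
            simp only [h3.1, le_refl, true_and, not_le] at h1
            simpa [h7, hl.customer] using h1.le.trans h3.2
          · simpa [hj, h7, hl.customer] using hA t ht
        · simp [h7, hl.customer]
      · by_cases hj' : j = E.customer u
        · subst hj'
          exact ⟨u, by omega, rfl, by simp, by simp⟩
        · obtain ⟨t, ht, h'⟩ := hB j (by simpa [hj', h7, hl.customer] using hj)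
          exact ⟨t, by omega, by simpa [hj'] using h'⟩
      · by_cases hj' : j = E.customer u
        · subst hj'
          exact .inr ⟨u, hu, by simp⟩
        · simpa [hj'] using hC j
  · rw [mul_comm]
    exact Nat.mul_le_mul_right _ (Nat.le_of_ble_eq_true rfl)
  · rintro s ⟨hA, hB, hC⟩
    refine ⟨fun t ht => ⟨(hA t ht).2, ?_⟩, hC⟩
    exact hB _ (by rw [(hA t ht).1]; exact one_ne_zero)

/-- Compute the reduced costs (real array `2`), with a copy in real array `3`. -/
def reduceCosts : Program :=
  forTo 7 mExpr
    (.setReal 2 (nvar 7) (.sub (.read 0 (nvar 7)) (.read 1 curCustomer)) ;;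
      .setReal 3 (nvar 7) (.read 2 (nvar 7)))

theorem ends_reduceCosts {E : EdgeList} {k : ℕ} {s₀ : Memory} (h : Loaded E k s₀) :
    Ends reduceCosts s₀ (100 * (E.m + 1)) (fun s =>
      ∀ t < E.m, s.real 2 t = s₀.real 0 t - s₀.real 1 (E.customer t) ∧
        s.real 3 t = s.real 2 t) := by
  refine (Ends.forTo (N := E.m) (B := 50) (fun u s =>
    ∀ t < u, s.real 2 t = s₀.real 0 t - s₀.real 1 (E.customer t) ∧ s.real 3 t = s.real 2 t)
      (by simp) ?_ ?_).mono ?_ fun _ => id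
  · intro s hs
    simp [(h.of_same hs rfl rfl rfl).m_eq]
  · rintro u hu s hs h7 hA
    have hl := h.of_same hs rfl rfl rfl
    have hr0 : s.real 0 = s₀.real 0 := hs.real 0 rfl
    have hr1 : s.real 1 = s₀.real 1 := hs.real 1 rfl
    refine (Ends.of_wp ?_).mono (N := _) (Nat.le_of_ble_eq_true rfl) fun _ => id
    simp only [wp, NatExpr.eval, RealExpr.eval, Memory.writeNat, Memory.writeReal, h7,
      hl.customer, hr0, hr1]
    refine ⟨by simp, fun t ht => ?_⟩
    by_cases htu : t = u
    · subst htu; simp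
    · simpa [h7, htu] using hA t (by omega)
  · rw [mul_comm]
    exact Nat.mul_le_mul_right _ (Nat.le_of_ble_eq_true rfl)

/-! ### Merge sort -/

/-- The state of a merge pass with block length `w`, at output position `o`: the blocks
`[lo, mid)` and `[mid, hi)` of `a` are being merged into `b`, and have been consumed up to `i`
and `j`. -/
structure Merging (a b : ℕ → ℝ) (m w o lo mid hi i j : ℕ) : Prop where
  dvd : 2 * w ∣ lo
  lo_le : lo ≤ o
  le_hi : o ≤ hi
  hi_eq : hi = min (lo + 2 * w) m
  mid_eq : mid = lo + w
  lo_le_i : lo ≤ i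
  i_le : i ≤ mid
  mid_le_j : mid ≤ j
  -- In an incomplete last pair `mid` may exceed `hi`; the right block is then empty and `j` stays
  -- at `mid`.
  j_le : j = mid ∨ j ≤ hi
  sum_eq : i + j = o + mid
  sorted : ∀ x y, x ≤ y → y < o → x / (2 * w) = y / (2 * w) → b x ≤ b y
  source : ∀ x < o, ∃ y < m, b x = a y
  cover : ∀ x < m, x < i ∨ mid ≤ x ∧ x < j → ∃ y < o, b y = a x
  left : ∀ y, lo ≤ y → y < o → ∀ x, i ≤ x → x < mid → x < m → b y ≤ a x
  right : ∀ y, lo ≤ y → y < o → ∀ x, j ≤ x → x < hi → b y ≤ a x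

/-- `a` is sorted within each block of length `w`. -/
def BlockSorted (a : ℕ → ℝ) (m w : ℕ) : Prop :=
  ∀ x y, x ≤ y → y < m → x / w = y / w → a x ≤ a y

/-- Sortedness of the output is only claimed within a pair of blocks. Since `lo` is a multiple of `2
* w`, positions in the same pair as `o` belong to the current merge, where `left` and `right` apply.
-/
theorem Merging.lo_le_of_div_eq {a b : ℕ → ℝ} {m w o lo mid hi i j : ℕ}
    (h : Merging a b m w o lo mid hi i j) {x : ℕ} (hw : 0 < w)
    (hx : x / (2 * w) = o / (2 * w)) : lo ≤ x := by
  obtain ⟨c, hc⟩ := h.dvd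
  have h1 : c ≤ o / (2 * w) := by
    rw [Nat.le_div_iff_mul_le (by omega), mul_comm, ← hc]; exact h.lo_le
  rw [← hx, Nat.le_div_iff_mul_le (by omega), mul_comm, ← hc] at h1
  exact h1

/-- With `lo = 2 * w * c`, the left block has quotient `2 * c` by `w`, and the right one `2 * c +
1`. Thus `BlockSorted` applies inside each of them. -/
theorem Merging.div_left {a b : ℕ → ℝ} {m w o lo mid hi i j : ℕ}
    (h : Merging a b m w o lo mid hi i j) {x y : ℕ} (hx : lo ≤ x) (hx' : x < mid)
    (hy : lo ≤ y) (hy' : y < mid) : x / w = y / w := by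
  obtain ⟨c, hc⟩ := h.dvd
  have hm := h.mid_eq
  have e : ∀ z, lo ≤ z → z < mid → z / w = 2 * c := fun z h1 h2 =>
    Nat.div_eq_of_lt_le (by rw [hc] at h1; linarith) (by rw [hm, hc] at h2; nlinarith)
  rw [e x hx hx', e y hy hy']

theorem Merging.div_right {a b : ℕ → ℝ} {m w o lo mid hi i j : ℕ}
    (h : Merging a b m w o lo mid hi i j) {x y : ℕ} (hx : mid ≤ x) (hx' : x < hi)
    (hy : mid ≤ y) (hy' : y < hi) : x / w = y / w := by
  obtain ⟨c, hc⟩ := h.dvd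
  have hm := h.mid_eq
  have hh : hi ≤ lo + 2 * w := h.hi_eq ▸ min_le_left _ _
  have e : ∀ z, mid ≤ z → z < hi → z / w = 2 * c + 1 := fun z h1 h2 =>
    Nat.div_eq_of_lt_le (by rw [hm, hc] at h1; nlinarith)
      (by have := h2.trans_le hh; rw [hc] at this; nlinarith)
  rw [e x hx hx', e y hy hy']

/-- Appending a value that is a lower bound of all values not yet consumed. -/
theorem Merging.append {a b : ℕ → ℝ} {m w o lo mid hi i j i' j' z : ℕ}
    (h : Merging a b m w o lo mid hi i j) (hw : 0 < w) (ho : o < hi) (hz : z < m)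
    (hi' : i ≤ i') (hi'm : i' ≤ mid) (hj' : j ≤ j') (hj'h : j' = mid ∨ j' ≤ hi)
    (hsum : i' + j' = o + 1 + mid) (hzo : ∀ y, lo ≤ y → y < o → b y ≤ a z)
    (hcov : ∀ x, x < i' ∨ mid ≤ x ∧ x < j' → x = z ∨ (x < i ∨ mid ≤ x ∧ x < j))
    (hl : ∀ x, i' ≤ x → x < mid → x < m → a z ≤ a x)
    (hr : ∀ x, j' ≤ x → x < hi → a z ≤ a x) :
    Merging a (Function.update b o (a z)) m w (o + 1) lo mid hi i' j' where
  dvd := h.dvd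
  lo_le := h.lo_le.trans (Nat.le_succ o)
  le_hi := ho
  hi_eq := h.hi_eq
  mid_eq := h.mid_eq
  lo_le_i := h.lo_le_i.trans hi'
  i_le := hi'm
  mid_le_j := h.mid_le_j.trans hj'
  j_le := hj'h
  sum_eq := hsum
  sorted x y hxy hy hdiv := by
    by_cases hyo : y = o
    · subst hyo
      by_cases hxo : x = y
      · rw [hxo]
      · rw [Function.update_self, Function.update_of_ne hxo]
        exact hzo x (h.lo_le_of_div_eq hw hdiv) (by omega)
    · rw [Function.update_of_ne hyo, Function.update_of_ne (by omega)]
      exact h.sorted x y hxy (by omega) hdiv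
  source x hx := by
    by_cases hxo : x = o
    · subst hxo; exact ⟨z, hz, by simp⟩
    · rw [Function.update_of_ne hxo]; exact h.source x (by omega)
  cover x hx hx' := by
    rcases hcov x hx' with rfl | hx'
    · exact ⟨o, by omega, by simp⟩
    · obtain ⟨y, hy, hy'⟩ := h.cover x hx hx'
      exact ⟨y, by omega, by rw [Function.update_of_ne (by omega)]; exact hy'⟩
  left y hy hy' x hx hx' hxm := by
    by_cases hyo : y = o
    · subst hyo; rw [Function.update_self]; exact hl x hx hx' hxm
    · rw [Function.update_of_ne hyo]; exact h.left y hy (by omega) x (by omega) hx' hxm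
  right y hy hy' x hx hx' := by
    by_cases hyo : y = o
    · subst hyo; rw [Function.update_self]; exact hr x hx hx'
    · rw [Function.update_of_ne hyo]; exact h.right y hy (by omega) x (by omega) hx'

theorem Merging.takeLeft {a b : ℕ → ℝ} {m w o lo mid hi i j : ℕ}
    (h : Merging a b m w o lo mid hi i j) (hw : 0 < w) (ha : BlockSorted a m w) (ho : o < hi)
    (hi' : i < mid) (hij : j < hi → a i ≤ a j) :
    Merging a (Function.update b o (a i)) m w (o + 1) lo mid hi (i + 1) j := by
  have hhm : hi ≤ m := h.hi_eq ▸ min_le_right _ _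
  have h1 := h.sum_eq
  have h2 := h.mid_le_j
  have him : i < m := by omega
  refine h.append hw ho him (by omega) hi' le_rfl h.j_le (by omega)
    (fun y hy hy' => h.left y hy hy' i le_rfl hi' him) (fun x hx => by omega)
    (fun x hx hx' hxm => ?_) (fun x hx hx' => ?_)
  · have := h.lo_le_i
    exact ha i x (by omega) hxm (h.div_left this hi' (by omega) hx')
  · exact (hij (by omega)).trans (ha j x hx (by omega) (h.div_right h2 (by omega) (by omega) hx'))

theorem Merging.takeRight {a b : ℕ → ℝ} {m w o lo mid hi i j : ℕ}
    (h : Merging a b m w o lo mid hi i j) (hw : 0 < w) (ha : BlockSorted a m w) (ho : o < hi)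
    (hij : i < mid → j < hi ∧ a j ≤ a i) :
    Merging a (Function.update b o (a j)) m w (o + 1) lo mid hi i (j + 1) := by
  have hhm : hi ≤ m := h.hi_eq ▸ min_le_right _ _
  have h1 := h.sum_eq
  have h2 := h.mid_le_j
  have h3 := h.i_le
  -- When the left block is exhausted, the count `i + j = o + mid` gives `j = o`.
  have hjh : j < hi := by
    by_cases hi' : i < mid
    · exact (hij hi').1
    · omega
  refine h.append hw ho (by omega) le_rfl h.i_le (by omega) (.inr hjh) (by omega)
    (fun y hy hy' => h.right y hy hy' j le_rfl hjh) (fun x hx => by omega)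
    (fun x hx hx' hxm => ?_) (fun x hx hx' => ?_)
  · have := h.lo_le_i
    exact (hij (by omega)).2.trans (ha i x hx hxm (h.div_left this (by omega) (by omega) hx'))
  · exact ha j x (by omega) (by omega) (h.div_right h2 hjh (by omega) hx')

theorem Merging.start {a b : ℕ → ℝ} {m w o : ℕ} (ho : o ≤ m) (hdvd : 2 * w ∣ o)
    (hs : ∀ x y, x ≤ y → y < o → x / (2 * w) = y / (2 * w) → b x ≤ b y)
    (hsrc : ∀ x < o, ∃ y < m, b x = a y) (hcov : ∀ x < o, ∃ y < o, b y = a x) :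
    Merging a b m w o o (o + w) (min (o + 2 * w) m) o (o + w) where
  dvd := hdvd
  lo_le := le_rfl
  le_hi := le_min (by omega) ho
  hi_eq := rfl
  mid_eq := rfl
  lo_le_i := le_rfl
  i_le := by omega
  mid_le_j := le_rfl
  j_le := .inl rfl
  sum_eq := by omega
  sorted := hs
  source := hsrc
  cover x hx hx' := hcov x (by omega)
  left y hy hy' := by omega
  right y hy hy' := by omega

/-- By the count `i + j = o + mid`, both blocks are completely consumed when the output reaches
`hi`. -/
theorem Merging.cover_of_eq {a b : ℕ → ℝ} {m w o lo mid hi i j : ℕ}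
    (h : Merging a b m w o lo mid hi i j) (ho : o = hi) : ∀ x < o, ∃ y < o, b y = a x := by
  intro x hx
  have hhm : hi ≤ m := h.hi_eq ▸ min_le_right _ _
  have h1 := h.sum_eq
  have h2 := h.i_le
  have h3 := h.mid_le_j
  have h4 := h.j_le
  exact h.cover x (by omega) (by omega)

/-- Merge the blocks of length `w` (integer array `8`) of real array `3` in pairs; the result goes
to real array `4`.  Integer arrays `9`, `10`, `11`, `12` hold `hi`, `i`, `j`, `mid`. -/
def mergePass : Program :=
  letNat 9 (.const 0) ;;
  forTo 7 mExpr
    (.ite (.natLe (nvar 9) (nvar 7))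
        (letNat 10 (nvar 7) ;; letNat 12 (.add (nvar 7) (nvar 8)) ;; letNat 11 (nvar 12) ;;
          letNat 9 (.add (nvar 12) (nvar 8)) ;;
          .ite (.natLe mExpr (nvar 9)) (letNat 9 mExpr) .skip)
        .skip ;;
      .ite (.and (.not (.natLe (nvar 12) (nvar 10)))
          (.not (.and (.not (.natLe (nvar 9) (nvar 11)))
            (.not (.realLe (.read 3 (nvar 10)) (.read 3 (nvar 11)))))))
        (.setReal 4 (nvar 7) (.read 3 (nvar 10)) ;; incr 10)
        (.setReal 4 (nvar 7) (.read 3 (nvar 11)) ;; incr 11))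

theorem ends_mergePass {E : EdgeList} {k w : ℕ} {s₀ : Memory} (h : Loaded E k s₀)
    (h8 : s₀.nat 8 0 = w) (hw : 0 < w) (hm : 0 < E.m) (ha : BlockSorted (s₀.real 3) E.m w) :
    Ends mergePass s₀ (200 * (E.m + 1)) (fun s => BlockSorted (s.real 4) E.m (2 * w) ∧
      (∀ x < E.m, ∃ y < E.m, s.real 4 x = s₀.real 3 y) ∧
      ∀ x < E.m, ∃ y < E.m, s.real 4 y = s₀.real 3 x) := by
  have first : Ends (letNat 9 (.const 0)) s₀ 3 (fun s => s.nat 9 0 = 0) :=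
    Ends.of_wp (P := letNat 9 (.const 0)) (by simp)
  refine (first.seq_same (N' := (E.m + 1) * (100 + mExpr.cost + 10))
    fun s₁ h9 hs₁ => ?_).mono ?_ fun _ => id
  · have hl₁ := h.of_same hs₁ rfl rfl rfl
    have h8₁ : s₁.nat 8 0 = w := by rw [hs₁.nat 8 rfl, h8]
    have h3₁ : s₁.real 3 = s₀.real 3 := hs₁.real 3 rfl
    refine (Ends.forTo (N := E.m) (B := 100) (fun o s => (o = 0 ∧ s.nat 9 0 = 0) ∨
      ∃ lo, Merging (s₀.real 3) (s.real 4) E.m w o lo (s.nat 12 0) (s.nat 9 0)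
        (s.nat 10 0) (s.nat 11 0)) ?_ ?_ ?_).mono le_rfl ?_
    · simp [h9]
    · intro s hs
      simp [(hl₁.of_same hs rfl rfl rfl).m_eq]
    · rintro o ho s hs h7 hI
      have hl := hl₁.of_same hs rfl rfl rfl
      have hr3 : s.real 3 = s₀.real 3 := (hs.real 3 rfl).trans h3₁
      have hn8 : s.nat 8 0 = w := by rw [hs.nat 8 rfl, h8₁]
      refine (Ends.of_wp ?_).mono (N := _) (Nat.le_of_ble_eq_true rfl) fun _ => id
      -- The comparison and the output step, shared by the cases where a new pair has just been
      -- opened and where the current pair continues.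
      have main : ∀ s' : Memory, s'.real 3 = s₀.real 3 → s'.nat 7 0 = o →
          (∃ lo, Merging (s₀.real 3) (s'.real 4) E.m w o lo (s'.nat 12 0) (s'.nat 9 0)
            (s'.nat 10 0) (s'.nat 11 0)) → o < s'.nat 9 0 →
          wp (.ite (.and (.not (.natLe (nvar 12) (nvar 10)))
            (.not (.and (.not (.natLe (nvar 9) (nvar 11)))
              (.not (.realLe (.read 3 (nvar 10)) (.read 3 (nvar 11)))))))
          (.setReal 4 (nvar 7) (.read 3 (nvar 10)) ;; incr 10)
          (.setReal 4 (nvar 7) (.read 3 (nvar 11)) ;; incr 11)) (wp (incr 7)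
            (fun s' => s'.nat 7 0 = o + 1 ∧ ((o + 1 = 0 ∧ s'.nat 9 0 = 0) ∨
      ∃ lo, Merging (s₀.real 3) (s'.real 4) E.m w (o + 1) lo (s'.nat 12 0) (s'.nat 9 0)
        (s'.nat 10 0) (s'.nat 11 0)))) s' := by
        rintro s' hr3' h7' ⟨lo, hM⟩ ho'
        simp only [wp, Test.Holds, NatExpr.eval, RealExpr.eval, hr3', h7']
        refine ⟨fun ⟨h1, h2⟩ => ⟨by simp [h7'], .inr ⟨lo, ?_⟩⟩,
          fun h1 => ⟨by simp [h7'], .inr ⟨lo, ?_⟩⟩⟩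
        · have := hM.takeLeft hw ha ho' (not_le.1 h1) fun hj => by
            by_contra h3; exact h2 ⟨not_le.2 hj, h3⟩
          simpa using this
        · have := hM.takeRight hw ha ho' fun hi => by
            by_contra h3
            refine h1 ⟨not_le.2 hi, fun h4 => h3 ⟨not_le.1 h4.1, (not_le.1 h4.2).le⟩⟩
          simpa using this
      rw [wp, wp, wp]
      refine ⟨fun h1 => ?_, fun h1 => ?_⟩
      · simp only [Test.Holds, NatExpr.eval, h7] at h1
        have hst : Merging (s₀.real 3) (s.real 4) E.m w o o (o + w) (min (o + 2 * w) E.m)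
            o (o + w) := by
          rcases hI with ⟨rfl, h9'⟩ | ⟨lo, hM⟩
          · exact Merging.start ho.le (dvd_zero _) (by simp) (by simp) (by simp)
          -- The previous pair ended before `E.m`, so its end was not cut off and `o` is again a
          -- multiple of `2 * w`.
          · have ho' : o = s.nat 9 0 := le_antisymm hM.le_hi h1
            refine Merging.start ho.le ?_ hM.sorted hM.source (hM.cover_of_eq ho')
            have h2 := hM.hi_eq
            have : o = lo + 2 * w := by omega
            rw [this]
            exact Dvd.dvd.add hM.dvd dvd_rfl
        have hlt : o < min (o + 2 * w) E.m := lt_min (by omega) ho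
        have e : o + w + w = o + 2 * w := by ring
        simp only [wp]
        refine ⟨fun h2 => main _ ?_ ?_ ⟨o, ?_⟩ ?_, fun h2 => main _ ?_ ?_ ⟨o, ?_⟩ ?_⟩
        · simpa using hr3
        · simpa using h7
        · simp [h7, hn8, hl.m_eq, e] at h2 ⊢
          rwa [min_eq_right h2] at hst
        · simp [hl.m_eq, ho]
        · simpa using hr3
        · simpa using h7
        · simp [h7, hn8, hl.m_eq, e] at h2 ⊢
          rwa [min_eq_left h2.le] at hst
        · simp [h7, hn8]; omega
      · simp only [Test.Holds, NatExpr.eval, h7] at h1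
        refine main s hr3 h7 ?_ (by omega)
        rcases hI with ⟨rfl, h9'⟩ | hM
        · omega
        · exact hM
    · rintro s (⟨h0, -⟩ | ⟨lo, hM⟩)
      · omega
      · have h1 := hM.le_hi
        have h2 := hM.hi_eq
        exact ⟨fun x y hxy hy hd => hM.sorted x y hxy hy hd, hM.source,
          hM.cover_of_eq (by omega)⟩
  · simp only [NatExpr.cost]; ring_nf; omega

/-- Copy real array `4` to real array `3`. -/
def copyBack : Program :=
  forTo 7 mExpr (.setReal 3 (nvar 7) (.read 4 (nvar 7)))

theorem ends_copyBack {E : EdgeList} {k : ℕ} {s₀ : Memory} (h : Loaded E k s₀) :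
    Ends copyBack s₀ (100 * (E.m + 1)) (fun s => ∀ t < E.m, s.real 3 t = s₀.real 4 t) := by
  refine (Ends.forTo (N := E.m) (B := 50) (fun u s => ∀ t < u, s.real 3 t = s₀.real 4 t)
      (by simp) ?_ ?_).mono ?_ fun _ => id
  · intro s hs
    simp [(h.of_same hs rfl rfl rfl).m_eq]
  · rintro u hu s hs h7 hA
    have hr4 : s.real 4 = s₀.real 4 := hs.real 4 rfl
    refine (Ends.of_wp ?_).mono (N := _) (Nat.le_of_ble_eq_true rfl) fun _ => id
    simp only [wp, NatExpr.eval, RealExpr.eval, Memory.writeNat, Memory.writeReal, h7, hr4]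
    refine ⟨by simp, fun t ht => ?_⟩
    by_cases htu : t = u
    · subst htu; simp
    · simpa [htu] using hA t (by omega)
  · rw [mul_comm]
    exact Nat.mul_le_mul_right _ (Nat.le_of_ble_eq_true rfl)

/-- Sort real array `3`. -/
def mergeSort : Program :=
  letNat 8 (.const 1) ;;
  .while (.natLe (.add (nvar 8) (.const 1)) mExpr)
    (mergePass ;; copyBack ;; letNat 8 (.add (nvar 8) (nvar 8)))

/-- `b` is a sorted rearrangement of the values of `a` (up to multiplicity). -/
structure SortedCopy (m : ℕ) (a b : ℕ → ℝ) : Prop where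
  mono : ∀ x y, x ≤ y → y < m → b x ≤ b y
  source : ∀ x < m, ∃ y < m, b x = a y
  cover : ∀ x < m, ∃ y < m, b y = a x

/-- The invariant `E.m ≤ w * 2 ^ v` bounds the number of doublings left. Multiplicities are not
tracked because the threshold search only uses which values occur and their order. -/
theorem ends_mergeSort {E : EdgeList} {k : ℕ} {s₀ : Memory} (h : Loaded E k s₀)
    (hm : 0 < E.m) :
    Ends mergeSort s₀ (1000 * (E.m + 1) * (Nat.log 2 E.m + 2)) (fun s =>
      SortedCopy E.m (s₀.real 3) (s.real 3)) := by
  have first : Ends (letNat 8 (.const 1)) s₀ 3 (fun s => s.nat 8 0 = 1) :=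
    Ends.of_wp (P := letNat 8 (.const 1)) (by simp)
  refine (first.seq_same (N' := (Nat.log 2 E.m + 1) * (300 * (E.m + 1) + 20 + 7 + 1) + 7 + 1)
    fun s₁ h8 hs₁ => ?_).mono ?_ fun _ => id
  · have h3₁ : s₁.real 3 = s₀.real 3 := hs₁.real 3 rfl
    refine (Ends.while (B := 300 * (E.m + 1) + 20) (fun v s => ∃ w, s.nat 8 0 = w ∧ 0 < w ∧
      E.m ≤ w * 2 ^ v ∧ Loaded E k s ∧ BlockSorted (s.real 3) E.m w ∧
      (∀ x < E.m, ∃ y < E.m, s.real 3 x = s₀.real 3 y) ∧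
      ∀ x < E.m, ∃ y < E.m, s.real 3 y = s₀.real 3 x) ?_ (Nat.log 2 E.m + 1) s₁ ?_).mono
      (by simp only [Test.cost, NatExpr.cost, le_refl]) ?_
    · rintro v s ⟨w, h8, hw, hv, hl, hsort, hsrc, hcov⟩ hb
      simp only [Test.Holds, NatExpr.eval, h8, hl.m_eq] at hb
      refine ((ends_mergePass hl h8 hw hm hsort).seq_same fun s' h' hs' =>
        (ends_copyBack (hl.of_same hs' rfl rfl rfl)).seq_same (N' := 20)
          fun s'' h'' hs'' => ?_).mono (by omega) fun _ => id
      have hl'' := (hl.of_same hs' rfl rfl rfl).of_same hs'' rfl rfl rfl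
      have h8'' : s''.nat 8 0 = w := by rw [hs''.nat 8 rfl, hs'.nat 8 rfl, h8]
      refine (Ends.of_wp ?_).mono (Nat.le_of_ble_eq_true rfl) fun _ => id
      have hv0 : v ≠ 0 := by rintro rfl; simp at hv; omega
      refine ⟨v - 1, by omega, 2 * w, by simp [h8'']; ring, by omega, ?_, ?_, ?_, ?_, ?_⟩
      · obtain ⟨v, rfl⟩ := Nat.exists_eq_succ_of_ne_zero hv0
        rw [pow_succ] at hv
        simp only [Nat.succ_sub_one]
        linarith
      · exact ⟨by simpa using hl''.k_eq, by simpa using hl''.n_eq, by simpa using hl''.m_eq,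
          by simpa using hl''.center, by simpa using hl''.customer⟩
      · intro x y hxy hy hd
        simpa [h'' x (by omega), h'' y hy] using h'.1 x y hxy hy hd
      · intro x hx
        obtain ⟨y, hy, hxy⟩ := h'.2.1 x hx
        obtain ⟨z, hz, hyz⟩ := hsrc y hy
        exact ⟨z, hz, by simp [h'' x hx, hxy, hyz]⟩
      · intro x hx
        obtain ⟨y, hy, hxy⟩ := hcov x hx
        obtain ⟨z, hz, hyz⟩ := h'.2.2 y hy
        exact ⟨z, hz, by simp [h'' z hz, hxy, hyz]⟩
    · refine ⟨1, h8, one_pos, ?_, h.of_same hs₁ rfl rfl rfl, ?_, ?_, ?_⟩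
      · rw [one_mul]; exact (Nat.lt_pow_succ_log_self one_lt_two _).le
      · intro x y _ _ hd
        rw [Nat.div_one, Nat.div_one] at hd
        rw [hd]
      · exact fun x hx => ⟨x, hx, by rw [h3₁]⟩
      · exact fun x hx => ⟨x, hx, by rw [h3₁]⟩
    · rintro s ⟨⟨v, w, h8, hw, hv, hl, hsort, hsrc, hcov⟩, hb⟩
      simp only [Test.Holds, NatExpr.eval, h8, hl.m_eq] at hb
      refine ⟨fun x y hxy hy => hsort x y hxy hy ?_, hsrc, hcov⟩
      rw [Nat.div_eq_of_lt (by omega), Nat.div_eq_of_lt (by omega)]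
  · have h1 : 0 < Nat.log 2 E.m + 2 := by omega
    nlinarith [Nat.zero_le (E.m * Nat.log 2 E.m)]

end KMedian

/-! ### One greedy run with a fixed threshold -/

namespace KMedian

open RealRAM

/-! ### The greedy phase: mathematics -/

/-- The budget `L` is realizable by the relaxation, and is compatible with the threshold `b`. -/
structure Realizable (E : EdgeList) (k : ℕ) (d : ℕ → ℝ) (b L : ℝ) : Prop where
  le : b ≤ capRatio k E.n * L
  -- An edge costing more than `b` costs at least the cap. Comparing with `b` therefore replaces
  -- comparing with the cap, which depends on the unknown budget.
  sep : ∀ t < E.m, d t ≤ b ∨ capRatio k E.n * L ≤ d t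
  value : E.LPValue d k L

/-- The number of unassigned customers. -/
noncomputable def missing (n : ℕ) (b : ℝ) (g : ℕ → ℝ) : ℝ := ∑ j ∈ Finset.range n, miss b (g j)

/-- The total cost of the assigned customers. -/
noncomputable def spent (n : ℕ) (b : ℝ) (g : ℕ → ℝ) : ℝ := ∑ j ∈ Finset.range n, paid b (g j)

theorem sum_capped (n : ℕ) (b θ : ℝ) (g : ℕ → ℝ) :
    ∑ j ∈ Finset.range n, capped b θ (g j) = θ * missing n b g + spent n b g := by
  simp only [capped, missing, spent, Finset.sum_add_distrib, Finset.mul_sum]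

theorem EdgeList.gain_capped (E : EdgeList) (d : ℕ → ℝ) (b θ : ℝ) (g : ℕ → ℝ) (i u : ℕ) :
    E.gain d b g (capped b θ) i u =
      θ * E.gain d b g (miss b) i u + E.gain d b g (paid b) i u := by
  simp only [EdgeList.gain, Finset.mul_sum, ← Finset.sum_add_distrib]
  refine Finset.sum_congr rfl fun t _ => ?_
  split_ifs
  · simp only [capped]; ring
  · ring

/-- The state of the greedy algorithm with threshold `b` after `u` steps: whether it has failed,
the budget `L` used so far, the centers picked so far, and the distances of the customers. -/
structure Greedy (E : EdgeList) (k : ℕ) (d : ℕ → ℝ) (b : ℝ) (u failed : ℕ) (L : ℝ)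
    (pick : ℕ → ℕ) (g : ℕ → ℝ) : Prop where
  picks : ∀ r < u, ∃ t < E.m, E.center t = pick r
  served : ∀ j < E.n, b < g j ∨ g j ≤ b ∧ 0 ≤ g j ∧
    ∃ t < E.m, ∃ r < u, E.customer t = j ∧ E.center t = pick r ∧ d t = g j
  -- The last inequality says that the capped cost with cap `ρL` is at most `L` times the potential.
  -- The one before makes its right side monotone in `L`, so the budget may be raised later.
  sound : failed = 0 → 0 ≤ L ∧ capRatio k E.n * missing E.n b g ≤ potential k E.n u ∧
    spent E.n b g ≤ L * (potential k E.n u - capRatio k E.n * missing E.n b g)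
  -- Optimality of the budget: the run never exceeds a positive realizable budget, and never fails
  -- if one exists.
  complete : ∀ L', 0 < L' → Realizable E k d b L' → failed = 0 ∧ L ≤ L'

section

variable {E : EdgeList} {k : ℕ} {d : ℕ → ℝ} {b : ℝ} {u failed : ℕ} {L : ℝ} {pick : ℕ → ℕ}
  {g : ℕ → ℝ}

theorem Greedy.init (g : ℕ → ℝ) (pick : ℕ → ℕ) (hg : ∀ j < E.n, b < g j) :
    Greedy E k d b 0 0 0 pick g where
  picks := by simp
  served j hj := .inl (hg j hj)
  sound _ := by
    have h1 : missing E.n b g = E.n := by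
      rw [missing, Finset.sum_congr rfl fun j hj => miss_of_lt (hg j (Finset.mem_range.1 hj))]
      simp
    have h2 : spent E.n b g = 0 := by
      rw [spent, Finset.sum_congr rfl fun j hj => paid_of_lt (hg j (Finset.mem_range.1 hj))]
      simp
    simp [h1, h2, potential, mul_comm]
  complete L' hL' _ := ⟨rfl, hL'.le⟩

theorem missing_relax (t : ℕ) : missing E.n b (E.relax d b g (E.center t) E.m) =
    missing E.n b g + E.gain d b g (miss b) (E.center t) E.m :=
  EdgeList.sum_relax (miss b) le_rfl

theorem spent_relax (t : ℕ) : spent E.n b (E.relax d b g (E.center t) E.m) =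
    spent E.n b g + E.gain d b g (paid b) (E.center t) E.m :=
  EdgeList.sum_relax (paid b) le_rfl

theorem Greedy.relax_served (h : Greedy E k d b u failed L pick g) (hd : ∀ t < E.m, 0 ≤ d t)
    (t : ℕ) : ∀ j < E.n, b < E.relax d b g (E.center t) E.m j ∨
      E.relax d b g (E.center t) E.m j ≤ b ∧ 0 ≤ E.relax d b g (E.center t) E.m j ∧
      ∃ t' < E.m, ∃ r < u + 1, E.customer t' = j ∧
        E.center t' = Function.update pick u (E.center t) r ∧
        d t' = E.relax d b g (E.center t) E.m j := by
  intro j hj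
  rcases EdgeList.relax_cases (E := E) (d := d) (b := b) (g := g) (i := E.center t) (u := E.m)
    (j := j) with h1 | ⟨t', ht', hc, hi, hr, hb⟩
  · rw [h1]
    refine (h.served j hj).imp_right fun ⟨h2, h3, t', ht', r, hr, hc, hp, hdt⟩ =>
      ⟨h2, h3, t', ht', r, by omega, hc, ?_, hdt⟩
    rw [Function.update_of_ne (by omega), hp]
  · rw [hr]
    exact .inr ⟨hb, hd t' ht', t', ht', u, by omega, hc, by simp [hi], rfl⟩

theorem Greedy.spent_relax_nonneg (h : Greedy E k d b u failed L pick g)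
    (hd : ∀ t < E.m, 0 ≤ d t) (t : ℕ) : 0 ≤ spent E.n b (E.relax d b g (E.center t) E.m) := by
  refine Finset.sum_nonneg fun j hj => ?_
  rcases h.relax_served hd t j (Finset.mem_range.1 hj) with h1 | ⟨h1, h2, -⟩
  · rw [paid_of_lt h1]
  · rw [paid_of_le h1]; exact h2

theorem Greedy.relax_picks (h : Greedy E k d b u failed L pick g) {t : ℕ} (ht : t < E.m) :
    ∀ r < u + 1, ∃ t' < E.m, E.center t' = Function.update pick u (E.center t) r := by
  intro r hr
  by_cases hru : r = u
  · subst hru; exact ⟨t, ht, by simp⟩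
  · rw [Function.update_of_ne hru]; exact h.picks r (by omega)

/-- Within every realizable budget there is a center that keeps the capped cost below the
potential. -/
theorem Greedy.exists_center (h : Greedy E k d b u failed L pick g) (hk : 1 ≤ k)
    (hn : 2 * k < E.n) (hm : 0 < E.m) (hd : ∀ t < E.m, 0 ≤ d t) {L' : ℝ} (hL' : 0 < L')
    (hr : Realizable E k d b L') : ∃ t < E.m,
      capRatio k E.n * missing E.n b (E.relax d b g (E.center t) E.m) < potential k E.n (u + 1) ∧
      spent E.n b (E.relax d b g (E.center t) E.m) / (potential k E.n (u + 1) -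
        capRatio k E.n * missing E.n b (E.relax d b g (E.center t) E.m)) ≤ L' := by
  have hk0 : (1 : ℝ) ≤ k := by exact_mod_cast hk
  have hn0 : (0 : ℝ) < E.n := by
    have : 0 < E.n := by omega
    exact_mod_cast this
  obtain ⟨hf, hLL⟩ := h.complete L' hL' hr
  obtain ⟨hL0, hcap, hsp⟩ := h.sound hf
  obtain ⟨t, ht, hgain⟩ := hr.value.exists_gain_le (g := g) (by omega) hm hr.le hr.sep
  set ρ := capRatio k E.n
  set H := ∑ j ∈ Finset.range E.n, capped b (ρ * L') (g j) with hH
  -- The invariant is transferred from the budget `L` of the run to the larger budget `L'`.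
  have hHle : H ≤ L' * potential k E.n u := by
    rw [hH, sum_capped]
    have := mul_le_mul_of_nonneg_right hLL (sub_nonneg.2 hcap)
    linarith
  have hx := missing_relax (E := E) (d := d) (b := b) (g := g) t
  have hy := spent_relax (E := E) (d := d) (b := b) (g := g) t
  have hy0 := h.spent_relax_nonneg hd t
  set x := missing E.n b (E.relax d b g (E.center t) E.m)
  set y := spent E.n b (E.relax d b g (E.center t) E.m)
  have hxy : ρ * L' * x + y = H + E.gain d b g (capped b (ρ * L')) (E.center t) E.m := by
    rw [hH, sum_capped, EdgeList.gain_capped, hx, hy]; ring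
  have hdrift : 1 / (k : ℝ) < drift k E.n := by
    rw [drift]
    refine div_lt_div_of_pos_right ?_ (by linarith)
    have : (0 : ℝ) < 2 * k * (2 * k + 1) / (E.n * E.n) := by positivity
    linarith
  have hk1 : (0 : ℝ) ≤ 1 - 1 / k := by
    rw [sub_nonneg, div_le_one (by linarith)]; exact hk0
  -- The drift exceeds `1 / k`, so for `L' > 0` the inequality is strict. As `y ≥ 0`, this makes the
  -- denominator of the required budget positive.
  have hlt : ρ * L' * x + y < L' * potential k E.n (u + 1) := by
    have e1 : ρ * L' * x + y ≤ H * (1 - 1 / k) + L' * (1 / k) := by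
      rw [hxy]
      have : H * (1 - 1 / k) + L' * (1 / k) = H + (L' - H) / k := by ring
      rw [this]; linarith
    have e2 := mul_le_mul_of_nonneg_right hHle hk1
    have e3 := mul_lt_mul_of_pos_left hdrift hL'
    rw [potential]
    linarith
  have hρx : ρ * x < potential k E.n (u + 1) := by
    have : L' * (ρ * x) < L' * potential k E.n (u + 1) := by linarith
    exact lt_of_mul_lt_mul_left this hL'.le
  refine ⟨t, ht, hρx, ?_⟩
  rw [div_le_iff₀ (by linarith)]
  linarith

/-- If no center keeps the caps below the potential, then by `Greedy.exists_center` no positive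
budget is realizable. The run still records some center, so that all runs have the same length. -/
theorem Greedy.step_failed (h : Greedy E k d b u failed L pick g) (hk : 1 ≤ k)
    (hn : 2 * k < E.n) (hd : ∀ t < E.m, 0 ≤ d t) {t : ℕ} (ht : t < E.m)
    (hnone : ∀ t < E.m, ¬ capRatio k E.n * missing E.n b (E.relax d b g (E.center t) E.m) <
      potential k E.n (u + 1)) :
    Greedy E k d b (u + 1) 1 L (Function.update pick u (E.center t))
      (E.relax d b g (E.center t) E.m) where
  picks := h.relax_picks ht
  served := h.relax_served hd t
  sound := by simp
  complete L' hL' hr := by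
    obtain ⟨t', ht', h1, -⟩ := h.exists_center hk hn (by omega) hd hL' hr
    exact absurd h1 (hnone t' ht')

/-- The chosen center needs the least budget, hence no more than the center that
`Greedy.exists_center` provides for any realizable budget. -/
theorem Greedy.step_found (h : Greedy E k d b u failed L pick g) (hk : 1 ≤ k)
    (hn : 2 * k < E.n) (hd : ∀ t < E.m, 0 ≤ d t) {t : ℕ} (ht : t < E.m)
    (hlt : capRatio k E.n * missing E.n b (E.relax d b g (E.center t) E.m) <
      potential k E.n (u + 1))
    {l : ℝ} (hl : l = spent E.n b (E.relax d b g (E.center t) E.m) / (potential k E.n (u + 1) -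
        capRatio k E.n * missing E.n b (E.relax d b g (E.center t) E.m)))
    (hmin : ∀ t' < E.m, capRatio k E.n * missing E.n b (E.relax d b g (E.center t') E.m) <
      potential k E.n (u + 1) →
      l ≤ spent E.n b (E.relax d b g (E.center t') E.m) / (potential k E.n (u + 1) -
        capRatio k E.n * missing E.n b (E.relax d b g (E.center t') E.m))) :
    Greedy E k d b (u + 1) failed (max L l) (Function.update pick u (E.center t))
      (E.relax d b g (E.center t) E.m) where
  picks := h.relax_picks ht
  served := h.relax_served hd t
  sound hf := by
    refine ⟨(h.sound hf).1.trans (le_max_left _ _), hlt.le, ?_⟩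
    have : l * (potential k E.n (u + 1) -
        capRatio k E.n * missing E.n b (E.relax d b g (E.center t) E.m)) =
        spent E.n b (E.relax d b g (E.center t) E.m) := by
      rw [hl]; exact div_mul_cancel₀ _ (by linarith)
    rw [← this]
    exact mul_le_mul_of_nonneg_right (le_max_right _ _) (by linarith)
  complete L' hL' hr := by
    obtain ⟨t', ht', h1, h2⟩ := h.exists_center hk hn (by omega) hd hL' hr
    obtain ⟨hf, hL⟩ := h.complete L' hL' hr
    exact ⟨hf, max_le hL ((hmin t' ht' h1).trans h2)⟩

end

/-! ### The greedy phase: program -/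

/-- The memory holds the instance, its reduced costs, and the numerical parameters. -/
structure Ready (E : EdgeList) (k : ℕ) (d : ℕ → ℝ) (s : Memory) : Prop extends
    Loaded E k s where
  costs : s.real 2 = d
  cap : s.real 14 0 = capRatio k E.n
  halting : s.real 15 0 = stopRatio k E.n
  drift : s.real 16 0 = drift k E.n
  factor : s.real 17 0 = 1 - 1 / k

theorem Ready.of_same {E : EdgeList} {k : ℕ} {d : ℕ → ℝ} {s s' : Memory} {P : Program}
    (h : Ready E k d s) (hs : Same P s s') (h0 : P.writesNat 0 = false)
    (h1 : P.writesNat 1 = false) (h2 : P.writesNat 2 = false) (h2' : P.writesReal 2 = false)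
    (h14 : P.writesReal 14 = false) (h15 : P.writesReal 15 = false)
    (h16 : P.writesReal 16 = false) (h17 : P.writesReal 17 = false) : Ready E k d s' :=
  ⟨h.toLoaded.of_same hs h0 h1 h2, by rw [hs.real 2 h2', h.costs], by rw [hs.real 14 h14, h.cap],
    by rw [hs.real 15 h15, h.halting], by rw [hs.real 16 h16, h.drift],
    by rw [hs.real 17 h17, h.factor]⟩

/-- The number of medians. -/
abbrev kExpr : NatExpr := .read 0 (.const 0)

/-- Compute the numerical parameters (real arrays `14` to `17`). -/
def setParameters : Program :=
  letReal 14 (.div (.ofNat nExpr) (.mul (.ofNat (.add (.add kExpr kExpr) (.const 1)))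
    (.sub (.ofNat nExpr) (.ofNat (.add kExpr kExpr))))) ;;
  letReal 15 (.div (.ofNat nExpr) (.sub (.ofNat nExpr) (.ofNat (.add kExpr kExpr)))) ;;
  letReal 16 (.div (.add (.ofNat (.const 1)) (.div (.mul (.ofNat (.add kExpr kExpr))
    (.ofNat (.add (.add kExpr kExpr) (.const 1)))) (.mul (.ofNat nExpr) (.ofNat nExpr))))
    (.ofNat kExpr)) ;;
  letReal 17 (.sub (.ofNat (.const 1)) (.div (.ofNat (.const 1)) (.ofNat kExpr)))

theorem ends_setParameters {E : EdgeList} {k : ℕ} {s₀ : Memory} (h : Loaded E k s₀) :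
    Ends setParameters s₀ 200 (Ready E k (s₀.real 2)) := by
  refine (Ends.of_wp ?_).mono (Nat.le_of_ble_eq_true rfl) fun _ => id
  have h0 := h.k_eq
  have h2 := h.n_eq
  refine ⟨⟨by simp [h0], by simp [h2], by simp [h.m_eq], by simp [h.center],
    by simp [h.customer]⟩, by simp, ?_, ?_, ?_, ?_⟩
  · simp [h0, h2, capRatio, two_mul]
  · simp [h0, h2, stopRatio, two_mul]
  · simp [h0, h2, KMedian.drift, two_mul]
  · simp [h0]

/-- Prepare a greedy run with the threshold `b` (real array `13`) of rank `q` (integer array `15`).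
Real array `5` holds the distances, real arrays `6` to `9` hold the number of unassigned customers,
the cost of the assigned ones, the budget and the potential; integer arrays `16`, `19` and `20`
hold the failure flag and the number and the list of centers picked. -/
def initGreedy : Program :=
  letReal 13 (.read 3 (nvar 15)) ;;
  forTo 7 nExpr (.setReal 5 (nvar 7) (.add (rvar 13) (.ofNat (.const 1)))) ;;
  letReal 6 (.ofNat nExpr) ;; letReal 7 (.ofNat (.const 0)) ;; letReal 8 (.ofNat (.const 0)) ;;
  letNat 16 (.const 0) ;; letNat 19 (.const 0) ;; letReal 9 (.mul (.ofNat nExpr) (rvar 14))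

/-- The greedy state is held in memory. -/
structure GreedyMem (E : EdgeList) (k : ℕ) (d : ℕ → ℝ) (b : ℝ) (u : ℕ) (s : Memory) :
    Prop where
  ready : Ready E k d s
  threshold : s.real 13 0 = b
  missing : s.real 6 0 = missing E.n b (s.real 5)
  spent : s.real 7 0 = spent E.n b (s.real 5)
  potential : s.real 9 0 = potential k E.n u
  count : s.nat 19 0 = u
  greedy : Greedy E k d b u (s.nat 16 0) (s.real 8 0) (s.nat 20) (s.real 5)

theorem Ready.of_eq {E : EdgeList} {k : ℕ} {d : ℕ → ℝ} {s s' : Memory} (h : Ready E k d s)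
    (h0 : s'.nat 0 = s.nat 0) (h1 : s'.nat 1 = s.nat 1) (h2 : s'.nat 2 = s.nat 2)
    (h2' : s'.real 2 = s.real 2) (h14 : s'.real 14 = s.real 14) (h15 : s'.real 15 = s.real 15)
    (h16 : s'.real 16 = s.real 16) (h17 : s'.real 17 = s.real 17) : Ready E k d s' :=
  ⟨⟨by rw [h0, h.k_eq], by rw [h0, h.n_eq], by rw [h0, h.m_eq], by rw [h1, h.center],
    by rw [h2, h.customer]⟩, by rw [h2', h.costs], by rw [h14, h.cap], by rw [h15, h.halting],
    by rw [h16, h.drift], by rw [h17, h.factor]⟩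

theorem ends_initGreedy {E : EdgeList} {k : ℕ} {d : ℕ → ℝ} {s₀ : Memory} (h : Ready E k d s₀)
    (hnm : E.n ≤ E.m) :
    Ends initGreedy s₀ (200 * (E.m + 1))
      (GreedyMem E k d (s₀.real 3 (s₀.nat 15 0)) 0) := by
  set b := s₀.real 3 (s₀.nat 15 0) with hb
  have first : Ends (letReal 13 (.read 3 (nvar 15))) s₀ 5 (fun s => s.real 13 0 = b) :=
    (Ends.of_wp (P := letReal 13 (.read 3 (nvar 15))) (by simp [hb])).mono
      (Nat.le_of_ble_eq_true rfl) fun _ => id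
  have second : ∀ s₁, Ready E k d s₁ → s₁.real 13 0 = b →
      Ends (forTo 7 nExpr (.setReal 5 (nvar 7) (.add (rvar 13) (.ofNat (.const 1))))) s₁
        (100 * (E.m + 1)) (fun s => ∀ j < E.n, s.real 5 j = b + 1) := by
    intro s₁ h1 hb1
    refine (Ends.forTo (N := E.n) (B := 50) (fun u s => ∀ j < u, s.real 5 j = b + 1)
      (by simp) ?_ ?_).mono ?_ fun _ => id
    · intro s hs
      simp [(h1.of_same hs rfl rfl rfl rfl rfl rfl rfl rfl).n_eq]
    · rintro u hu s hs h7 hA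
      have hr : s.real 13 0 = b := by rw [hs.real 13 rfl, hb1]
      refine (Ends.of_wp ?_).mono (N := _) (Nat.le_of_ble_eq_true rfl) fun _ => id
      refine ⟨by simp [h7], fun j hj => ?_⟩
      by_cases hju : j = u
      · subst hju; simp [h7, hr]
      · simpa [h7, hju] using hA j (by omega)
    · rw [mul_comm]
      exact Nat.mul_le_mul (Nat.le_of_ble_eq_true rfl) (by omega)
  refine (first.seq_same fun s₁ hb1 hs1 => ?_).mono (N := 5 + (100 * (E.m + 1) + 50))
    (by omega) fun _ => id
  have hr1 := h.of_same hs1 rfl rfl rfl rfl rfl rfl rfl rfl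
  refine (second s₁ hr1 hb1).seq_same fun s₂ hg hs2 => ?_
  have hr2 := hr1.of_same hs2 rfl rfl rfl rfl rfl rfl rfl rfl
  have hb2 : s₂.real 13 0 = b := by rw [hs2.real 13 rfl, hb1]
  refine (Ends.of_wp ?_).mono (N := _) (Nat.le_of_ble_eq_true rfl) fun _ => id
  -- The initial distance `b + 1` stands for infinity: any value above `b` means unassigned.
  have hlt : ∀ j < E.n, b < s₂.real 5 j := fun j hj => by rw [hg j hj]; linarith
  refine ⟨hr2.of_eq ?_ ?_ ?_ ?_ ?_ ?_ ?_ ?_, ?_, ?_, ?_, ?_, ?_, ?_⟩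
  any_goals first | (simp; done) | skip
  · simpa using hb2
  · simp only [KMedian.missing]
    rw [Finset.sum_congr rfl fun j hj => miss_of_lt (by simpa using hlt j (Finset.mem_range.1 hj))]
    simp [hr2.n_eq]
  · simp only [KMedian.spent]
    rw [Finset.sum_congr rfl fun j hj => paid_of_lt (by simpa using hlt j (Finset.mem_range.1 hj))]
    simp
  · simp [KMedian.potential, hr2.n_eq, hr2.cap]
  · simpa using Greedy.init (k := k) (d := d) (s₂.real 5) (s₂.nat 20) hlt

/-- Clear the gains (real arrays `10` and `11`) of all centers. -/
def clearGains : Program :=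
  forTo 7 mExpr (.setReal 10 curCenter (.ofNat (.const 0)) ;;
    .setReal 11 curCenter (.ofNat (.const 0)))

theorem ends_clearGains {E : EdgeList} {k : ℕ} {d : ℕ → ℝ} {s₀ : Memory} (h : Ready E k d s₀) :
    Ends clearGains s₀ (100 * (E.m + 1)) (fun s => ∀ t < E.m, s.real 10 (E.center t) = 0 ∧
      s.real 11 (E.center t) = 0) := by
  refine (Ends.forTo (N := E.m) (B := 50) (fun u s => ∀ t < u, s.real 10 (E.center t) = 0 ∧
      s.real 11 (E.center t) = 0) (by simp) ?_ ?_).mono ?_ fun _ => id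
  · intro s hs
    simp [(h.of_same hs rfl rfl rfl rfl rfl rfl rfl rfl).m_eq]
  · rintro u hu s hs h7 hA
    have hr := h.of_same hs rfl rfl rfl rfl rfl rfl rfl rfl
    refine (Ends.of_wp ?_).mono (N := _) (Nat.le_of_ble_eq_true rfl) fun _ => id
    refine ⟨by simp [h7], fun t ht => ?_⟩
    by_cases htu : E.center t = E.center u
    · simp [h7, hr.center, htu]
    · have : t ≠ u := fun h => htu (by rw [h])
      simpa [h7, hr.center, htu] using hA t (by omega)
  · rw [mul_comm]
    exact Nat.mul_le_mul_right _ (Nat.le_of_ble_eq_true rfl)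

/-- The edge at the loop counter is an improvement. -/
abbrev improvesTest : Test :=
  .and (.realLe (.read 2 (nvar 7)) (rvar 13))
    (.not (.realLe (.read 5 curCustomer) (.read 2 (nvar 7))))

/-- Compute the change of the number of unassigned customers (real array `10`) and of the cost of
the assigned ones (real array `11`) for every center. -/
def computeGains : Program :=
  forTo 7 mExpr
    (.ite improvesTest
      (.ite (.realLe (.read 5 curCustomer) (rvar 13))
        (.setReal 11 curCenter (.add (.read 11 curCenter)
          (.sub (.read 2 (nvar 7)) (.read 5 curCustomer))))
        (.setReal 10 curCenter (.sub (.read 10 curCenter) (.ofNat (.const 1))) ;;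
          .setReal 11 curCenter (.add (.read 11 curCenter) (.read 2 (nvar 7)))))
      .skip)

/-- One pass serves all centers: each edge contributes to the gain of its own center only, measured
against the unchanged distances. -/
theorem ends_computeGains {E : EdgeList} {k : ℕ} {d : ℕ → ℝ} {b : ℝ} {s₀ : Memory}
    (h : Ready E k d s₀) (hb : s₀.real 13 0 = b)
    (h0 : ∀ t < E.m, s₀.real 10 (E.center t) = 0 ∧ s₀.real 11 (E.center t) = 0) :
    Ends computeGains s₀ (200 * (E.m + 1)) (fun s => ∀ t < E.m,
      s.real 10 (E.center t) = E.gain d b (s₀.real 5) (miss b) (E.center t) E.m ∧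
      s.real 11 (E.center t) = E.gain d b (s₀.real 5) (paid b) (E.center t) E.m) := by
  refine (Ends.forTo (N := E.m) (B := 150) (fun u s => ∀ t < E.m,
      s.real 10 (E.center t) = E.gain d b (s₀.real 5) (miss b) (E.center t) u ∧
      s.real 11 (E.center t) = E.gain d b (s₀.real 5) (paid b) (E.center t) u)
      (by simpa [EdgeList.gain] using h0) ?_ ?_).mono ?_ fun _ => id
  · intro s hs
    simp [(h.of_same hs rfl rfl rfl rfl rfl rfl rfl rfl).m_eq]
  · rintro u hu s hs h7 hA
    have hr := h.of_same hs rfl rfl rfl rfl rfl rfl rfl rfl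
    have hb' : s.real 13 0 = b := by rw [hs.real 13 rfl, hb]
    have h5 : s.real 5 = s₀.real 5 := hs.real 5 rfl
    refine (Ends.of_wp ?_).mono (N := _) (Nat.le_of_ble_eq_true rfl) fun _ => id
    classical
    have hsucc : ∀ φ i, E.gain d b (s₀.real 5) φ i (u + 1) = E.gain d b (s₀.real 5) φ i u +
        if E.center u = i ∧ E.Improves d b (s₀.real 5) u
          then φ (d u) - φ (s₀.real 5 (E.customer u)) else 0 := fun φ i =>
      Finset.sum_range_succ _ _
    simp only [wp, Test.Holds, NatExpr.eval, RealExpr.eval, h7, hr.center, hr.customer, hr.costs,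
      hb', h5]
    refine ⟨fun h1 => ⟨fun h2 => ⟨by simp [h7], fun t ht => ?_⟩,
      fun h2 => ⟨by simp [h7], fun t ht => ?_⟩⟩, fun h1 => ⟨by simp, fun t ht => ?_⟩⟩
    · have himp : E.Improves d b (s₀.real 5) u := ⟨h1.1, not_le.1 h1.2⟩
      rw [hsucc, hsucc, miss_of_le h1.1, paid_of_le h1.1, miss_of_le h2, paid_of_le h2]
      by_cases htu : E.center u = E.center t
      · rw [if_pos ⟨htu, himp⟩, if_pos ⟨htu, himp⟩, ← (hA t ht).1, ← (hA t ht).2]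
        simp [htu]
      · rw [if_neg fun h => htu h.1, if_neg fun h => htu h.1, ← (hA t ht).1, ← (hA t ht).2]
        simp [Function.update_of_ne (Ne.symm htu)]
    · have himp : E.Improves d b (s₀.real 5) u := ⟨h1.1, not_le.1 h1.2⟩
      rw [hsucc, hsucc, miss_of_le h1.1, paid_of_le h1.1, miss_of_lt (not_le.1 h2),
        paid_of_lt (not_le.1 h2)]
      by_cases htu : E.center u = E.center t
      · rw [if_pos ⟨htu, himp⟩, if_pos ⟨htu, himp⟩, ← (hA t ht).1, ← (hA t ht).2]
        simp [h7, hr.center, hr.costs, htu]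
        ring
      · rw [if_neg fun h => htu h.1, if_neg fun h => htu h.1, ← (hA t ht).1, ← (hA t ht).2]
        simp [h7, hr.center, Function.update_of_ne (Ne.symm htu)]
    · have himp : ¬ E.Improves d b (s₀.real 5) u := fun h => h1 ⟨h.1, not_le.2 h.2⟩
      rw [hsucc, hsucc, if_neg fun h => himp h.2, if_neg fun h => himp h.2, ← (hA t ht).1,
        ← (hA t ht).2]
      simp
  · rw [mul_comm]
    exact Nat.mul_le_mul_right _ (Nat.le_of_ble_eq_true rfl)

/-- The capped number of unassigned customers after adding the center of the current edge. -/
abbrev candidateCap : RealExpr := .mul (rvar 14) (.add (rvar 6) (.read 10 curCenter))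

/-- The budget required for adding the center of the current edge. -/
abbrev candidateBudget : RealExpr :=
  .div (.add (rvar 7) (.read 11 curCenter)) (.sub (rvar 9) candidateCap)

/-- Find the edge (integer array `18`) whose center requires the smallest budget
(real array `12`), and set integer array `17` to `1` if there is one. -/
def findBest : Program :=
  letNat 17 (.const 0) ;; letNat 18 (.const 0) ;;
  forTo 7 mExpr
    (.ite (.not (.realLe (rvar 9) candidateCap))
      (.ite (.and (.natLe (.const 1) (nvar 17)) (.realLe (rvar 12) candidateBudget)) .skip
        (letNat 17 (.const 1) ;; letNat 18 (nvar 7) ;; letReal 12 candidateBudget))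
      .skip)

/-- Here `x t` and `y t` are the totals after adding the center of edge `t`. Running over edges
suffices, since `Greedy.exists_center` provides a center with an edge. -/
theorem ends_findBest {E : EdgeList} {k : ℕ} {d : ℕ → ℝ} {s₀ : Memory} (h : Ready E k d s₀)
    (x y : ℕ → ℝ) (hm : 0 < E.m)
    (hx : ∀ t < E.m, s₀.real 6 0 + s₀.real 10 (E.center t) = x t)
    (hy : ∀ t < E.m, s₀.real 7 0 + s₀.real 11 (E.center t) = y t) :
    Ends findBest s₀ (200 * (E.m + 1)) (fun s => s.nat 18 0 < E.m ∧
      ((s.nat 17 0 = 0 ∧ ∀ t < E.m, ¬ capRatio k E.n * x t < s₀.real 9 0) ∨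
       (s.nat 17 0 = 1 ∧ capRatio k E.n * x (s.nat 18 0) < s₀.real 9 0 ∧
        s.real 12 0 = y (s.nat 18 0) / (s₀.real 9 0 - capRatio k E.n * x (s.nat 18 0)) ∧
        ∀ t < E.m, capRatio k E.n * x t < s₀.real 9 0 →
          s.real 12 0 ≤ y t / (s₀.real 9 0 - capRatio k E.n * x t)))) := by
  refine Ends.mono (N := 3 + (3 + 150 * (E.m + 1))) (Q := _) ?_ (by omega) fun _ => id
  refine Ends.seq_same (R := fun s => s.nat 17 0 = 0)
    (Ends.of_wp (P := letNat 17 (.const 0)) (by simp)) fun s₁ h17 hs1 =>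
    Ends.seq_same (R := fun s => s.nat 18 0 = 0)
    (Ends.of_wp (P := letNat 18 (.const 0)) (by simp)) fun s₂ h18 hs2 => ?_
  have hr2 := (h.of_same hs1 rfl rfl rfl rfl rfl rfl rfl rfl).of_same hs2 rfl rfl rfl rfl rfl rfl
    rfl rfl
  have h17' : s₂.nat 17 0 = 0 := by rw [hs2.nat 17 rfl, h17]
  have e : ∀ a, s₂.real a = s₀.real a := fun a => (hs2.real a rfl).trans (hs1.real a rfl)
  refine (Ends.forTo (N := E.m) (B := 100) (fun u s => s.nat 18 0 < E.m ∧
      ((s.nat 17 0 = 0 ∧ ∀ t < u, ¬ capRatio k E.n * x t < s₀.real 9 0) ∨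
       (s.nat 17 0 = 1 ∧ capRatio k E.n * x (s.nat 18 0) < s₀.real 9 0 ∧
        s.real 12 0 = y (s.nat 18 0) / (s₀.real 9 0 - capRatio k E.n * x (s.nat 18 0)) ∧
        ∀ t < u, capRatio k E.n * x t < s₀.real 9 0 →
          s.real 12 0 ≤ y t / (s₀.real 9 0 - capRatio k E.n * x t))))
      (by simp [h17', h18, hm]) ?_ ?_).mono ?_ fun _ => id
  · intro s hs
    simp [(hr2.of_same hs rfl rfl rfl rfl rfl rfl rfl rfl).m_eq]
  · rintro u hu s hs h7 ⟨hA, hB⟩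
    have hr := hr2.of_same hs rfl rfl rfl rfl rfl rfl rfl rfl
    have r6 : s.real 6 = s₀.real 6 := (hs.real 6 rfl).trans (e 6)
    have r7 : s.real 7 = s₀.real 7 := (hs.real 7 rfl).trans (e 7)
    have r9 : s.real 9 = s₀.real 9 := (hs.real 9 rfl).trans (e 9)
    have r10 : s.real 10 = s₀.real 10 := (hs.real 10 rfl).trans (e 10)
    have r11 : s.real 11 = s₀.real 11 := (hs.real 11 rfl).trans (e 11)
    refine (Ends.of_wp ?_).mono (N := _) (Nat.le_of_ble_eq_true rfl) fun _ => id
    simp only [wp, Test.Holds, NatExpr.eval, RealExpr.eval, h7, hr.center, hr.cap, r6, r7, r9,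
      r10, r11, hx u hu, hy u hu, not_le]
    have hlast : ∀ {q : ℕ → Prop}, (∀ t < u, q t) → q u → ∀ t < u + 1, q t := by
      intro q h1 h2 t ht
      rcases Nat.lt_succ_iff_lt_or_eq.1 ht with ht | rfl
      exacts [h1 t ht, h2]
    refine ⟨fun h1 => ⟨fun h2 => ⟨by simp, by simpa using hA, .inr ?_⟩, fun h2 =>
      ⟨by simp [h7], by simpa [h7] using hu, .inr ⟨by simp, by simpa [h7] using h1, ?_, ?_⟩⟩⟩,
      fun h1 => ⟨by simp, by simpa using hA, ?_⟩⟩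
    · rcases hB with ⟨hf, -⟩ | ⟨hf, hb1, hb2, hb3⟩
      · omega
      · exact ⟨by simpa using hf, by simpa using hb1, by simpa using hb2,
          by simpa using hlast hb3 fun _ => h2.2⟩
    · simp [h7, hr.center, hr.cap, r6, r7, r9, r10, r11, hx u hu, hy u hu]
    · have : ∀ t < u, capRatio k E.n * x t < s₀.real 9 0 →
          y u / (s₀.real 9 0 - capRatio k E.n * x u) ≤
            y t / (s₀.real 9 0 - capRatio k E.n * x t) := by
        intro t ht hxt
        rcases hB with ⟨-, hf⟩ | ⟨hf, hb1, hb2, hb3⟩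
        · exact absurd hxt (hf t ht)
        · simp only [hf, le_refl, true_and, not_le] at h2
          exact h2.le.trans (hb3 t ht hxt)
      simpa [h7, hr.center, hr.cap, r6, r7, r9, r10, r11, hx u hu, hy u hu] using
        hlast this fun _ => le_rfl
    · rcases hB with ⟨hf, hb⟩ | ⟨hf, hb1, hb2, hb3⟩
      · exact .inl ⟨by simpa using hf, hlast hb h1⟩
      · exact .inr ⟨by simpa using hf, by simpa using hb1, by simpa using hb2,
          by simpa using hlast hb3 fun h => absurd h h1⟩
  · rw [mul_comm]
    exact Nat.mul_le_mul_right _ (Nat.le_of_ble_eq_true rfl)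

/-- The center picked by `findBest`. -/
abbrev bestCenter : NatExpr := .read 1 (nvar 18)

/-- Update the budget, or set the failure flag; record the center and update the totals. -/
def recordBest : Program :=
  .ite (.natLe (.const 1) (nvar 17)) (.ite (.realLe (rvar 12) (rvar 8)) .skip
    (letReal 8 (rvar 12))) (letNat 16 (.const 1)) ;;
  .setNat 20 (nvar 19) bestCenter ;; incr 19 ;;
  letReal 6 (.add (rvar 6) (.read 10 bestCenter)) ;;
  letReal 7 (.add (rvar 7) (.read 11 bestCenter))

/-- Update the distances. -/
def applyBest : Program :=
  forTo 7 mExpr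
    (.ite (.and (.and (.natLe curCenter bestCenter) (.natLe bestCenter curCenter)) improvesTest)
      (.setReal 5 curCustomer (.read 2 (nvar 7))) .skip)

theorem ends_applyBest {E : EdgeList} {k : ℕ} {d : ℕ → ℝ} {b : ℝ} {s₀ : Memory}
    (h : Ready E k d s₀) (hb : s₀.real 13 0 = b) :
    Ends applyBest s₀ (200 * (E.m + 1)) (fun s =>
      s.real 5 = E.relax d b (s₀.real 5) (E.center (s₀.nat 18 0)) E.m) := by
  refine (Ends.forTo (N := E.m) (B := 100) (fun u s =>
      s.real 5 = E.relax d b (s₀.real 5) (E.center (s₀.nat 18 0)) u)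
      (by simp [EdgeList.relax]) ?_ ?_).mono ?_ fun _ => id
  · intro s hs
    simp [(h.of_same hs rfl rfl rfl rfl rfl rfl rfl rfl).m_eq]
  · rintro u hu s hs h7 hA
    have hr := h.of_same hs rfl rfl rfl rfl rfl rfl rfl rfl
    have hb' : s.real 13 0 = b := by rw [hs.real 13 rfl, hb]
    have h18 : s.nat 18 = s₀.nat 18 := hs.nat 18 rfl
    refine (Ends.of_wp ?_).mono (N := _) (Nat.le_of_ble_eq_true rfl) fun _ => id
    simp only [wp, Test.Holds, NatExpr.eval, RealExpr.eval, h7, hr.center, hr.customer, hr.costs,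
      hb', hA, h18, not_le]
    refine ⟨fun h1 => ⟨by simp [h7], ?_⟩, fun h1 => ⟨by simp, ?_⟩⟩
    · rw [EdgeList.relax, if_pos ⟨le_antisymm h1.1.1 h1.1.2, h1.2⟩]
      simp [hA]
    · rw [EdgeList.relax, if_neg fun h2 => h1 ⟨⟨h2.1.le, h2.1.ge⟩, h2.2⟩]
      simp [hA]
  · rw [mul_comm]
    exact Nat.mul_le_mul_right _ (Nat.le_of_ble_eq_true rfl)

/-- One greedy step. -/
def greedyStep : Program :=
  letReal 9 (.add (.mul (rvar 9) (rvar 17)) (rvar 16)) ;; clearGains ;; computeGains ;;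
    findBest ;; recordBest ;; applyBest

/-- By `missing_relax` and `spent_relax` the gains give the new totals exactly, so these are
recorded before the distances are updated. -/
theorem ends_greedyStep {E : EdgeList} {k : ℕ} {d : ℕ → ℝ} {b : ℝ} {u : ℕ} {s₀ : Memory}
    (hk : 1 ≤ k) (hn : 2 * k < E.n) (hm : 0 < E.m) (hd : ∀ t < E.m, 0 ≤ d t)
    (h : GreedyMem E k d b u s₀) :
    Ends greedyStep s₀ (1000 * (E.m + 1)) (GreedyMem E k d b (u + 1)) := by
  have first : Ends (letReal 9 (.add (.mul (rvar 9) (rvar 17)) (rvar 16))) s₀ 20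
      (fun s => s.real 9 0 = potential k E.n (u + 1)) :=
    (Ends.of_wp (P := letReal 9 (.add (.mul (rvar 9) (rvar 17)) (rvar 16)))
      (by simp [KMedian.potential, h.potential, h.ready.factor, h.ready.drift])).mono
      (Nat.le_of_ble_eq_true rfl) fun _ => id
  refine Ends.mono (N := 20 + (100 * (E.m + 1) + (200 * (E.m + 1) + (200 * (E.m + 1) +
    (100 + 200 * (E.m + 1)))))) (Q := _) ?_ (by omega) fun _ => id
  refine first.seq_same fun s₁ hP1 hs1 => ?_
  have hr1 := h.ready.of_same hs1 rfl rfl rfl rfl rfl rfl rfl rfl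
  refine (ends_clearGains hr1).seq_same fun s₂ h0 hs2 => ?_
  have hr2 := hr1.of_same hs2 rfl rfl rfl rfl rfl rfl rfl rfl
  have hb2 : s₂.real 13 0 = b := by rw [hs2.real 13 rfl, hs1.real 13 rfl, h.threshold]
  have hg2 : s₂.real 5 = s₀.real 5 := by rw [hs2.real 5 rfl, hs1.real 5 rfl]
  refine (ends_computeGains hr2 hb2 h0).seq_same fun s₃ hgain hs3 => ?_
  rw [hg2] at hgain
  have hr3 := hr2.of_same hs3 rfl rfl rfl rfl rfl rfl rfl rfl
  have h6 : s₃.real 6 = s₀.real 6 := by rw [hs3.real 6 rfl, hs2.real 6 rfl, hs1.real 6 rfl]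
  have h7 : s₃.real 7 = s₀.real 7 := by rw [hs3.real 7 rfl, hs2.real 7 rfl, hs1.real 7 rfl]
  have h9 : s₃.real 9 0 = potential k E.n (u + 1) := by rw [hs3.real 9 rfl, hs2.real 9 rfl, hP1]
  have hX : ∀ t < E.m, s₃.real 6 0 + s₃.real 10 (E.center t) =
      missing E.n b (E.relax d b (s₀.real 5) (E.center t) E.m) := fun t ht => by
    rw [missing_relax, (hgain t ht).1, h6, h.missing]
  have hY : ∀ t < E.m, s₃.real 7 0 + s₃.real 11 (E.center t) =
      spent E.n b (E.relax d b (s₀.real 5) (E.center t) E.m) := fun t ht => by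
    rw [spent_relax, (hgain t ht).2, h7, h.spent]
  refine (ends_findBest hr3 _ _ hm hX hY).seq_same fun s₄ hbest hs4 => ?_
  obtain ⟨hbm, hbest⟩ := hbest
  have hr4 := hr3.of_same hs4 rfl rfl rfl rfl rfl rfl rfl rfl
  rw [h9] at hbest
  have h16 : s₄.nat 16 = s₀.nat 16 := by
    rw [hs4.nat 16 rfl, hs3.nat 16 rfl, hs2.nat 16 rfl, hs1.nat 16 rfl]
  have h19 : s₄.nat 19 0 = u := by
    rw [hs4.nat 19 rfl, hs3.nat 19 rfl, hs2.nat 19 rfl, hs1.nat 19 rfl, h.count]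
  have h20 : s₄.nat 20 = s₀.nat 20 := by
    rw [hs4.nat 20 rfl, hs3.nat 20 rfl, hs2.nat 20 rfl, hs1.nat 20 rfl]
  have h8 : s₄.real 8 = s₀.real 8 := by
    rw [hs4.real 8 rfl, hs3.real 8 rfl, hs2.real 8 rfl, hs1.real 8 rfl]
  set t₀ := s₄.nat 18 0 with ht₀
  set g' := E.relax d b (s₀.real 5) (E.center t₀) E.m with hg'
  have h6' : s₄.real 6 0 + s₄.real 10 (E.center t₀) = missing E.n b g' := by
    rw [hs4.real 6 rfl, hs4.real 10 rfl, hX t₀ hbm]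
  have h7' : s₄.real 7 0 + s₄.real 11 (E.center t₀) = spent E.n b g' := by
    rw [hs4.real 7 rfl, hs4.real 11 rfl, hY t₀ hbm]
  have hrecord : Ends recordBest s₄ 100 (fun s => s.nat 19 0 = u + 1 ∧
      s.real 6 0 = missing E.n b g' ∧ s.real 7 0 = spent E.n b g' ∧
      Greedy E k d b (u + 1) (s.nat 16 0) (s.real 8 0) (s.nat 20) g') := by
    refine (Ends.of_wp ?_).mono (Nat.le_of_ble_eq_true rfl) fun _ => id
    have hgr := h.greedy
    simp only [recordBest, wp, Test.Holds, NatExpr.eval, RealExpr.eval, h8]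
    refine ⟨fun h1 => ⟨fun h2 => ?_, fun h2 => ?_⟩, fun h1 => ?_⟩
    · rcases hbest with ⟨h17, -⟩ | ⟨-, hb1, hb2, hb3⟩
      · omega
      · have := hgr.step_found hk hn hd hbm hb1 hb2 hb3
        rw [max_eq_left h2] at this
        simpa [h19, h20, h16, h8, hr4.center, ← ht₀, h6', h7'] using this
    · rcases hbest with ⟨h17, -⟩ | ⟨-, hb1, hb2, hb3⟩
      · omega
      · have := hgr.step_found hk hn hd hbm hb1 hb2 hb3
        rw [max_eq_right (not_le.1 h2).le] at this
        simpa [h19, h20, h16, h8, hr4.center, ← ht₀, h6', h7'] using this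
    · rcases hbest with ⟨-, hb⟩ | ⟨h17, -⟩
      · have := hgr.step_failed hk hn hd hbm hb
        simpa [h19, h20, h16, h8, hr4.center, ← ht₀, h6', h7'] using this
      · omega
  refine hrecord.seq_same fun s₅ hrec hs5 => ?_
  obtain ⟨h19', h6'', h7'', hgr'⟩ := hrec
  have hr5 := hr4.of_same hs5 rfl rfl rfl rfl rfl rfl rfl rfl
  have hb5 : s₅.real 13 0 = b := by
    rw [hs5.real 13 rfl, hs4.real 13 rfl, hs3.real 13 rfl, hb2]
  refine (ends_applyBest hr5 hb5).same.mono le_rfl fun s₆ ⟨h5, hs6⟩ => ?_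
  have h5' : s₆.real 5 = g' := by
    rw [h5, hs5.real 5 rfl, hs4.real 5 rfl, hs3.real 5 rfl, hg2, hs5.nat 18 rfl]
  refine ⟨hr5.of_same hs6 rfl rfl rfl rfl rfl rfl rfl rfl, ?_, ?_, ?_, ?_, ?_, ?_⟩
  · rw [hs6.real 13 rfl, hb5]
  · rw [hs6.real 6 rfl, h5', h6'']
  · rw [hs6.real 7 rfl, h5', h7'']
  · rw [hs6.real 9 rfl, hs5.real 9 rfl, hs4.real 9 rfl, h9]
  · rw [hs6.nat 19 rfl, h19']
  · rw [hs6.nat 16 rfl, hs6.real 8 rfl, hs6.nat 20 rfl, h5']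
    exact hgr'

/-- A greedy run. -/
def greedyRun : Program :=
  initGreedy ;; .while (.realLe (rvar 15) (rvar 9)) greedyStep

/-- The guard only looks at the potential, which depends on `k`, `n` and the step. Every run thus
takes exactly `numSteps` steps, whatever the threshold. -/
theorem ends_greedyRun {E : EdgeList} {k : ℕ} {d : ℕ → ℝ} {s₀ : Memory}
    (hk : 1 ≤ k) (hn : 2 * k < E.n) (hnm : E.n ≤ E.m) (hd : ∀ t < E.m, 0 ≤ d t)
    (h : Ready E k d s₀) :
    Ends greedyRun s₀ (2000 * (E.m + 1) * (numSteps k E.n + 1))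
      (GreedyMem E k d (s₀.real 3 (s₀.nat 15 0)) (numSteps k E.n)) := by
  set b := s₀.real 3 (s₀.nat 15 0)
  refine Ends.mono (N := 200 * (E.m + 1) +
    (numSteps k E.n * (1000 * (E.m + 1) + 5 + 1) + 5 + 1)) (Q := _) ?_ ?_ fun _ => id
  · refine (ends_initGreedy h hnm).seq fun s₁ h1 => ?_
    refine (Ends.while (B := 1000 * (E.m + 1)) (fun v s => ∃ u, u + v = numSteps k E.n ∧
      GreedyMem E k d b u s) ?_ (numSteps k E.n) s₁ ⟨0, by omega, h1⟩).mono
      (by simp only [Test.cost, RealExpr.cost, NatExpr.cost]; exact le_rfl) ?_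
    · rintro v s ⟨u, huv, hs⟩ hb
      simp only [Test.Holds, RealExpr.eval, NatExpr.eval, hs.ready.halting, hs.potential] at hb
      have hv : 0 < v := by
        by_contra h0
        have : u = numSteps k E.n := by omega
        subst this
        exact absurd (potential_numSteps hk hn) (not_lt.2 hb)
      exact (ends_greedyStep hk hn (by omega) hd hs).mono le_rfl fun s' hs' =>
        ⟨v - 1, by omega, u + 1, by omega, hs'⟩
    · rintro s ⟨⟨v, u, huv, hs⟩, hb⟩
      simp only [Test.Holds, RealExpr.eval, NatExpr.eval, hs.ready.halting, hs.potential] at hb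
      have : u = numSteps k E.n := by
        by_contra hu
        exact hb (stopRatio_le_potential (by omega))
      exact this ▸ hs
  · nlinarith [Nat.zero_le (E.m * numSteps k E.n)]

end KMedian

/-! ### Binary search for the threshold and completion of the solution -/

namespace KMedian

open RealRAM

/-! ### Searching for the threshold -/

/-- Used when the reduced LP value is zero: small positive budgets then have caps below all positive
costs. -/
theorem exists_pos_gap (m : ℕ) (d : ℕ → ℝ) : ∃ δ > 0, ∀ t < m, d t ≤ 0 ∨ δ ≤ d t := by
  induction m with
  | zero => exact ⟨1, one_pos, by simp⟩
  | succ m ih =>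
    obtain ⟨δ, hδ, h⟩ := ih
    by_cases hm : d m ≤ 0
    · refine ⟨δ, hδ, fun t ht => ?_⟩
      rcases Nat.lt_succ_iff_lt_or_eq.1 ht with ht | rfl
      exacts [h t ht, .inl hm]
    · refine ⟨min δ (d m), lt_min hδ (not_le.1 hm), fun t ht => ?_⟩
      rcases Nat.lt_succ_iff_lt_or_eq.1 ht with ht | rfl
      exacts [(h t ht).imp_right (min_le_left _ _).trans, .inr (min_le_right _ _)]

section

variable {E : EdgeList} {k : ℕ} {d : ℕ → ℝ} {b : ℝ} {u failed : ℕ} {L : ℝ} {pick : ℕ → ℕ}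
  {g : ℕ → ℝ}

/-- `Greedy.complete` for budgets that may vanish. -/
theorem Greedy.le_of_realizable (h : Greedy E k d b u failed L pick g) (hn : 2 * k < E.n)
    (hd : ∀ t < E.m, 0 ≤ d t) (hb : 0 ≤ b) {A : ℝ} (hA : Realizable E k d b A) :
    failed = 0 ∧ L ≤ A := by
  have hρ := capRatio_pos hn
  rcases (hA.value.nonneg hd).lt_or_eq with h0 | h0
  · exact h.complete A h0 hA
  -- For `A = 0` the field `complete` is not available. Budgets below `δ / ρ` are positive and still
  -- realizable, and can be made arbitrarily small.
  · obtain ⟨δ, hδ, hgap⟩ := exists_pos_gap E.m d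
    have key : ∀ ε > 0, failed = 0 ∧ L ≤ ε := by
      intro ε hε
      have hb0 : b ≤ 0 := by simpa [← h0] using hA.le
      have hpos : 0 < min ε (δ / capRatio k E.n) := lt_min hε (div_pos hδ hρ)
      have hle : capRatio k E.n * min ε (δ / capRatio k E.n) ≤ δ := by
        calc _ ≤ capRatio k E.n * (δ / capRatio k E.n) :=
              mul_le_mul_of_nonneg_left (min_le_right _ _) hρ.le
          _ = δ := mul_div_cancel₀ _ hρ.ne'
      obtain ⟨h1, h2⟩ := h.complete _ hpos
        ⟨hb0.trans (mul_nonneg hρ.le hpos.le), fun t ht =>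
          (hgap t ht).imp (fun h => h.trans hb) hle.trans, hA.value.mono (by rw [← h0]; exact hpos.le)⟩
      exact ⟨h1, h2.trans (min_le_left _ _)⟩
    refine ⟨(key 1 one_pos).1, ?_⟩
    rw [← h0]
    exact le_of_forall_gt_imp_ge_of_dense fun ε hε => (key ε hε).2

/-- Lets the invariant pass to saved copies, which agree with the originals only on the entries in
use. -/
theorem Greedy.congr (h : Greedy E k d b u failed L pick g) {pick' : ℕ → ℕ} {g' : ℕ → ℝ}
    (hp : ∀ r < u, pick' r = pick r) (hg : ∀ j < E.n, g' j = g j) :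
    Greedy E k d b u failed L pick' g' where
  picks r hr := by rw [hp r hr]; exact h.picks r hr
  served j hj := by
    rw [hg j hj]
    exact (h.served j hj).imp_right fun ⟨h1, h2, t, ht, r, hr, h3⟩ =>
      ⟨h1, h2, t, ht, r, hr, by rw [hp r hr]; exact h3⟩
  sound hf := by
    have e1 : KMedian.missing E.n b g' = KMedian.missing E.n b g :=
      Finset.sum_congr rfl fun j hj => by rw [hg j (Finset.mem_range.1 hj)]
    have e2 : KMedian.spent E.n b g' = KMedian.spent E.n b g :=
      Finset.sum_congr rfl fun j hj => by rw [hg j (Finset.mem_range.1 hj)]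
    rw [e1, e2]; exact h.sound hf
  complete := h.complete

end

/-- Between consecutive sorted values there are no values. -/
theorem SortedCopy.le_or_le {m : ℕ} {a b : ℕ → ℝ} (h : SortedCopy m a b) (q : ℕ) {t : ℕ}
    (ht : t < m) : a t ≤ b q ∨ q + 1 < m ∧ b (q + 1) ≤ a t ∨ m ≤ q := by
  obtain ⟨y, hy, hyt⟩ := h.cover t ht
  rcases le_or_gt m q with hq | hq
  · exact .inr (.inr hq)
  rcases le_or_gt y q with hyq | hyq
  · exact .inl (hyt ▸ h.mono y q hyq hq)
  · exact .inr (.inl ⟨by omega, hyt ▸ h.mono (q + 1) y hyq hy⟩)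

/-- Save the outcome of the greedy run (real array `18`, integer arrays `22` and `23`). -/
def saveRun : Program :=
  forTo 7 nExpr (.setReal 18 (nvar 7) (.read 5 (nvar 7))) ;;
  forTo 7 (nvar 19) (.setNat 22 (nvar 7) (.read 20 (nvar 7))) ;;
  letNat 23 (nvar 19)

theorem ends_saveRun {E : EdgeList} {k T : ℕ} {s₀ : Memory} (h : Loaded E k s₀)
    (h19 : s₀.nat 19 0 = T) (hnm : E.n ≤ E.m) :
    Ends saveRun s₀ (200 * (E.m + 1) * (T + 1)) (fun s => s.nat 23 0 = T ∧
      (∀ r < T, s.nat 22 r = s₀.nat 20 r) ∧ ∀ j < E.n, s.real 18 j = s₀.real 5 j) := by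
  have first : Ends (forTo 7 nExpr (.setReal 18 (nvar 7) (.read 5 (nvar 7)))) s₀
      (50 * (E.m + 1)) (fun s => ∀ j < E.n, s.real 18 j = s₀.real 5 j) := by
    refine (Ends.forTo (N := E.n) (B := 20) (fun u s => ∀ j < u, s.real 18 j = s₀.real 5 j)
      (by simp) ?_ ?_).mono ?_ fun _ => id
    · intro s hs
      simp [(h.of_same hs rfl rfl rfl).n_eq]
    · rintro u hu s hs h7 hA
      have hr : s.real 5 = s₀.real 5 := hs.real 5 rfl
      refine (Ends.of_wp ?_).mono (N := _) (Nat.le_of_ble_eq_true rfl) fun _ => id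
      refine ⟨by simp [h7], fun j hj => ?_⟩
      by_cases hju : j = u
      · subst hju; simp [h7, hr]
      · simpa [h7, hju] using hA j (by omega)
    · rw [mul_comm]
      exact Nat.mul_le_mul (Nat.le_of_ble_eq_true rfl) (by omega)
  refine (first.seq_same fun s₁ h1 hs1 => ?_).mono (N := 50 * (E.m + 1) + (50 * (T + 1) + 10))
    (by nlinarith [Nat.zero_le (E.m * T)]) fun _ => id
  have h20 : s₁.nat 20 = s₀.nat 20 := hs1.nat 20 rfl
  have second : Ends (forTo 7 (nvar 19) (.setNat 22 (nvar 7) (.read 20 (nvar 7)))) s₁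
      (50 * (T + 1)) (fun s => ∀ r < T, s.nat 22 r = s₀.nat 20 r) := by
    refine (Ends.forTo (N := T) (B := 20) (fun u s => ∀ j < u, s.nat 22 j = s₀.nat 20 j)
      (by simp) ?_ ?_).mono ?_ fun _ => id
    · intro s hs
      simp [hs.nat 19 rfl, hs1.nat 19 rfl, h19]
    · rintro u hu s hs h7 hA
      have hr : s.nat 20 = s₀.nat 20 := (hs.nat 20 rfl).trans h20
      refine (Ends.of_wp ?_).mono (N := _) (Nat.le_of_ble_eq_true rfl) fun _ => id
      refine ⟨by simp [h7], fun j hj => ?_⟩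
      by_cases hju : j = u
      · subst hju; simp [h7, hr]
      · simpa [h7, hju] using hA j (by omega)
    · rw [mul_comm]
      exact Nat.mul_le_mul_right _ (Nat.le_of_ble_eq_true rfl)
  refine second.seq_same fun s₂ h2 hs2 => ?_
  refine (Ends.of_wp ?_).mono (N := _) (Nat.le_of_ble_eq_true rfl) fun _ => id
  refine ⟨by simp [hs2.nat 19 rfl, hs1.nat 19 rfl, h19], fun r hr => by simpa using h2 r hr,
    fun j hj => ?_⟩
  simpa [hs2.real 18 rfl] using h1 j hj

/-- The saved run uses a threshold and a budget of at most the LP value. -/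
def SavedOptimal (E : EdgeList) (k : ℕ) (d : ℕ → ℝ) (s : Memory) : Prop :=
  s.nat 23 0 = numSteps k E.n ∧ ∃ b failed L, 0 ≤ b ∧
    Greedy E k d b (numSteps k E.n) failed L (s.nat 22) (s.real 18) ∧
    ∀ A, E.LPValue d k A → b ≤ capRatio k E.n * A ∧ failed = 0 ∧ L ≤ A

/-- Binary search for the threshold, by its rank; integer arrays `13` and `14` hold the bounds,
and the outcome of the run for the upper bound is saved. -/
def searchThreshold : Program :=
  letNat 15 (.sub mExpr (.const 1)) ;; greedyRun ;; saveRun ;;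
  letNat 13 (.const 0) ;; letNat 14 (.sub mExpr (.const 1)) ;;
  .while (.natLe (.add (nvar 13) (.const 1)) (nvar 14))
    (letNat 15 (.half (.add (nvar 13) (nvar 14))) ;; greedyRun ;;
      .ite (.and (.natLe (nvar 16) (.const 0)) (.realLe (.mul (rvar 14) (rvar 8))
          (.read 3 (.add (nvar 15) (.const 1)))))
        (saveRun ;; letNat 14 (nvar 15))
        (letNat 13 (.add (nvar 15) (.const 1))))

/-- The invariant of the binary search between the ranks `lo` and `hi`. -/
structure Searching (E : EdgeList) (k : ℕ) (d b : ℕ → ℝ) (lo hi : ℕ) (s : Memory) : Prop where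
  ready : Ready E k d s
  sorted : s.real 3 = b
  lo_eq : s.nat 13 0 = lo
  hi_eq : s.nat 14 0 = hi
  le : lo ≤ hi
  lt : hi < E.m
  count : s.nat 23 0 = numSteps k E.n
  upper : ∃ failed L, Greedy E k d (b hi) (numSteps k E.n) failed L (s.nat 22) (s.real 18) ∧
    (hi + 1 = E.m ∨ failed = 0 ∧ capRatio k E.n * L ≤ b (hi + 1))
  lower : lo = 0 ∨ ∀ A, E.LPValue d k A → b lo < capRatio k E.n * A

/-- The lower bound gives `b q ≤ ρA`; at rank `0` this holds because some reduced cost vanishes. -/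
theorem Searching.savedOptimal {E : EdgeList} {k : ℕ} {d b : ℕ → ℝ} {q : ℕ} {s : Memory}
    (h : Searching E k d b q q s) (hn : 2 * k < E.n) (hd : ∀ t < E.m, 0 ≤ d t)
    (hb : SortedCopy E.m d b) (hzero : ∃ t < E.m, d t ≤ 0) : SavedOptimal E k d s := by
  have hρ := capRatio_pos hn
  obtain ⟨failed, L, hg, hup⟩ := h.upper
  have hb0 : 0 ≤ b q := by
    obtain ⟨y, hy, hqy⟩ := hb.source q h.lt
    rw [hqy]; exact hd y hy
  refine ⟨h.count, b q, failed, L, hb0, hg, fun A hA => ?_⟩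
  have hle : b q ≤ capRatio k E.n * A := by
    rcases h.lower with h0 | h0
    · obtain ⟨t, ht, htd⟩ := hzero
      obtain ⟨y, hy, hyt⟩ := hb.cover t ht
      have : b q ≤ 0 := (hb.mono q y (by omega) hy).trans (hyt.trans_le htd)
      exact this.trans (mul_nonneg hρ.le (hA.nonneg hd))
    · exact (h0 A hA).le
  refine ⟨hle, ?_⟩
  -- If the next value is below the cap `ρA`, acceptance of the run already bounds its budget by
  -- `A`. Otherwise no cost lies strictly between `b q` and `ρA`, so `A` is realizable at this
  -- threshold.
  by_cases hcase : q + 1 < E.m ∧ b (q + 1) < capRatio k E.n * A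
  · rcases hup with hup | ⟨hf, hL⟩
    · omega
    · exact ⟨hf, (lt_of_mul_lt_mul_left (hL.trans_lt hcase.2) hρ.le).le⟩
  · refine hg.le_of_realizable hn hd hb0 ⟨hle, fun t ht => ?_, hA⟩
    rcases hb.le_or_le q ht with h1 | ⟨h1, h2⟩ | h1
    · exact .inl h1
    · exact .inr ((not_lt.1 fun h => hcase ⟨h1, h⟩).trans h2)
    · exact absurd h.lt h1.not_gt

/-- An unsuccessful run certifies a lower bound on the LP value. -/
theorem Greedy.lt_of_unsuccessful {E : EdgeList} {k : ℕ} {d b : ℕ → ℝ} {q failed : ℕ} {L : ℝ}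
    {pick : ℕ → ℕ} {g : ℕ → ℝ} {u : ℕ}
    (hg : Greedy E k d (b q) u failed L pick g) (hn : 2 * k < E.n)
    (hd : ∀ t < E.m, 0 ≤ d t) (hb : SortedCopy E.m d b) (hq : q + 1 < E.m)
    (hfail : ¬ (failed = 0 ∧ capRatio k E.n * L ≤ b (q + 1))) :
    ∀ A, E.LPValue d k A → b (q + 1) < capRatio k E.n * A := by
  intro A hA
  by_contra hle
  rw [not_lt] at hle
  have hρ := capRatio_pos hn
  have hb0 : 0 ≤ b q := by
    obtain ⟨y, hy, hqy⟩ := hb.source q (by omega)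
    rw [hqy]; exact hd y hy
  have e : capRatio k E.n * (b (q + 1) / capRatio k E.n) = b (q + 1) := mul_div_cancel₀ _ hρ.ne'
  -- The witness `b (q + 1) / ρ` is the budget whose cap is exactly the next value. It is at least
  -- `A`, so it would be realizable and the run would have been accepted.
  obtain ⟨h1, h2⟩ := hg.le_of_realizable hn hd hb0 (A := b (q + 1) / capRatio k E.n)
    ⟨by rw [e]; exact hb.mono _ _ (Nat.le_succ q) hq, fun t ht => by
      rw [e]
      rcases hb.le_or_le q ht with h1 | ⟨h1, h2⟩ | h1
      · exact .inl h1
      · exact .inr h2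
      · omega, hA.mono (by rw [le_div_iff₀ hρ]; linarith)⟩
  exact hfail ⟨h1, by rw [← e]; exact mul_le_mul_of_nonneg_left h2 hρ.le⟩

theorem ends_searchThreshold {E : EdgeList} {k : ℕ} {d : ℕ → ℝ} {s₀ : Memory}
    (hk : 1 ≤ k) (hn : 2 * k < E.n) (hnm : E.n ≤ E.m) (hd : ∀ t < E.m, 0 ≤ d t)
    (h : Ready E k d s₀) (hb : SortedCopy E.m d (s₀.real 3)) (hzero : ∃ t < E.m, d t ≤ 0) :
    Ends searchThreshold s₀
      (4000 * (E.m + 1) * (numSteps k E.n + 1) * (Nat.log 2 E.m + 3)) (fun s =>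
      Ready E k d s ∧ SavedOptimal E k d s) := by
  set b := s₀.real 3 with hbdef
  set T := numSteps k E.n with hT
  have first : Ends (letNat 15 (.sub mExpr (.const 1))) s₀ 10
      (fun s => s.nat 15 0 = E.m - 1) :=
    (Ends.of_wp (P := letNat 15 (.sub mExpr (.const 1))) (by simp [h.m_eq])).mono
      (Nat.le_of_ble_eq_true rfl) fun _ => id
  refine Ends.mono (N := 10 + (2000 * (E.m + 1) * (T + 1) + (200 * (E.m + 1) * (T + 1) +
    (3 + (10 + ((Nat.log 2 E.m + 1) * (2500 * (E.m + 1) * (T + 1) + 7 + 1) + 7 + 1))))))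
    (Q := _) ?_ ?_ fun _ => id
  · refine first.seq_same fun s₁ h15 hs1 => ?_
    have hr1 := h.of_same hs1 rfl rfl rfl rfl rfl rfl rfl rfl
    refine (ends_greedyRun hk hn hnm hd hr1).seq_same fun s₂ hg2 hs2 => ?_
    rw [h15, hs1.real 3 rfl, ← hbdef] at hg2
    refine (ends_saveRun hg2.ready.toLoaded hg2.count hnm).seq_same fun s₃ ⟨h23, h22, h18⟩ hs3 => ?_
    have hr3 := hg2.ready.of_same hs3 rfl rfl rfl rfl rfl rfl rfl rfl
    refine Ends.seq_same (R := fun s => s.nat 13 0 = 0)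
      (Ends.of_wp (P := letNat 13 (.const 0)) (by simp)) fun s₄ h13 hs4 => ?_
    have hr4 := hr3.of_same hs4 rfl rfl rfl rfl rfl rfl rfl rfl
    have next : Ends (letNat 14 (.sub mExpr (.const 1))) s₄ 10
        (fun s => s.nat 14 0 = E.m - 1) :=
      (Ends.of_wp (P := letNat 14 (.sub mExpr (.const 1))) (by simp [hr4.m_eq])).mono
        (Nat.le_of_ble_eq_true rfl) fun _ => id
    refine next.seq_same fun s₅ h14 hs5 => ?_
    have hr5 := hr4.of_same hs5 rfl rfl rfl rfl rfl rfl rfl rfl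
    have hstart : Searching E k d b 0 (E.m - 1) s₅ := by
      refine ⟨hr5, ?_, ?_, h14, by omega, by omega, ?_, ⟨s₂.nat 16 0, s₂.real 8 0, ?_, ?_⟩,
        .inl rfl⟩
      · rw [hs5.real 3 rfl, hs4.real 3 rfl, hs3.real 3 rfl, hs2.real 3 rfl, hs1.real 3 rfl]
      · rw [hs5.nat 13 rfl, h13]
      · rw [hs5.nat 23 rfl, hs4.nat 23 rfl, h23]
      · rw [hs5.nat 22 rfl, hs4.nat 22 rfl, hs5.real 18 rfl, hs4.real 18 rfl]
        exact hg2.greedy.congr h22 h18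
      -- The run at the largest cost has no next value to be compared with and is saved
      -- unconditionally.
      · left; omega
    refine (Ends.while (B := 2500 * (E.m + 1) * (T + 1)) (fun v s => ∃ lo hi,
      hi - lo < 2 ^ v ∧ Searching E k d b lo hi s) ?_ (Nat.log 2 E.m + 1) s₅
      ⟨0, E.m - 1, ?_, hstart⟩).mono ?_ ?_
    · rintro v s ⟨lo, hi, hv, hS⟩ hcond
      simp only [Test.Holds, NatExpr.eval, hS.lo_eq, hS.hi_eq] at hcond
      have hv0 : v ≠ 0 := by rintro rfl; simp at hv; omega
      obtain ⟨v, rfl⟩ := Nat.exists_eq_succ_of_ne_zero hv0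
      rw [Nat.succ_eq_add_one, pow_succ] at hv
      set q := (lo + hi) / 2 with hq
      have mid : Ends (letNat 15 (.half (.add (nvar 13) (nvar 14)))) s 10
          (fun s => s.nat 15 0 = q) :=
        (Ends.of_wp (P := letNat 15 (.half (.add (nvar 13) (nvar 14))))
          (by simp [hS.lo_eq, hS.hi_eq, hq])).mono (Nat.le_of_ble_eq_true rfl) fun _ => id
      refine Ends.mono (N := 10 + (2000 * (E.m + 1) * (T + 1) + (20 +
        (200 * (E.m + 1) * (T + 1) + 10)))) (Q := _) ?_ ?_ fun _ => id
      · refine mid.seq_same fun s₁ h15 hs1 => ?_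
        have hr1 := hS.ready.of_same hs1 rfl rfl rfl rfl rfl rfl rfl rfl
        refine (ends_greedyRun hk hn hnm hd hr1).seq_same fun s₂ hg2 hs2 => ?_
        rw [h15, hs1.real 3 rfl, hS.sorted] at hg2
        have hqm : q + 1 < E.m := by have := hS.lt; omega
        have h3 : s₂.real 3 = b := by rw [hs2.real 3 rfl, hs1.real 3 rfl, hS.sorted]
        have h15' : s₂.nat 15 0 = q := by rw [hs2.nat 15 rfl, h15]
        refine (Ends.ite (N := 200 * (E.m + 1) * (T + 1) + 10) (fun hb1 => ?_)
          fun hb1 => ?_).mono (Nat.add_le_add_right (Nat.le_of_ble_eq_true rfl) _) fun _ => id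
        · simp only [Test.Holds, NatExpr.eval, RealExpr.eval, h15', hg2.ready.cap, h3] at hb1
          refine (ends_saveRun hg2.ready.toLoaded hg2.count hnm).seq_same
            fun s₃ ⟨h23, h22, h18⟩ hs3 => ?_
          have hr3 := hg2.ready.of_same hs3 rfl rfl rfl rfl rfl rfl rfl rfl
          have last : Ends (letNat 14 (nvar 15)) s₃ 10 (fun s => s.nat 14 0 = q) :=
            (Ends.of_wp (P := letNat 14 (nvar 15)) (by simp [hs3.nat 15 rfl, h15'])).mono
              (Nat.le_of_ble_eq_true rfl) fun _ => id
          refine last.same.mono le_rfl fun s₄ ⟨h14, hs4⟩ => ⟨v, Nat.lt_succ_self v, lo, q, ?_,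
            hr3.of_same hs4 rfl rfl rfl rfl rfl rfl rfl rfl, ?_, ?_, h14, ?_, ?_, ?_,
            ⟨s₂.nat 16 0, s₂.real 8 0, ?_, .inr ⟨by omega, hb1.2⟩⟩, hS.lower⟩
          · omega
          · rw [hs4.real 3 rfl, hs3.real 3 rfl, h3]
          · rw [hs4.nat 13 rfl, hs3.nat 13 rfl, hs2.nat 13 rfl, hs1.nat 13 rfl, hS.lo_eq]
          · omega
          · omega
          · rw [hs4.nat 23 rfl, h23]
          · rw [hs4.nat 22 rfl, hs4.real 18 rfl]
            exact hg2.greedy.congr h22 h18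
        · simp only [Test.Holds, NatExpr.eval, RealExpr.eval, h15', hg2.ready.cap, h3,
            Nat.le_zero] at hb1
          have last : Ends (letNat 13 (.add (nvar 15) (.const 1))) s₂ 10
              (fun s => s.nat 13 0 = q + 1) :=
            (Ends.of_wp (P := letNat 13 (.add (nvar 15) (.const 1))) (by simp [h15'])).mono
              (Nat.le_of_ble_eq_true rfl) fun _ => id
          refine last.same.mono (by omega) fun s₃ ⟨h13, hs3⟩ => ⟨v, Nat.lt_succ_self v, q + 1, hi,
            ?_, hg2.ready.of_same hs3 rfl rfl rfl rfl rfl rfl rfl rfl, ?_, h13, ?_, ?_, hS.lt, ?_,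
            ?_, .inr (hg2.greedy.lt_of_unsuccessful hn hd hb hqm hb1)⟩
          · omega
          · rw [hs3.real 3 rfl, h3]
          · rw [hs3.nat 14 rfl, hs2.nat 14 rfl, hs1.nat 14 rfl, hS.hi_eq]
          · omega
          · rw [hs3.nat 23 rfl, hs2.nat 23 rfl, hs1.nat 23 rfl, hS.count]
          · rw [hs3.nat 22 rfl, hs2.nat 22 rfl, hs1.nat 22 rfl, hs3.real 18 rfl, hs2.real 18 rfl,
              hs1.real 18 rfl]
            exact hS.upper
      · have hM1 : 1 ≤ (E.m + 1) * (T + 1) := Nat.one_le_iff_ne_zero.2 (by positivity)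
        simp only [mul_assoc _ (E.m + 1) (T + 1)]
        omega
    · have := Nat.lt_pow_succ_log_self one_lt_two E.m
      omega
    · simp only [Test.cost, NatExpr.cost]; exact le_rfl
    · rintro s ⟨⟨v, lo, hi, -, hS⟩, hcond⟩
      simp only [Test.Holds, NatExpr.eval, hS.lo_eq, hS.hi_eq] at hcond
      have : lo = hi := le_antisymm hS.le (by omega)
      subst this
      exact ⟨hS.ready, hS.savedOptimal hn hd hb hzero⟩
  · set M := (E.m + 1) * (T + 1) with hM
    have hM1 : 1 ≤ M := Nat.one_le_iff_ne_zero.2 (by positivity)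
    simp only [mul_assoc _ (E.m + 1) (T + 1), ← hM]
    have h1 : Nat.log 2 E.m ≤ M * Nat.log 2 E.m := Nat.le_mul_of_pos_left _ hM1
    ring_nf
    omega

/-! ### Completing the solution -/

/-- Append integer cell `26` to the output, unless it is already listed; integer array `21` marks
the members of the list. -/
def addCenter : Program :=
  .ite (.natLe (.const 1) (.read 21 (nvar 26))) .skip
    (.setNat 21 (nvar 26) (.const 1) ;; .setNat 4 (nvar 3) (nvar 26) ;; incr 3)

/-- The output cells list the set `C`. -/
structure Listing (s : Memory) (C : Finset ℕ) : Prop where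
  count : s.nat 3 0 = C.card
  image : (Finset.range C.card).image (s.nat 4) = C
  mark : ∀ i, s.nat 21 i = 0 ↔ i ∉ C

theorem Listing.congr {s s' : Memory} {C : Finset ℕ} (h : Listing s C)
    (h3 : s'.nat 3 = s.nat 3) (h4 : s'.nat 4 = s.nat 4) (h21 : s'.nat 21 = s.nat 21) :
    Listing s' C :=
  ⟨by rw [h3, h.count], by rw [h4, h.image], by rw [h21]; exact h.mark⟩

theorem Listing.of_same {s s' : Memory} {C : Finset ℕ} {P : Program} (h : Listing s C)
    (hs : Same P s s') (h3 : P.writesNat 3 = false) (h4 : P.writesNat 4 = false)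
    (h21 : P.writesNat 21 = false) : Listing s' C :=
  h.congr (hs.nat 3 h3) (hs.nat 4 h4) (hs.nat 21 h21)

theorem ends_addCenter {s : Memory} {C : Finset ℕ} (h : Listing s C) :
    Ends addCenter s 50 (fun s' => Listing s' (insert (s.nat 26 0) C)) := by
  refine (Ends.of_wp ?_).mono (Nat.le_of_ble_eq_true rfl) fun _ => id
  simp only [addCenter, wp, Test.Holds, NatExpr.eval]
  refine ⟨fun h1 => ?_, fun h1 => ?_⟩
  · have hmem : s.nat 26 0 ∈ C := by
      by_contra hc
      have := (h.mark _).2 hc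
      omega
    rw [Finset.insert_eq_of_mem hmem]
    exact h
  · have hnot : s.nat 26 0 ∉ C := (h.mark _).1 (by omega)
    refine ⟨?_, ?_, fun i => ?_⟩
    · simp [h.count, Finset.card_insert_of_notMem hnot]
    · rw [Finset.card_insert_of_notMem hnot, Finset.range_add_one, Finset.image_insert]
      simp only [Memory.writeNat]
      congr 1
      · simp [h.count]
      · conv_rhs => rw [← h.image]
        refine Finset.image_congr fun x hx => ?_
        have : x ≠ C.card := (Finset.mem_range.1 (Finset.mem_coe.1 hx)).ne
        simp [h.count, this]
    · by_cases hi : i = s.nat 26 0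
      · subst hi; simp
      · simpa [hi] using h.mark i

/-- List the centers of the saved run. -/
def listPicks : Program :=
  forTo 7 (nvar 23) (letNat 26 (.read 22 (nvar 7)) ;; addCenter)

theorem ends_listPicks {s₀ : Memory} {T p : ℕ} (h : Listing s₀ ∅) (h23 : s₀.nat 23 0 = T)
    (hp : ∀ r < T, s₀.nat 22 r < p) :
    Ends listPicks s₀ (100 * (T + 1)) (fun s => ∃ C, Listing s C ∧ C.card ≤ T ∧
      (∀ i ∈ C, i < p) ∧ ∀ r < T, s₀.nat 22 r ∈ C) := by
  refine (Ends.forTo (N := T) (B := 80) (fun u s => ∃ C, Listing s C ∧ C.card ≤ u ∧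
      (∀ i ∈ C, i < p) ∧ ∀ r < u, s₀.nat 22 r ∈ C)
      ⟨∅, h.congr (by simp) (by simp) (by simp), by simp, by simp, by simp⟩ ?_ ?_).mono ?_
      fun _ => id
  · intro s hs
    simp [hs.nat 23 rfl, h23]
  · rintro u hu s hs h7 ⟨C, hC, hcard, hlt, hmem⟩
    have h22 : s.nat 22 = s₀.nat 22 := hs.nat 22 rfl
    have first : Ends (letNat 26 (.read 22 (nvar 7))) s 10 (fun s => s.nat 26 0 = s₀.nat 22 u) :=
      (Ends.of_wp (P := letNat 26 (.read 22 (nvar 7))) (by simp [h7, h22])).mono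
        (Nat.le_of_ble_eq_true rfl) fun _ => id
    have both : Ends (letNat 26 (.read 22 (nvar 7)) ;; addCenter) s (10 + 50)
        (fun s' => Listing s' (insert (s₀.nat 22 u) C)) :=
      first.seq_same fun s₁ h26 hs1 => (ends_addCenter (hC.of_same hs1 rfl rfl rfl)).mono le_rfl
        fun s' h => by rwa [h26] at h
    refine (both.then_incr (v := 7) rfl h7 (I := fun s => ∃ C, Listing s C ∧ C.card ≤ u + 1 ∧
      (∀ i ∈ C, i < p) ∧ ∀ r < u + 1, s₀.nat 22 r ∈ C) fun s₂ h2 hs2 =>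
        ⟨_, h2.congr (by simp) (by simp) (by simp), ?_, ?_, ?_⟩).mono (by omega) fun _ => id
    · exact (Finset.card_insert_le _ _).trans (by omega)
    · intro i hi
      rcases Finset.mem_insert.1 hi with rfl | hi
      exacts [hp u hu, hlt i hi]
    · intro r hr
      rcases Nat.lt_succ_iff_lt_or_eq.1 hr with hr | rfl
      exacts [Finset.mem_insert_of_mem (hmem r hr), Finset.mem_insert_self _ _]
  · rw [mul_comm]
    exact Nat.mul_le_mul_right _ (Nat.le_of_ble_eq_true rfl)

/-- Find the customer (integer array `25`) with the largest saved distance. -/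
def findFarthest : Program :=
  letNat 25 (.const 0) ;;
  forTo 7 nExpr
    (.ite (.realLe (.read 18 (nvar 7)) (.read 18 (nvar 25))) .skip (letNat 25 (nvar 7)))

theorem ends_findFarthest {E : EdgeList} {k : ℕ} {s₀ : Memory} (h : Loaded E k s₀)
    (hn : 0 < E.n) : Ends findFarthest s₀ (100 * (E.n + 1)) (fun s => s.nat 25 0 < E.n ∧
      ∀ j < E.n, s₀.real 18 j ≤ s₀.real 18 (s.nat 25 0)) := by
  have first : Ends (letNat 25 (.const 0)) s₀ 10 (fun s => s.nat 25 0 = 0) :=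
    (Ends.of_wp (P := letNat 25 (.const 0)) (by simp)).mono (Nat.le_of_ble_eq_true rfl)
      fun _ => id
  refine (first.seq_same (N' := 60 * (E.n + 1)) fun s₁ h25 hs1 => ?_).mono (by omega) fun _ => id
  have hl1 := h.of_same hs1 rfl rfl rfl
  have hr1 : s₁.real 18 = s₀.real 18 := hs1.real 18 rfl
  refine (Ends.forTo (N := E.n) (B := 40) (fun u s => s.nat 25 0 < E.n ∧
      ∀ j < u, s₀.real 18 j ≤ s₀.real 18 (s.nat 25 0)) (by simp [h25, hn]) ?_ ?_).mono ?_
      fun _ => id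
  · intro s hs
    simp [(hl1.of_same hs rfl rfl rfl).n_eq]
  · rintro u hu s hs h7 ⟨hA, hB⟩
    have hr : s.real 18 = s₀.real 18 := (hs.real 18 rfl).trans hr1
    refine (Ends.of_wp ?_).mono (N := _) (Nat.le_of_ble_eq_true rfl) fun _ => id
    simp only [wp, Test.Holds, NatExpr.eval, RealExpr.eval, h7, hr]
    refine ⟨fun h1 => ⟨by simp, by simpa using hA, fun j hj => ?_⟩,
      fun h1 => ⟨by simp [h7], by simpa using hu, fun j hj => ?_⟩⟩
    · rcases Nat.lt_succ_iff_lt_or_eq.1 hj with hj | rfl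
      · simpa using hB j hj
      · simpa using h1
    · rcases Nat.lt_succ_iff_lt_or_eq.1 hj with hj | rfl
      · simpa using (hB j hj).trans (not_le.1 h1).le
      · simp
  · rw [mul_comm]
    exact Nat.mul_le_mul_right _ (Nat.le_of_ble_eq_true rfl)

/-- Serve the farthest customers by their nearest centers; integer array `24` counts them. -/
def serveFarthest : Program :=
  forTo 24 (.add kExpr kExpr)
    (findFarthest ;; letNat 26 (.read 6 (nvar 25)) ;; addCenter ;;
      .setReal 18 (nvar 25) (.ofNat (.const 0)))

/-- Every customer within distance `b` that has an edge is served by `C` within its distance. -/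
def ServedBy (E : EdgeList) (d : ℕ → ℝ) (b : ℝ) (g : ℕ → ℝ) (C : Finset ℕ) : Prop :=
  ∀ j < E.n, (∃ t < E.m, E.customer t = j) → b < g j ∨
    ∃ t < E.m, E.customer t = j ∧ E.center t ∈ C ∧ d t ≤ g j

theorem ServedBy.mono {E : EdgeList} {d : ℕ → ℝ} {b : ℝ} {g : ℕ → ℝ} {C C' : Finset ℕ}
    (h : ServedBy E d b g C) (hC : C ⊆ C') : ServedBy E d b g C' :=
  fun j hj he => (h j hj he).imp_right fun ⟨t, ht, h1, h2, h3⟩ => ⟨t, ht, h1, hC h2, h3⟩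

/-- A removed customer gets distance `0`, justified by its free edge to the center just added. `θ`
and `H` are quantified in the conclusion because the program does not know the LP value. -/
theorem ends_serveFarthest {E : EdgeList} {k T K : ℕ} {d : ℕ → ℝ} {b : ℝ} {s₀ : Memory}
    {C₀ : Finset ℕ} (h : Loaded E k s₀) (hn : 2 * k < E.n) (hC₀ : Listing s₀ C₀)
    (hcard₀ : C₀.card ≤ T) (hlt₀ : ∀ i ∈ C₀, i < E.p) (hserved₀ : ServedBy E d b (s₀.real 18) C₀)
    (hnear : ∀ j, s₀.nat 6 j < E.p)
    (hnear' : ∀ j, (∃ t < E.m, E.customer t = j) →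
      ∃ t < E.m, E.customer t = j ∧ E.center t = s₀.nat 6 j ∧ d t ≤ 0) (hb : 0 ≤ b) :
    Ends serveFarthest s₀ (300 * (E.n + 1) * (2 * k + 1)) (fun s => ∃ C, Listing s C ∧
      C.card ≤ T + 2 * k ∧ (∀ i ∈ C, i < E.p) ∧ ServedBy E d b (s.real 18) C ∧
      ∀ θ H, b ≤ θ → Trimmed E.n K b θ H 0 (s₀.real 18) →
        Trimmed E.n K b θ H (2 * k) (s.real 18)) := by
  refine (Ends.forTo (N := 2 * k) (B := 100 * (E.n + 1) + 100) (fun u s => ∃ C, Listing s C ∧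
      C.card ≤ T + u ∧ (∀ i ∈ C, i < E.p) ∧ ServedBy E d b (s.real 18) C ∧
      ∀ θ H, b ≤ θ → Trimmed E.n K b θ H 0 (s₀.real 18) → Trimmed E.n K b θ H u (s.real 18))
      ⟨C₀, hC₀.congr (by simp) (by simp) (by simp), hcard₀, hlt₀, hserved₀,
        fun _ _ _ h => h⟩ ?_ ?_).mono ?_ fun _ => id
  · intro s hs
    simp [(h.of_same hs rfl rfl rfl).k_eq, two_mul]
  · rintro u hu s hs h24 ⟨C, hC, hcard, hlt, hserved, htrim⟩
    have hl := h.of_same hs rfl rfl rfl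
    have h6 : s.nat 6 = s₀.nat 6 := hs.nat 6 rfl
    have body : Ends (findFarthest ;; letNat 26 (.read 6 (nvar 25)) ;; addCenter ;;
        .setReal 18 (nvar 25) (.ofNat (.const 0))) s (100 * (E.n + 1) + (10 + (50 + 10)))
        (fun s' => ∃ j < E.n, (∀ j' < E.n, s.real 18 j' ≤ s.real 18 j) ∧
          Listing s' (insert (s₀.nat 6 j) C) ∧
          s'.real 18 = Function.update (s.real 18) j 0) := by
      refine (ends_findFarthest hl (by omega)).seq_same fun s₁ ⟨hj, hmax⟩ hs1 => ?_
      have first : Ends (letNat 26 (.read 6 (nvar 25))) s₁ 10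
          (fun s' => s'.nat 26 0 = s₀.nat 6 (s₁.nat 25 0)) :=
        (Ends.of_wp (P := letNat 26 (.read 6 (nvar 25)))
          (by simp [hs1.nat 6 rfl, h6])).mono (Nat.le_of_ble_eq_true rfl) fun _ => id
      refine first.seq_same fun s₂ h26 hs2 => ?_
      refine (ends_addCenter ((hC.of_same hs1 rfl rfl rfl).of_same hs2 rfl rfl rfl)).seq_same
        fun s₃ h3 hs3 => (Ends.of_wp ?_).mono (Nat.le_of_ble_eq_true rfl) fun _ => id
      rw [h26] at h3
      have h25 : s₃.nat 25 = s₁.nat 25 := (hs3.nat 25 rfl).trans (hs2.nat 25 rfl)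
      have h18 : s₃.real 18 = s.real 18 :=
        (hs3.real 18 rfl).trans ((hs2.real 18 rfl).trans (hs1.real 18 rfl))
      exact ⟨s₁.nat 25 0, hj, hmax, h3.congr (by simp) (by simp) (by simp),
        by simp [h25, h18]⟩
    refine (body.then_incr (v := 24) rfl h24 (I := fun s => ∃ C, Listing s C ∧
      C.card ≤ T + (u + 1) ∧ (∀ i ∈ C, i < E.p) ∧ ServedBy E d b (s.real 18) C ∧
      ∀ θ H, b ≤ θ → Trimmed E.n K b θ H 0 (s₀.real 18) →
        Trimmed E.n K b θ H (u + 1) (s.real 18)) fun s₂ ⟨j, hj, hmax, hC', h18⟩ hs2 =>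
        ⟨_, hC'.congr (by simp) (by simp) (by simp), ?_, ?_, ?_, ?_⟩).mono (by omega) fun _ => id
    · exact (Finset.card_insert_le _ _).trans (by omega)
    · intro i hi
      rcases Finset.mem_insert.1 hi with rfl | hi
      exacts [hnear j, hlt i hi]
    · intro j' hj' he
      simp only [Memory.writeNat, h18]
      by_cases hjj : j' = j
      · subst hjj
        obtain ⟨t, ht, h1, h2, h3⟩ := hnear' j' he
        exact .inr ⟨t, ht, h1, by rw [h2]; exact Finset.mem_insert_self _ _, by simpa using h3⟩
      · rw [Function.update_of_ne hjj]
        exact hserved.mono (Finset.subset_insert _ _) j' hj' he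
    · intro θ H hθ h0
      simp only [Memory.writeNat, h18]
      exact (htrim θ H hθ h0).step hb hθ (by omega) hj hmax
  · have : (NatExpr.add kExpr kExpr).cost = 5 := rfl
    rw [this, mul_comm]
    refine Nat.mul_le_mul_right _ ?_
    omega

/-- List the saved centers and complete the solution. -/
def finish : Program := listPicks ;; serveFarthest

/-- Discarding the `2k` most expensive customers of a successful greedy run brings the cost within
the LP value. -/
theorem Greedy.trimmed {E : EdgeList} {k : ℕ} {d : ℕ → ℝ} {b : ℝ} {L A : ℝ} {pick : ℕ → ℕ}
    {g : ℕ → ℝ} (hk : 1 ≤ k) (hn : 2 * k < E.n)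
    (h : Greedy E k d b (numSteps k E.n) 0 L pick g) (hb : 0 ≤ b) :
    Trimmed E.n (2 * k) b (capRatio k E.n * A)
      (capRatio k E.n * A * missing E.n b g + spent E.n b g) 0 g where
  nonneg j hj := by
    rcases h.served j hj with h1 | ⟨-, h1, -⟩
    exacts [hb.trans h1.le, h1]
  missing := by
    obtain ⟨-, h2, -⟩ := h.sound rfl
    have h3 := h2.trans_lt (potential_numSteps hk hn)
    -- Now `ρ * missing < ρ * (2k + 1)`, and the number of unassigned customers is an integer.
    rw [stopRatio_eq hn] at h3
    have h4 := lt_of_mul_lt_mul_left h3 (capRatio_pos hn).le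
    have h5 : KMedian.missing E.n b g =
        (((Finset.range E.n).filter (fun j => b < g j)).card : ℝ) := by
      rw [KMedian.missing, Finset.card_filter, Nat.cast_sum]
      refine Finset.sum_congr rfl fun j _ => ?_
      rcases le_or_gt (g j) b with h | h
      · rw [miss_of_le h, if_neg h.not_gt]; simp
      · rw [miss_of_lt h, if_pos h]; simp
    rw [h5] at h4
    have h6 : ((Finset.range E.n).filter (fun j => b < g j)).card < 2 * k + 1 := by
      exact_mod_cast h4
    omega
  support := (Finset.card_filter_le _ _).trans (by simp)
  cost := by rw [sum_capped]; simp

/-- After `2k` removals nobody is unassigned, so the capped cost is the sum of the distances. The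
set `C` is chosen before `A`, hence is good for every achievable LP value. -/
theorem ends_finish {E : EdgeList} {k : ℕ} {d : ℕ → ℝ} {s₀ : Memory} (h : Ready E k d s₀)
    (hk : 1 ≤ k) (hn : 2 * k < E.n) (hC₀ : Listing s₀ ∅)
    (hsaved : SavedOptimal E k d s₀)
    (hnear : ∀ j, s₀.nat 6 j < E.p)
    (hnear' : ∀ j, (∃ t < E.m, E.customer t = j) →
      ∃ t < E.m, E.customer t = j ∧ E.center t = s₀.nat 6 j ∧ d t ≤ 0) :
    Ends finish s₀ (400 * (E.n + 1) * (numSteps k E.n + 2 * k + 1)) (fun s => ∃ C,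
      Listing s C ∧ C.card ≤ numSteps k E.n + 2 * k ∧ (∀ i ∈ C, i < E.p) ∧
      ∀ A, E.LPValue d k A → ∃ g : ℕ → ℝ, ∑ j ∈ Finset.range E.n, g j ≤ A ∧
        ∀ j < E.n, ∃ t < E.m, E.customer t = j ∧ E.center t ∈ C ∧ d t ≤ g j) := by
  obtain ⟨h23, b, failed, L, hb, hg, hopt⟩ := hsaved
  set T := numSteps k E.n with hT
  have hp : ∀ r < T, s₀.nat 22 r < E.p := fun r hr => by
    obtain ⟨t, ht, h1⟩ := hg.picks r hr
    rw [← h1]; exact E.center_lt t ht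
  refine ((ends_listPicks hC₀ h23 hp).seq_same (N' := 300 * (E.n + 1) * (2 * k + 1))
    fun s₁ ⟨C, hC, hcard, hlt, hmem⟩ hs1 => ?_).mono ?_ fun _ => id
  · have h18 : s₁.real 18 = s₀.real 18 := hs1.real 18 rfl
    have h6 : s₁.nat 6 = s₀.nat 6 := hs1.nat 6 rfl
    have hserved : ServedBy E d b (s₁.real 18) C := by
      intro j hj _
      rw [h18]
      exact (hg.served j hj).imp_right fun ⟨_, _, t, ht, r, hr, h3, h4, h5⟩ =>
        ⟨t, ht, h3, by rw [h4]; exact hmem r hr, h5.le⟩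
    refine (ends_serveFarthest (K := 2 * k) (h.toLoaded.of_same hs1 rfl rfl rfl) hn hC hcard hlt
      hserved (by rwa [h6]) (by rwa [h6]) hb).mono le_rfl ?_
    rintro s ⟨C', hC', hcard', hlt', hserved', htrim⟩
    refine ⟨C', hC', hcard', hlt', fun A hA => ⟨s.real 18, ?_⟩⟩
    obtain ⟨hθ, rfl, hL⟩ := hopt A hA
    have ht := htrim _ _ hθ (by rw [h18]; exact hg.trimmed hk hn hb)
    have hle : ∀ j < E.n, s.real 18 j ≤ b := by
      intro j hj
      by_contra hlt
      have h1 := ht.missing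
      rw [Nat.sub_self, Nat.le_zero, Finset.card_eq_zero, Finset.filter_eq_empty_iff] at h1
      exact h1 (Finset.mem_range.2 hj) (not_le.1 hlt)
    constructor
    · have h1 := ht.cost
      rw [Finset.sum_congr rfl fun j hj => capped_of_le (hle j (Finset.mem_range.1 hj))] at h1
      obtain ⟨h2, h3, h4⟩ := hg.sound rfl
      have h5 := potential_numSteps hk hn
      have hA0 : 0 ≤ A := h2.trans hL
      have h6 : capRatio k E.n * A * missing E.n b (s₀.real 18) + spent E.n b (s₀.real 18) ≤
          A * stopRatio k E.n := by
        have e1 := mul_le_mul_of_nonneg_right hL (sub_nonneg.2 h3)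
        have e2 := mul_le_mul_of_nonneg_left h5.le hA0
        linarith
      have hnk := two_mul_lt_cast hn
      push_cast at h1
      have hn0 : (0 : ℝ) < E.n := by
        have := k.cast_nonneg (α := ℝ)
        linarith
      -- `stopRatio` is chosen to cancel the factor `(n - 2k) / n` gained by discarding.
      have h7 : (E.n - 2 * k : ℝ) * (A * stopRatio k E.n) = E.n * A := by
        have : (E.n : ℝ) - 2 * k ≠ 0 := by linarith
        rw [stopRatio]; field_simp
      have h8 := mul_le_mul_of_nonneg_left h6 (sub_nonneg.2 hnk.le)
      rw [h7] at h8
      exact le_of_mul_le_mul_left (h1.trans h8) hn0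
    · intro j hj
      exact (hserved' j hj (hA.exists_edge hj)).resolve_left (hle j hj).not_gt
  · have h1 : 100 * (T + 1) ≤ 100 * (E.n + 1) * (T + 1) :=
      Nat.mul_le_mul_right _ (by omega)
    have h2 : 400 * (E.n + 1) * (T + 2 * k + 1) =
      400 * ((E.n + 1) * (T + 1)) + 400 * ((E.n + 1) * (2 * k)) := by ring
    have h3 : 300 * (E.n + 1) * (2 * k + 1) =
      300 * ((E.n + 1) * (2 * k)) + 300 * (E.n + 1) := by ring
    have h4 : E.n + 1 ≤ (E.n + 1) * (T + 1) := Nat.le_mul_of_pos_right _ (by omega)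
    rw [mul_assoc] at h1
    omega

end KMedian

/-! ### The complete algorithm, its running time, and the passage to instances -/

namespace KMedian

open RealRAM

/-! ### The algorithm -/

/-- The whole algorithm.  With fewer edges than customers no solution has finite cost. -/
def medianProgram : Program :=
  .ite (.natLe nExpr mExpr)
    (findNearest ;; reduceCosts ;; mergeSort ;; setParameters ;; searchThreshold ;; finish)
    .skip

/-- With fewer edges than customers some customer has no edge and the LP is infeasible. The program
may then stop with the empty set, and otherwise `n` is absorbed in `m`. -/
theorem EdgeList.LPValue.card_le {E : EdgeList} {k : ℕ} {d : ℕ → ℝ} {A : ℝ}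
    (h : E.LPValue d k A) : E.n ≤ E.m := by
  have := Finset.card_le_card_of_surjOn (s := Finset.range E.m) (t := Finset.range E.n)
    E.customer fun j hj => by
      obtain ⟨t, ht, htj⟩ := h.exists_edge (Finset.mem_range.1 (Finset.mem_coe.1 hj))
      exact ⟨t, Finset.mem_coe.2 (Finset.mem_range.2 ht), htj⟩
  simpa using this

/-- Shifting the costs of the edges of each customer shifts the LP value. -/
theorem EdgeList.LPValue.shift {E : EdgeList} {k : ℕ} {w d v : ℕ → ℝ} {B : ℝ}
    (h : E.LPValue w k B) (hd : ∀ t < E.m, d t = w t - v (E.customer t)) :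
    E.LPValue d k (B - ∑ j ∈ Finset.range E.n, v j) := by
  obtain ⟨x, y, h1, h2, h3, h4, h5⟩ := h
  refine ⟨x, y, h1, h2, h3, h4, ?_⟩
  have e : ∑ j ∈ Finset.range E.n, v j =
      ∑ t ∈ Finset.range E.m, v (E.customer t) * y t := by
    have : ∀ j ∈ Finset.range E.n, v j = ∑ t ∈ Finset.range E.m,
        (if E.customer t = j then v (E.customer t) * y t else 0) := by
      intro j hj
      conv_lhs => rw [← mul_one (v j), ← h4 j (Finset.mem_range.1 hj), Finset.mul_sum]
      refine Finset.sum_congr rfl fun t _ => ?_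
      split_ifs with h
      · rw [h]
      · simp
    rw [Finset.sum_congr rfl this, Finset.sum_comm]
    refine Finset.sum_congr rfl fun t ht => ?_
    rw [Finset.sum_ite_eq, if_pos (Finset.mem_range.2 (E.customer_lt t (Finset.mem_range.1 ht)))]
  rw [e, Finset.sum_congr rfl fun t ht => by rw [hd t (Finset.mem_range.1 ht), sub_mul],
    Finset.sum_sub_distrib]
  linarith

/-- A bound on the number of steps of the algorithm. -/
noncomputable def timeBound (k n m : ℕ) : ℕ :=
  10000 * ((m + 1) * (numSteps k n + 2 * k + 1) * (Nat.log 2 m + 3))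

/-- The list `C` is a set of centers whose cost does not exceed the LP value. -/
structure Solution (E : EdgeList) (k : ℕ) (w : ℕ → ℝ) (C : Finset ℕ) : Prop where
  card_le : C.card ≤ numSteps k E.n + 2 * k
  lt : ∀ i ∈ C, i < E.p
  cost : ∀ B, E.LPValue w k B → ∃ f : ℕ → ℝ, ∑ j ∈ Finset.range E.n, f j ≤ B ∧
    ∀ j < E.n, ∃ t < E.m, E.customer t = j ∧ E.center t ∈ C ∧ w t ≤ f j

theorem ends_medianProgram {E : EdgeList} {k : ℕ} {s₀ : Memory} (h : Loaded E k s₀)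
    (hk : 1 ≤ k) (hn : 2 * k < E.n) (h3 : ∀ j, s₀.nat 3 j = 0)
    (h5 : ∀ j, s₀.nat 5 j = 0) (h6 : ∀ j, s₀.nat 6 j = 0) (h21 : ∀ j, s₀.nat 21 j = 0) :
    Ends medianProgram s₀ (7 + if E.n ≤ E.m then timeBound k E.n E.m else 1) (fun s => ∃ C,
      Listing s C ∧ Solution E k (s₀.real 0) C) := by
  have hlist : Listing s₀ ∅ := ⟨by simp [h3], by simp, fun i => by simp [h21]⟩
  refine (Ends.ite (N := if E.n ≤ E.m then timeBound k E.n E.m else 1) (fun hnm => ?_)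
    fun hnm => ?_).mono (Nat.add_le_add_right (Nat.le_of_ble_eq_true rfl) _) fun _ => id
  · simp only [Test.Holds, NatExpr.eval, h.n_eq, h.m_eq] at hnm
    rw [if_pos hnm]
    have hm : 0 < E.m := by omega
    set T := numSteps k E.n with hT
    refine Ends.mono (N := 100 * (E.m + 1) + (100 * (E.m + 1) +
      (1000 * (E.m + 1) * (Nat.log 2 E.m + 2) + (200 +
        (4000 * (E.m + 1) * (T + 1) * (Nat.log 2 E.m + 3) +
          400 * (E.n + 1) * (T + 2 * k + 1)))))) (Q := _) ?_ ?_ fun _ => id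
    · refine (ends_findNearest h h5 h6).seq_same fun s₁ ⟨hmin, hnear⟩ hs1 => ?_
      have hl1 := h.of_same hs1 rfl rfl rfl
      have hr0 : s₁.real 0 = s₀.real 0 := hs1.real 0 rfl
      refine (ends_reduceCosts hl1).seq_same fun s₂ hred hs2 => ?_
      have hl2 := hl1.of_same hs2 rfl rfl rfl
      rw [hr0] at hred
      refine (ends_mergeSort hl2 hm).seq_same fun s₃ hsort hs3 => ?_
      have hl3 := hl2.of_same hs3 rfl rfl rfl
      have hd2 : s₃.real 2 = s₂.real 2 := hs3.real 2 rfl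
      refine (ends_setParameters hl3).seq_same fun s₄ hr4 hs4 => ?_
      rw [hd2] at hr4
      set d := s₂.real 2 with hd
      have hd0 : ∀ t < E.m, 0 ≤ d t := fun t ht => by
        rw [(hred t ht).1]; linarith [(hmin t ht).1]
      have hsort' : SortedCopy E.m d (s₄.real 3) := by
        rw [hs4.real 3 rfl]
        refine ⟨hsort.mono, fun x hx => ?_, fun x hx => ?_⟩
        · obtain ⟨y, hy, hxy⟩ := hsort.source x hx
          exact ⟨y, hy, by rw [hxy, (hred y hy).2]⟩
        · obtain ⟨y, hy, hxy⟩ := hsort.cover x hx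
          exact ⟨y, hy, by rw [hxy, (hred x hx).2]⟩
      have hnear' : ∀ j, (∃ t < E.m, E.customer t = j) →
          ∃ t < E.m, E.customer t = j ∧ E.center t = s₁.nat 6 j ∧ d t ≤ 0 := by
        rintro j ⟨t, ht, rfl⟩
        obtain ⟨t', ht', h1, h2, h3⟩ := (hmin t ht).2
        refine ⟨t', ht', h1, h2, ?_⟩
        rw [(hred t' ht').1, h1, h3, sub_self]
      have hzero : ∃ t < E.m, d t ≤ 0 := by
        obtain ⟨t, ht, -, -, h1⟩ := hnear' _ ⟨0, hm, rfl⟩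
        exact ⟨t, ht, h1⟩
      refine (ends_searchThreshold hk hn hnm hd0 hr4 hsort' hzero).seq_same
        fun s₅ ⟨hr5, hsaved⟩ hs5 => ?_
      have h6' : s₅.nat 6 = s₁.nat 6 := by
        rw [hs5.nat 6 rfl, hs4.nat 6 rfl, hs3.nat 6 rfl, hs2.nat 6 rfl]
      have hlist' : Listing s₅ ∅ :=
        ((((hlist.of_same hs1 rfl rfl rfl).of_same hs2 rfl rfl rfl).of_same hs3 rfl rfl
          rfl).of_same hs4 rfl rfl rfl).of_same hs5 rfl rfl rfl
      have hp : ∀ j, s₅.nat 6 j < E.p := by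
        intro j
        rw [h6']
        rcases hnear j with h1 | ⟨t, ht, h1⟩
        -- The default entry `0` of a customer without edges is a valid center since some center
        -- exists.
        · rw [h1]; exact (Nat.zero_le _).trans_lt (E.center_lt 0 hm)
        · rw [← h1]; exact E.center_lt t ht
      refine (ends_finish hr5 hk hn hlist' hsaved hp (by rwa [h6'])).mono le_rfl ?_
      rintro s ⟨C, hC, hcard, hlt, hcost⟩
      refine ⟨C, hC, hcard, hlt, fun B hB => ?_⟩
      obtain ⟨g, hg, hserved⟩ := hcost _ (hB.shift fun t ht => (hred t ht).1)
      refine ⟨fun j => s₁.real 1 j + g j, ?_, fun j hj => ?_⟩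
      · rw [Finset.sum_add_distrib]; linarith
      · obtain ⟨t, ht, h1, h2, h3⟩ := hserved j hj
        refine ⟨t, ht, h1, h2, ?_⟩
        rw [(hred t ht).1, h1] at h3
        linarith
    · set l := Nat.log 2 E.m
      set M := E.m + 1
      set S := T + 2 * k + 1 with hS
      have h1 : M * 1 * (l + 3) ≤ M * S * (l + 3) :=
        Nat.mul_le_mul_right _ (Nat.mul_le_mul_left _ (by omega))
      have h2 : M * (T + 1) * (l + 3) ≤ M * S * (l + 3) :=
        Nat.mul_le_mul_right _ (Nat.mul_le_mul_left _ (by omega))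
      have h3 : (E.n + 1) * S * 1 ≤ M * S * (l + 3) :=
        Nat.mul_le_mul (Nat.mul_le_mul_right _ (by omega)) (by omega)
      have h4 : M * 1 ≤ M * (l + 3) := Nat.mul_le_mul_left _ (by omega)
      have h5 : M * (l + 2) ≤ M * (l + 3) := Nat.mul_le_mul_left _ (by omega)
      have h6 : 1 ≤ M := by omega
      have e1 : 1000 * M * (l + 2) = 1000 * (M * (l + 2)) := by ring
      have e2 : 4000 * M * (T + 1) * (l + 3) = 4000 * (M * (T + 1) * (l + 3)) := by ring
      have e3 : 400 * (E.n + 1) * S = 400 * ((E.n + 1) * S * 1) := by ring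
      rw [e1, e2, e3]
      change _ ≤ 10000 * (M * S * (l + 3))
      rw [mul_one] at h1 h4
      omega
  · simp only [Test.Holds, NatExpr.eval, h.n_eq, h.m_eq] at hnm
    rw [if_neg hnm]
    exact (Ends.of_wp (P := .skip) (Q := fun s => ∃ C, Listing s C ∧
      Solution E k (s₀.real 0) C) ⟨∅, hlist, by simp, by simp, fun B hB =>
        absurd hB.card_le hnm⟩)

/-! ### The running time -/

/-- With `log m ≥ 1` and `log (n/k) ≥ 2/3`, the three factors are at most `2m`, `8k log (n/k)` and
`5 log m`; the constant is `10000 * 2 * 8 * 5`. -/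
theorem timeBound_le {k n m : ℕ} (hk : 1 ≤ k) (hn : 2 * k < n) (hnm : n ≤ m) :
    (timeBound k n m : ℝ) ≤
      800000 * ((k : ℝ) * m * Real.log ((n : ℝ) / k) * Real.log m) := by
  have hk0 : (1 : ℝ) ≤ k := by exact_mod_cast hk
  have hn2 := two_mul_lt_cast hn
  have hm3 : (3 : ℝ) ≤ m := by
    have : 3 ≤ m := by omega
    exact_mod_cast this
  have hlogm : 1 ≤ Real.log m := by
    rw [Real.le_log_iff_exp_le (by linarith)]
    linarith [Real.exp_one_lt_d9]
  have hlog2 := Real.log_two_gt_d9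
  have hlam : 2 / 3 ≤ Real.log ((n : ℝ) / k) := by
    have : Real.log 2 ≤ Real.log ((n : ℝ) / k) :=
      Real.log_le_log (by norm_num) (by rw [le_div_iff₀ (by linarith)]; linarith)
    linarith
  have hl : (Nat.log 2 m : ℝ) + 3 ≤ 5 * Real.log m := by
    have h1 : (Nat.log 2 m : ℝ) * Real.log 2 ≤ Real.log m := by
      rw [← Real.log_pow]
      refine Real.log_le_log (by positivity) ?_
      exact_mod_cast Nat.pow_log_le_self 2 (by omega)
    nlinarith [(Nat.log 2 m).cast_nonneg (α := ℝ)]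
  have hT : (numSteps k n : ℝ) ≤ greedySize k n := by
    exact_mod_cast numSteps_le hk hn
  have hS : ((numSteps k n : ℝ) + 2 * k + 1) ≤ 8 * (k * Real.log ((n : ℝ) / k)) := by
    have h1 := greedySize_lt hk hn
    nlinarith
  have hkl : 0 ≤ k * Real.log ((n : ℝ) / k) := mul_nonneg (by linarith) (by linarith)
  rw [timeBound]
  push_cast
  have h1 : ((m : ℝ) + 1) * (numSteps k n + 2 * k + 1) ≤
      (2 * m) * (8 * (k * Real.log ((n : ℝ) / k))) :=
    mul_le_mul (by linarith) hS (by positivity) (by linarith)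
  have h2 : ((m : ℝ) + 1) * (numSteps k n + 2 * k + 1) * (Nat.log 2 m + 3) ≤
      (2 * m) * (8 * (k * Real.log ((n : ℝ) / k))) * (5 * Real.log m) :=
    mul_le_mul h1 hl (by positivity) (by positivity)
  calc _ ≤ 10000 * ((2 * m) * (8 * (k * Real.log ((n : ℝ) / k))) * (5 * Real.log m)) :=
        mul_le_mul_of_nonneg_left h2 (by norm_num)
    _ = _ := by ring

/-! ### Instances -/

section

variable {p n : ℕ} (c : Fin p → Fin n → ℝ≥0∞) (k : ℕ) (e : Fin (edges c).card ≃ edges c)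

/-- The edges of an instance as a list. -/
noncomputable def edgeList : EdgeList where
  m := (edges c).card
  n := n
  p := p
  center t := if h : t < (edges c).card then ((e ⟨t, h⟩).1.1 : ℕ) else 0
  customer t := if h : t < (edges c).card then ((e ⟨t, h⟩).1.2 : ℕ) else 0
  center_lt t ht := by rw [dif_pos ht]; exact (e ⟨t, ht⟩).1.1.2
  customer_lt t ht := by rw [dif_pos ht]; exact (e ⟨t, ht⟩).1.2.2
  inj t ht t' ht' h1 h2 := by
    rw [dif_pos ht, dif_pos ht'] at h1 h2
    have := e.injective (Subtype.ext (Prod.ext (Fin.ext h1) (Fin.ext h2)))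
    exact Fin.mk.inj_iff.1 this

theorem loaded_input : Loaded (edgeList c e) k (input c k e) where
  k_eq := by simp [input]
  n_eq := by simp [input, edgeList]
  m_eq := by simp [input, edgeList]
  center := by funext t; simp [input, edgeList]
  customer := by funext t; simp [input, edgeList]

variable {c e}

theorem mem_edges {q : Fin p × Fin n} : q ∈ edges c ↔ c q.1 q.2 ≠ ∞ := by
  simp [edges]

/-- Translates sums along the edge list into sums over all pairs, independently of the order of the
list. -/
theorem sum_edges (F : Fin p × Fin n → ℝ) (hF : ∀ q, q ∉ edges c → F q = 0) :
    ∑ t ∈ Finset.range (edges c).card,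
      (if h : t < (edges c).card then F (e ⟨t, h⟩).1 else 0) = ∑ q, F q := by
  rw [Finset.sum_range]
  simp only [Fin.is_lt, dite_true, Fin.eta]
  rw [Equiv.sum_comp e (fun q => F q.1), Finset.sum_coe_sort (edges c) F]
  exact Finset.sum_subset (Finset.subset_univ _) fun q _ hq => hF q hq

variable {k}

/-- A feasible solution of finite cost, in terms of the list of edges. -/
theorem LPFeasible.lpValue {x : Fin p → ℝ≥0} {y : Fin p → Fin n → ℝ≥0} (h : LPFeasible k x y)
    (hfin : ∑ i, ∑ j, c i j * (y i j : ℝ≥0∞) ≠ ∞) :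
    (edgeList c e).LPValue ((input c k e).real 0) k
      (∑ i, ∑ j, c i j * (y i j : ℝ≥0∞)).toReal := by
  have hterm : ∀ i j, c i j * (y i j : ℝ≥0∞) ≠ ∞ := by
    intro i j
    have h1 := ENNReal.sum_ne_top.1 hfin i (Finset.mem_univ i)
    exact ENNReal.sum_ne_top.1 h1 j (Finset.mem_univ j)
  -- Finite total cost forces `y` to vanish on pairs of infinite cost, which are not listed.
  have hy0 : ∀ q : Fin p × Fin n, q ∉ edges c → y q.1 q.2 = 0 := by
    intro q hq
    rw [mem_edges, not_not] at hq
    by_contra hne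
    exact hterm q.1 q.2 (by rw [hq, ENNReal.top_mul (by exact_mod_cast hne)])
  refine ⟨fun i => if hi : i < p then (x ⟨i, hi⟩ : ℝ) else 0,
    fun t => if ht : t < (edges c).card then (y (e ⟨t, ht⟩).1.1 (e ⟨t, ht⟩).1.2 : ℝ) else 0,
    ?_, ?_, ?_, ?_, ?_⟩
  · change ∑ i ∈ Finset.range p, _ = _
    rw [Finset.sum_range]
    simp only [Fin.is_lt, dite_true, Fin.eta]
    exact_mod_cast h.size
  · intro i
    simp only
    split_ifs
    exacts [NNReal.coe_nonneg _, le_rfl]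
  · intro t ht
    have ht' : t < (edges c).card := ht
    simp only [dif_pos ht', edgeList, Fin.is_lt, dite_true, Fin.eta]
    exact ⟨NNReal.coe_nonneg _, NNReal.coe_le_coe.2 (h.le _ _)⟩
  · intro j hj
    have key := sum_edges (e := e) (fun q => if (q.2 : ℕ) = j then (y q.1 q.2 : ℝ) else 0)
      fun q hq => by simp [hy0 q hq]
    refine Eq.trans (Finset.sum_congr rfl fun t ht => ?_) (key.trans ?_)
    · have ht' : t < (edges c).card := Finset.mem_range.1 ht
      simp only [edgeList, dif_pos ht']
    · rw [Fintype.sum_prod_type]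
      have hj' : j < n := hj
      have := h.assigned ⟨j, hj'⟩
      have e1 : ∀ i, ∑ j' : Fin n, (if (j' : ℕ) = j then (y i j' : ℝ) else 0) = y i ⟨j, hj'⟩ := by
        intro i
        rw [Finset.sum_eq_single ⟨j, hj'⟩]
        · simp
        · intro j' _ hne
          rw [if_neg fun h => hne (Fin.ext h)]
        · simp
      simp only [e1]
      exact_mod_cast this
  · have key := sum_edges (e := e) (fun q => (c q.1 q.2).toReal * (y q.1 q.2 : ℝ))
      fun q hq => by simp [hy0 q hq]
    refine le_of_eq (Eq.trans (Finset.sum_congr rfl fun t ht => ?_) (key.trans ?_))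
    · have ht' : t < (edges c).card := Finset.mem_range.1 ht
      simp [input, dif_pos ht']
    · rw [Fintype.sum_prod_type, ENNReal.toReal_sum fun i _ =>
        ENNReal.sum_ne_top.2 fun j _ => hterm i j]
      refine Finset.sum_congr rfl fun i _ => ?_
      rw [ENNReal.toReal_sum fun j _ => hterm i j]
      refine Finset.sum_congr rfl fun j _ => ?_
      rw [ENNReal.toReal_mul, ENNReal.coe_toReal]

/-- Feasible solutions of infinite cost impose nothing. For the others, the real bound on each
customer's edge is carried back to extended costs; the bounds `f j` are nonnegative, so
`ENNReal.ofReal` commutes with their sum. -/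
theorem Solution.cost_le_lpOpt {C : Finset ℕ}
    (h : Solution (edgeList c e) k ((input c k e).real 0) C) :
    KMedian.cost c (Finset.univ.filter fun i : Fin p => (i : ℕ) ∈ C) ≤ lpOpt c k := by
  refine le_iInf fun x => le_iInf fun y => le_iInf fun hxy => ?_
  by_cases hfin : ∑ i, ∑ j, c i j * (y i j : ℝ≥0∞) = ∞
  · rw [hfin]; exact le_top
  obtain ⟨f, hf, hserved⟩ := h.cost _ (hxy.lpValue hfin)
  have hj : ∀ j : Fin n, 0 ≤ f j ∧
      ⨅ i ∈ Finset.univ.filter fun i : Fin p => (i : ℕ) ∈ C, c i j ≤ ENNReal.ofReal (f j) := by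
    intro j
    obtain ⟨t, ht, h1, h2, h3⟩ := hserved j j.2
    have ht' : t < (edges c).card := ht
    simp only [edgeList, dif_pos ht'] at h1 h2
    have hj : (e ⟨t, ht'⟩).1.2 = j := Fin.ext h1
    have hw : (input c k e).real 0 t = (c (e ⟨t, ht'⟩).1.1 j).toReal := by
      simp [input, dif_pos ht', hj]
    rw [hw] at h3
    have hne : c (e ⟨t, ht'⟩).1.1 j ≠ ∞ := by
      have := mem_edges.1 (e ⟨t, ht'⟩).2
      rwa [hj] at this
    refine ⟨ENNReal.toReal_nonneg.trans h3, ?_⟩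
    refine (iInf₂_le (e ⟨t, ht'⟩).1.1 (by simpa using h2)).trans ?_
    rw [← ENNReal.ofReal_toReal hne]
    exact ENNReal.ofReal_le_ofReal h3
  calc KMedian.cost c _ ≤ ∑ j : Fin n, ENNReal.ofReal (f j) := Finset.sum_le_sum fun j _ => (hj j).2
    _ = ENNReal.ofReal (∑ j : Fin n, f j) :=
        (ENNReal.ofReal_sum_of_nonneg fun j _ => (hj j).1).symm
    _ ≤ ENNReal.ofReal (∑ i, ∑ j, c i j * (y i j : ℝ≥0∞)).toReal := by
        refine ENNReal.ofReal_le_ofReal (le_trans (le_of_eq ?_) hf)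
        exact (Finset.sum_range f).symm
    _ = _ := ENNReal.ofReal_toReal hfin

/-- The relaxation is a lower bound on the cost of every set of at most `k` centers. -/
theorem lpOpt_le_cost (hn : 0 < n) {C : Finset (Fin p)} (hC : C.card ≤ k) :
    lpOpt c k ≤ cost c C := by
  classical
  rcases C.eq_empty_or_nonempty with rfl | ⟨i₀, hi₀⟩
  · have : cost c (∅ : Finset (Fin p)) = ∞ := by
      rw [cost, ENNReal.sum_eq_top]
      exact ⟨⟨0, hn⟩, Finset.mem_univ _, by simp⟩
    rw [this]; exact le_top
  choose sel hsel hmin using fun j => C.exists_min_image (fun i => c i j) ⟨i₀, hi₀⟩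
  -- The relaxation demands total size exactly `k`, so the unused `k - |C|` is put on one center of
  -- `C`.
  set x : Fin p → ℝ≥0 := fun i =>
    (if i ∈ C then 1 else 0) + if i = i₀ then ((k - C.card : ℕ) : ℝ≥0) else 0
  set y : Fin p → Fin n → ℝ≥0 := fun i j => if i = sel j then 1 else 0
  have hxy : LPFeasible k x y := by
    refine ⟨fun i j => ?_, fun j => ?_, ?_⟩
    · by_cases h1 : i = sel j
      · simp [x, y, h1, hsel j]
      · simp [y, h1]
    · simp [y]
    · simp only [x, Finset.sum_add_distrib, Finset.sum_ite_eq', Finset.mem_univ, if_true,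
        Finset.sum_ite_mem, Finset.univ_inter, Finset.sum_const, nsmul_eq_mul, mul_one]
      rw [← Nat.cast_add, Nat.add_sub_cancel' hC]
  have hle : lpOpt c k ≤ ∑ i, ∑ j, c i j * (y i j : ℝ≥0∞) := by
    rw [lpOpt]
    exact iInf_le_of_le x (iInf_le_of_le y (iInf_le _ hxy))
  refine hle.trans ?_
  rw [Finset.sum_comm]
  refine Finset.sum_le_sum fun j _ => ?_
  have : ∑ i, c i j * (y i j : ℝ≥0∞) = c (sel j) j := by
    rw [Finset.sum_eq_single (sel j)]
    · simp [y]
    · intro i _ hi; simp [y, hi]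
    · simp
  rw [this]
  exact le_iInf₂ fun i hi => hmin j i hi

theorem isOutput_of_listing {s : Memory} {C : Finset ℕ} (h : Listing s C) (hp : ∀ i ∈ C, i < p) :
    IsOutput s (Finset.univ.filter fun i : Fin p => (i : ℕ) ∈ C) ∧
      (Finset.univ.filter fun i : Fin p => (i : ℕ) ∈ C).card = C.card := by
  have himage : (Finset.univ.filter fun i : Fin p => (i : ℕ) ∈ C).image Fin.val = C := by
    ext i
    simp only [Finset.mem_image, Finset.mem_filter, Finset.mem_univ, true_and]
    exact ⟨fun ⟨a, ha, h⟩ => h ▸ ha, fun hi => ⟨⟨i, hp i hi⟩, hi, rfl⟩⟩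
  have hcard : (Finset.univ.filter fun i : Fin p => (i : ℕ) ∈ C).card = C.card := by
    conv_rhs => rw [← himage]
    exact (Finset.card_image_of_injective _ Fin.val_injective).symm
  exact ⟨⟨by rw [hcard, h.count], by rw [hcard, himage, h.image]⟩, hcard⟩

end

end KMedian

/-! ### The theorem -/

theorem mainTheorem1 :
    (∀ k n : ℕ, 2 ≤ k → 2 * k < n →
      KMedian.sizeRatio k n < 1 + 2 * Real.log ((n : ℝ) / k)) ∧
    ∃ (P : RealRAM.Program) (K : ℝ),
      ∀ (p n k : ℕ) (c : Fin p → Fin n → ENNReal), 1 ≤ k → 2 * k < n →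
        ∀ e : Fin (KMedian.edges c).card ≃ KMedian.edges c,
          ∃ (t : ℕ) (s : RealRAM.Memory) (C : Finset (Fin p)),
            RealRAM.Runs P (KMedian.input c k e) t s ∧
            KMedian.IsOutput s C ∧
            (t : ℝ) ≤ K * max 1 ((k : ℝ) * ((KMedian.edges c).card : ℝ) *
              Real.log ((n : ℝ) / k) * Real.log ((KMedian.edges c).card : ℝ)) ∧
            (C.card : ℝ) ≤ KMedian.sizeRatio k n * k ∧
            KMedian.cost c C ≤ KMedian.lpOpt c k ∧
            ∀ C' : Finset (Fin p), C'.card ≤ k → KMedian.cost c C ≤ KMedian.cost c C' := by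
  -- Besides the `800000` of `KMedian.timeBound_le`, the constant covers the initial test and the
  -- immediate exit, which take a bounded number of steps.
  refine ⟨fun k n hk hn => KMedian.sizeRatio_lt hn hk, KMedian.medianProgram, 800010, ?_⟩
  intro p n k c hk hn e
  obtain ⟨t, s, hrun, ht, C, hC, hsol⟩ := KMedian.ends_medianProgram (KMedian.loaded_input c k e)
    hk hn (by simp [KMedian.input]) (by simp [KMedian.input]) (by simp [KMedian.input])
    (by simp [KMedian.input])
  obtain ⟨hout, hcard⟩ := KMedian.isOutput_of_listing (p := p) hC hsol.lt
  have hcost := hsol.cost_le_lpOpt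
  refine ⟨t, s, _, hrun, hout, ?_, ?_, hcost, fun C' hC' =>
    hcost.trans (KMedian.lpOpt_le_cost (by omega) hC')⟩
  · set V := (k : ℝ) * ((KMedian.edges c).card : ℝ) *
      Real.log ((n : ℝ) / k) * Real.log ((KMedian.edges c).card : ℝ) with hV
    have ht' : (t : ℝ) ≤ 7 + ((if n ≤ (KMedian.edges c).card then
        KMedian.timeBound k n (KMedian.edges c).card else 1 : ℕ) : ℝ) := by
      exact_mod_cast ht
    have h1 : (1 : ℝ) ≤ max 1 V := le_max_left _ _
    have h2 : V ≤ max 1 V := le_max_right _ _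
    split_ifs at ht' with hnm
    · have := KMedian.timeBound_le hk hn hnm
      linarith
    · push_cast at ht'
      linarith
  · have h0 : (0 : ℝ) < k := by exact_mod_cast hk
    rw [hcard, KMedian.sizeRatio, add_mul, div_mul_cancel₀ _ h0.ne']
    have h1 : ((C.card : ℕ) : ℝ) ≤ KMedian.numSteps k n + 2 * k := by
      exact_mod_cast hsol.card_le
    have h2 : (KMedian.numSteps k n : ℝ) ≤ KMedian.greedySize k n := by
      exact_mod_cast KMedian.numSteps_le hk hn
    linarith
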